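/- **Setting.** All Lie groups are finite-dimensional, over $\Bbbk=\mathbb R$ (smooth) or $\Bbbk=\mathbb C$ (holomorphic). Lie subgroups may be immersed. For a Lie group $A$ with Lie algebra $\mathcal A$, the left and right gradients $\nabla_a f,\nabla'_a f\in\mathcal A^*$ of a function $f$ on $A$ are $\langle\nabla_a f,X\rangle=\frac{d}{dt}f(e^{tX}a)|_{t=0}$ and $\langle\nabla'_a f,X\rangle=\frac{d}{dt}f(ae^{tX})|_{t=0}$, and $aXa^{-1}$ denotes $\mathrm{Ad}_aX$. Let $G$ be a connected Lie group with Lie algebra $\mathcal G$, and let $R\in\mathcal G\wedge\mathcal G$ be such that $\mathcal I_R=[R_{12},R_{13}]+[R_{12},R_{23}]+[R_{13},R_{23}]$ is $G$-invariant. Equip $G$ with the Poisson–Lie structure $\{\phi_1,\phi_2\}_G=\langle\nabla'\phi_1\otimes\nabla'\phi_2,R\rangle-\langle\nabla\phi_1\otimes\nabla\phi_2,R\rangle$. Let $H\subseteq K\subseteq G$ be connected Poisson–Lie subgroups with Lie algebras $\mathcal H\subseteq\mathcal K\subseteq\mathcal G$. Let $K^*$ be a connected dual Poisson–Lie group of $K$: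 its Lie algebra is the dual space $\mathcal K^*$ with $\langle X,[\alpha,\beta]\rangle=-\langle\alpha\otimes\beta,[X\otimes1+1\otimes X,R]\rangle$ for $X\in\mathcal K$, $\alpha,\beta\in\mathcal K^*$. Let $D(K,K^*)$ be a Drinfeld double: a Lie group containing $K$ and $K^*$ as Lie subgroups, with Lie algebra $\mathcal K\oplus\mathcal K^*$ carrying an invariant nondegenerate symmetric bilinear form $\langle\langle\ ,\ \rangle\rangle$ that vanishes on $\mathcal K$ and on $\mathcal K^*$ and restricts to the canonical pairing of $\mathcal K$ with $\mathcal K^*$. For $Y$ in this Lie algebra write $Y=Y_{\mathcal K}+Y_{\mathcal K^*}$. The Poisson bracket on $K^*$ is $\{f_1,f_2\}_{K^*}(\kappa)=\langle\langle\nabla_\kappa f_1,\kappa(\nabla'_\kappa f_2)\kappa^{-1}\rangle\rangle$, with gradients in $(\mathcal K^*)^*=\mathcal K$. For open $\check K^*\subseteq K^*$ and a map $r:\check K^*\to\mathcal G\wedge\mathcal G$, let $\{\ ,\ \}_{Q(\check K^*)}$ be the bracket (biderivation) on $Q(\check K^*)=G\times\check K^*$ given, for functions $\phi,\phi_1,\phi_2$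 of $g\in G$ and $f,f_1,f_2$ of $\kappa\in\check K^*$, by $$\{f_1,f_2\}(g,\kappa)=\{f_1,f_2\}_{K^*}(\kappa),\qquad \{\phi,f\}(g,\kappa)=\langle\nabla'_g\phi,\nabla_\kappa f\rangle,$$ $$\{\phi_1,\phi_2\}(g,\kappa)=\langle\nabla'_g\phi_1\otimes\nabla'_g\phi_2,R+r(\kappa)\rangle-\langle\nabla_g\phi_1\otimes\nabla_g\phi_2,R\rangle .$$ Let $r:\check K^*\to\mathcal G\wedge\mathcal G$ be a (possibly zero) *triangular Poisson–Lie dynamical $r$-matrix* for $K\subseteq G$, i.e. a smooth (holomorphic) map such that the derivative of $r$ along the dressing vector field $\kappa\mapsto\kappa(\kappa^{-1}X\kappa)_{\mathcal K^*}$ equals $[X\otimes1+1\otimes X,r]$ for all $X\in\mathcal K$, and $$[R_{12}+r_{12},R_{23}+r_{23}]+K^a_1\mathcal L_{K_a}r_{23}+\text{cycl. perm.}=\mathcal I_R,$$ where $\{K^a\}\subset\mathcal K$, $\{K_a\}\subset\mathcal K^*$ are dual bases, summation over $a$ is understood, and $(\mathcal L_Xf)(\kappa)=\langle\nabla_\kappa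 f,X\rangle$. **Structural conditions.** Let $\mathcal K=\mathcal H\oplus\mathcal M$ be a vector space decomposition with $[\mathcal H,\mathcal M]\subseteq\mathcal M$, such that $\mathcal H^\perp\subseteq\mathcal K^*$ is an ideal and $\mathcal H^*:=\mathcal M^\perp\subseteq\mathcal K^*$ is a Lie subalgebra. Let $H^*\subseteq K^*$ be the connected Lie subgroup with Lie algebra $\mathcal H^*$; with the pairing inherited from $\mathcal K\times\mathcal K^*$ it is a dual group of $H$, and $D(H,H^*)$ denotes any corresponding Drinfeld double. Let $\{M^i\}$ be a basis of $\mathcal M$, and let $\check H^*$ be a non-empty open submanifold of $H^*$ contained in $\check K^*$ such that the matrix $$C^{ij}(\lambda)=\langle\langle(\lambda M^i\lambda^{-1})_{\mathcal M},\lambda M^j\lambda^{-1}\rangle\rangle$$ is invertible for all $\lambda\in\check H^*$; here $Y_{\mathcal M}$ is the $\mathcal M$-component of $Y\in\mathcal M\oplus\mathcal H\oplus\mathcal K^*$. **Theorem 3.6.** Let $Q(\check H^*)=G\times\check H^*\subseteq Q(\check K^*)$. 1. $Q(\check H^*)$ is locally cut out of $Q(\check K^*)$ by second-class constraints. That is,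 every $\lambda_0\in\check H^*$ has an open neighbourhood $U_0$ in $\check H^*$ for which there are an open set $W\subseteq\check K^*$ and smooth functions $\xi_i$ on $W$ such that $U_0=\{\kappa\in W:\xi_i(\kappa)=0\ \forall i\}$ and, for all $\lambda\in U_0$ and $g\in G$, $\nabla'_\lambda\xi_i=M^i$ and $\{\xi_i,\xi_j\}_{Q(\check K^*)}(g,\lambda)=C^{ij}(\lambda)$. If $\check H^*$ is an embedded submanifold of $K^*$, one can in addition achieve $U_0=\check H^*\cap W$. Moreover, for any family of $\dim\mathcal M$ functions $Z_i$ on $Q(\check K^*)$, smooth at a point $q=(g,\lambda)\in Q(\check H^*)$, whose restrictions to $Q(\check H^*)$ vanish near $q$ and whose differentials at $q$ are linearly independent, the matrix $\{Z_i,Z_j\}_{Q(\check K^*)}(q)$ is invertible. 2. Every function $\Phi$ on $Q(\check H^*)$, smooth at a point, extends locally to a smooth function on $Q(\check K^*)$. For functions $\Phi_1,\Phi_2$ on $Q(\check H^*)$ with local smooth extensions $F_1,F_2$ near $q=(g,\lambda)\in Q(\check H^*)$, and any constraints $Z_i$ as in 1, the Dirac bracket at $q$, $$\{F_1,F_2\}(q)-\sum_{i,j}\{F_1,Z_i\}(q)\,\big(\{Z,Z\}(q)^{-1}\big)_{ij}\,\{Z_j,F_2\}(q),$$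 formed with $\{\ ,\ \}=\{\ ,\ \}_{Q(\check K^*)}$, equals $\{\Phi_1,\Phi_2\}_{Q(\check H^*)}(q)$. Here $\{\ ,\ \}_{Q(\check H^*)}$ is defined by the same formulas as above, with $H,H^*,D(H,H^*)$ in place of $K,K^*,D(K,K^*)$, and with the smooth map $r^*:\check H^*\to\mathcal G\wedge\mathcal G$ in place of $r$, where $$r^*(\lambda)=r(\lambda)+\rho(\lambda),\qquad \rho(\lambda)=\sum_{i,j}(C^{-1}(\lambda))_{ij}\,(\lambda M^i\lambda^{-1})_{\mathcal M}\otimes(\lambda M^j\lambda^{-1})_{\mathcal M}\in\mathcal M\wedge\mathcal M .$$ -/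

import Mathlib

open scoped Manifold ContDiff Topology TensorProduct

set_option linter.unusedSectionVars false

noncomputable section

namespace PLDirac

/-! ### Lie groups over `ℝ` or `ℂ`, their Lie algebras, and left/right derivatives -/

/-- Smooth (over `ℂ`: holomorphic) Lie groups are regular enough for Mathlib's Lie algebra of a
Lie group. -/
instance instLEInftyMinSmoothness (𝕜 : Type*) [RCLike 𝕜] :
    ENat.LEInfty (minSmoothness 𝕜 3) where
  out := by
    rw [minSmoothness_of_isRCLikeNormedField]
    exact (inferInstance : ENat.LEInfty 3).out

/-- The model of an `n`-dimensional manifold over `𝕜`. -/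
abbrev Model (𝕜 : Type*) [RCLike 𝕜] (n : ℕ) :
    ModelWithCorners 𝕜 (EuclideanSpace 𝕜 (Fin n)) (EuclideanSpace 𝕜 (Fin n)) :=
  𝓘(𝕜, EuclideanSpace 𝕜 (Fin n))

section Group

variable (𝕜 : Type*) [RCLike 𝕜] (n : ℕ) (A : Type*) [TopologicalSpace A]
  [ChartedSpace (EuclideanSpace 𝕜 (Fin n)) A] [Group A]

/-- The Lie algebra of an `n`-dimensional Lie group. -/
abbrev LieAlg : Type _ := GroupLieAlgebra (Model 𝕜 n) A

instance instFiniteDimensionalLieAlg : FiniteDimensional 𝕜 (LieAlg 𝕜 n A) :=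
  inferInstanceAs (FiniteDimensional 𝕜 (EuclideanSpace 𝕜 (Fin n)))

variable {A}

/-- The adjoint action `X ↦ a X a⁻¹`. -/
def Ad (a : A) : LieAlg 𝕜 n A →ₗ[𝕜] LieAlg 𝕜 n A :=
  ContinuousLinearMap.toLinearMap
    (mfderiv (Model 𝕜 n) (Model 𝕜 n) (fun x : A => a * x * a⁻¹) 1)

/-- The left gradient `∇_a f ∈ 𝒜*`: `⟨∇_a f, X⟩ = d/dt f(e^{tX} a)` at `t = 0`. -/
def leftGrad (f : A → 𝕜) (a : A) : Module.Dual 𝕜 (LieAlg 𝕜 n A) :=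
  ContinuousLinearMap.toLinearMap
    (mfderiv (Model 𝕜 n) 𝓘(𝕜, 𝕜) (fun x : A => f (x * a)) 1)

/-- The right gradient `∇'_a f ∈ 𝒜*`: `⟨∇'_a f, X⟩ = d/dt f(a e^{tX})` at `t = 0`. -/
def rightGrad (f : A → 𝕜) (a : A) : Module.Dual 𝕜 (LieAlg 𝕜 n A) :=
  ContinuousLinearMap.toLinearMap
    (mfderiv (Model 𝕜 n) 𝓘(𝕜, 𝕜) (fun x : A => f (a * x)) 1)

end Group

section Subgroup

variable (𝕜 : Type*) [RCLike 𝕜] (m n : ℕ)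
  (A : Type*) [TopologicalSpace A] [ChartedSpace (EuclideanSpace 𝕜 (Fin m)) A] [Group A]
  (B : Type*) [TopologicalSpace B] [ChartedSpace (EuclideanSpace 𝕜 (Fin n)) B] [Group B]

/-- `A` as a (possibly non-closed, i.e. immersed) Lie subgroup of `B`. -/
structure LieSubgroup where
  hom : A →* B
  smooth : ContMDiff (Model 𝕜 m) (Model 𝕜 n) ∞ hom
  injective : Function.Injective hom
  immersion : Function.Injective (mfderiv (Model 𝕜 m) (Model 𝕜 n) hom 1)

variable {𝕜 m n A B}

/-- The inclusion of Lie algebras induced by the inclusion of a Lie subgroup. -/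
def LieSubgroup.diff (j : LieSubgroup 𝕜 m n A B) : LieAlg 𝕜 m A →ₗ[𝕜] LieAlg 𝕜 n B :=
  haveI e : LieAlg 𝕜 m A →L[𝕜] LieAlg 𝕜 n B := mfderiv (Model 𝕜 m) (Model 𝕜 n) j.hom 1
  e.toLinearMap

theorem LieSubgroup.diff_injective (j : LieSubgroup 𝕜 m n A B) :
    Function.Injective j.diff := j.immersion

/-- A Lie subgroup of a Lie subgroup. -/
def LieSubgroup.comp {p : ℕ} {C : Type*} [TopologicalSpace C]
    [ChartedSpace (EuclideanSpace 𝕜 (Fin p)) C] [Group C]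
    (k : LieSubgroup 𝕜 n p B C) (j : LieSubgroup 𝕜 m n A B) : LieSubgroup 𝕜 m p A C where
  hom := k.hom.comp j.hom
  smooth := k.smooth.comp j.smooth
  injective := k.injective.comp j.injective
  immersion := by
    have hj : MDifferentiableAt (Model 𝕜 m) (Model 𝕜 n) j.hom 1 :=
      j.smooth.mdifferentiableAt (by simp)
    have hk : MDifferentiableAt (Model 𝕜 n) (Model 𝕜 p) k.hom (j.hom 1) :=
      k.smooth.mdifferentiableAt (by simp)
    have h : mfderiv (Model 𝕜 m) (Model 𝕜 p) (k.hom.comp j.hom) 1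
        = (mfderiv (Model 𝕜 n) (Model 𝕜 p) k.hom (j.hom 1)).comp
          (mfderiv (Model 𝕜 m) (Model 𝕜 n) j.hom 1) := mfderiv_comp 1 hk hj
    have h1 : Function.Injective (mfderiv (Model 𝕜 n) (Model 𝕜 p) k.hom (j.hom 1)) := by
      rw [map_one]; exact k.immersion
    rw [h]
    exact h1.comp j.immersion

end Subgroup

/-! ### Tensors over a Lie algebra -/

section Tensor

variable {𝕜 : Type*} [Field 𝕜] {L : Type*} [AddCommGroup L] [Module 𝕜 L]

/-- The pairing `⟨α ⊗ β, t⟩` for `t ∈ L ⊗ L`. -/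
def ev2 (α β : Module.Dual 𝕜 L) : L ⊗[𝕜] L →ₗ[𝕜] 𝕜 :=
  LinearMap.mul' 𝕜 𝕜 ∘ₗ TensorProduct.map α β

/-- The pairing `⟨α ⊗ β ⊗ γ, t⟩` for `t ∈ L ⊗ L ⊗ L`. -/
def ev3 (α β γ : Module.Dual 𝕜 L) : L ⊗[𝕜] (L ⊗[𝕜] L) →ₗ[𝕜] 𝕜 :=
  LinearMap.mul' 𝕜 𝕜 ∘ₗ TensorProduct.map α (ev2 β γ)

/-- `t ∈ L ∧ L`, viewed inside `L ⊗ L`. -/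
def IsSkew (t : L ⊗[𝕜] L) : Prop := TensorProduct.comm 𝕜 L L t = -t

end Tensor

section LieTensor

variable {𝕜 : Type*} [Field 𝕜] {L : Type*} [LieRing L] [LieAlgebra 𝕜 L]

/-- The Lie bracket as a linear map on `L ⊗ L`. -/
def lieT : L ⊗[𝕜] L →ₗ[𝕜] L := (LieModule.toModuleHom 𝕜 L L : L ⊗[𝕜] L →ₗ[𝕜] L)

/-- `[X ⊗ 1 + 1 ⊗ X, t]` for `t ∈ L ⊗ L`. -/
def adT (X : L) : L ⊗[𝕜] L →ₗ[𝕜] L ⊗[𝕜] L :=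
  TensorProduct.map (LieAlgebra.ad 𝕜 L X : L →ₗ[𝕜] L) LinearMap.id
    + TensorProduct.map LinearMap.id (LieAlgebra.ad 𝕜 L X : L →ₗ[𝕜] L)

/-- `[a₁₂, b₁₃]`, i.e. `(x ⊗ y, u ⊗ v) ↦ [x, u] ⊗ y ⊗ v`. -/
def br12_13 (a b : L ⊗[𝕜] L) : L ⊗[𝕜] (L ⊗[𝕜] L) :=
  TensorProduct.map lieT LinearMap.id (TensorProduct.tensorTensorTensorComm 𝕜 L L L L (a ⊗ₜ b))

/-- `[a₁₂, b₂₃]`, i.e. `(x ⊗ y, u ⊗ v) ↦ x ⊗ [y, u] ⊗ v`. -/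
def br12_23 (a b : L ⊗[𝕜] L) : L ⊗[𝕜] (L ⊗[𝕜] L) :=
  TensorProduct.map LinearMap.id
    (TensorProduct.map lieT LinearMap.id ∘ₗ (TensorProduct.assoc 𝕜 L L L).symm.toLinearMap)
    (TensorProduct.assoc 𝕜 L L (L ⊗[𝕜] L) (a ⊗ₜ b))

/-- `[a₁₃, b₂₃]`, i.e. `(x ⊗ y, u ⊗ v) ↦ x ⊗ u ⊗ [y, v]`. -/
def br13_23 (a b : L ⊗[𝕜] L) : L ⊗[𝕜] (L ⊗[𝕜] L) :=
  TensorProduct.assoc 𝕜 L L L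
    (TensorProduct.map LinearMap.id lieT
      (TensorProduct.tensorTensorTensorComm 𝕜 L L L L (a ⊗ₜ b)))

/-- `ℐ_R = [R₁₂, R₁₃] + [R₁₂, R₂₃] + [R₁₃, R₂₃]`. -/
def cyb (R : L ⊗[𝕜] L) : L ⊗[𝕜] (L ⊗[𝕜] L) := br12_13 R R + br12_23 R R + br13_23 R R

end LieTensor

/-- `R ∈ 𝒢 ∧ 𝒢` solves the (modified) classical Yang-Baxter equation: `ℐ_R` is invariant under
the group. Then `{φ₁, φ₂} = ⟨∇'φ₁ ⊗ ∇'φ₂, R⟩ - ⟨∇φ₁ ⊗ ∇φ₂, R⟩` is a coboundary Poisson-Lie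
structure on `G`. -/
structure IsCoboundaryRMatrix {𝕜 : Type*} [RCLike 𝕜] {n : ℕ} {G : Type*} [TopologicalSpace G]
    [ChartedSpace (EuclideanSpace 𝕜 (Fin n)) G] [Group G] [LieGroup (Model 𝕜 n) ∞ G]
    (R : LieAlg 𝕜 n G ⊗[𝕜] LieAlg 𝕜 n G) : Prop where
  skew : IsSkew R
  mcybe : ∀ g : G,
    TensorProduct.map (Ad 𝕜 n g) (TensorProduct.map (Ad 𝕜 n g) (Ad 𝕜 n g)) (cyb R) = cyb R

/-! ### The Drinfeld double of a Poisson-Lie group and its dual -/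

section Double

variable (𝕜 : Type*) [RCLike 𝕜] (nK nS nD : ℕ)
  (K : Type*) [TopologicalSpace K] [ChartedSpace (EuclideanSpace 𝕜 (Fin nK)) K] [Group K]
  (S : Type*) [TopologicalSpace S] [ChartedSpace (EuclideanSpace 𝕜 (Fin nS)) S] [Group S]
  (D : Type*) [TopologicalSpace D] [ChartedSpace (EuclideanSpace 𝕜 (Fin nD)) D] [Group D]
  [LieGroup (Model 𝕜 nD) ∞ D]

/-- `D` is a Drinfeld double group of the pair of groups `K`, `S = K*` in duality: `D` contains
`K` and `S` as Lie subgroups, and `Lie D = 𝒦 + 𝒦*` carries an invariant, symmetric,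
nondegenerate scalar product `⟨⟨ , ⟩⟩` for which `𝒦` and `𝒦*` are complementary and isotropic
(a Manin triple); thereby `𝒦*` is identified with the dual space of `𝒦`. -/
structure DrinfeldDouble where
  inK : LieSubgroup 𝕜 nK nD K D
  inS : LieSubgroup 𝕜 nS nD S D
  form : LinearMap.BilinForm 𝕜 (LieAlg 𝕜 nD D)
  symm : ∀ x y, form x y = form y x
  invariant : ∀ x y z : LieAlg 𝕜 nD D, form ⁅x, y⁆ z = form x ⁅y, z⁆
  nondegenerate : ∀ x, (∀ y, form x y = 0) → x = 0
  isotropicK : ∀ X Y, form (inK.diff X) (inK.diff Y) = 0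
  isotropicS : ∀ α β, form (inS.diff α) (inS.diff β) = 0
  isCompl : IsCompl (LinearMap.range inK.diff) (LinearMap.range inS.diff)

namespace DrinfeldDouble

variable {𝕜 nK nS nD K S D}
variable (d : DrinfeldDouble 𝕜 nK nS nD K S D)

/-- The pairing `⟨X, α⟩` of `X ∈ 𝒦` and `α ∈ 𝒦*`. -/
def pairing : LieAlg 𝕜 nK K →ₗ[𝕜] Module.Dual 𝕜 (LieAlg 𝕜 nS S) :=
  d.form.compl₁₂ d.inK.diff d.inS.diff

theorem pairing_apply (X : LieAlg 𝕜 nK K) (α : LieAlg 𝕜 nS S) :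
    d.pairing X α = d.form (d.inK.diff X) (d.inS.diff α) := rfl

theorem exists_add (x : LieAlg 𝕜 nD D) : ∃ X α, d.inK.diff X + d.inS.diff α = x := by
  have h : x ∈ LinearMap.range d.inK.diff ⊔ LinearMap.range d.inS.diff := by
    rw [d.isCompl.sup_eq_top]; trivial
  obtain ⟨_, ⟨X, rfl⟩, _, ⟨α, rfl⟩, rfl⟩ := Submodule.mem_sup.1 h
  exact ⟨X, α, rfl⟩

theorem pairing_injective : Function.Injective d.pairing := by
  rw [injective_iff_map_eq_zero]
  intro X hX
  apply d.inK.diff_injective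
  rw [map_zero]
  apply d.nondegenerate
  intro y
  obtain ⟨Y, α, rfl⟩ := d.exists_add y
  rw [map_add, d.isotropicK, zero_add, ← d.pairing_apply, hX, LinearMap.zero_apply]

theorem pairing_flip_injective : Function.Injective d.pairing.flip := by
  rw [injective_iff_map_eq_zero]
  intro α hα
  apply d.inS.diff_injective
  rw [map_zero]
  apply d.nondegenerate
  intro y
  obtain ⟨Y, β, rfl⟩ := d.exists_add y
  rw [map_add, d.isotropicS, add_zero, d.symm, ← d.pairing_apply, ← LinearMap.flip_apply, hα,
    LinearMap.zero_apply]

theorem pairing_bijective : Function.Bijective d.pairing := by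
  have h1 := LinearMap.finrank_le_finrank_of_injective d.pairing_injective
  have h2 := LinearMap.finrank_le_finrank_of_injective d.pairing_flip_injective
  rw [Subspace.dual_finrank_eq] at h1 h2
  refine ⟨d.pairing_injective, ?_⟩
  refine (LinearMap.injective_iff_surjective_of_finrank_eq_finrank ?_).1 d.pairing_injective
  rw [Subspace.dual_finrank_eq]
  exact le_antisymm h1 h2

/-- The identification `𝒦 ≃ (𝒦*)*`. -/
def dualEquiv : LieAlg 𝕜 nK K ≃ₗ[𝕜] Module.Dual 𝕜 (LieAlg 𝕜 nS S) :=
  LinearEquiv.ofBijective d.pairing d.pairing_bijective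

/-- The component `Y_𝒦` of `Y ∈ Lie D = 𝒦 + 𝒦*`. -/
def projK : LieAlg 𝕜 nD D →ₗ[𝕜] LieAlg 𝕜 nK K :=
  (LinearEquiv.ofInjective d.inK.diff d.inK.diff_injective).symm.toLinearMap ∘ₗ
    Submodule.projectionOnto _ _ d.isCompl

/-- The component `Y_{𝒦*}` of `Y ∈ Lie D = 𝒦 + 𝒦*`. -/
def projS : LieAlg 𝕜 nD D →ₗ[𝕜] LieAlg 𝕜 nS S :=
  (LinearEquiv.ofInjective d.inS.diff d.inS.diff_injective).symm.toLinearMap ∘ₗ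
    Submodule.projectionOnto _ _ d.isCompl.symm

/-- `κ X κ⁻¹ ∈ Lie D` for `κ ∈ K*` and `X ∈ 𝒦`. -/
def adK (κ : S) : LieAlg 𝕜 nK K →ₗ[𝕜] LieAlg 𝕜 nD D :=
  Ad 𝕜 nD (d.inS.hom κ) ∘ₗ d.inK.diff

/-- The Poisson bracket of `K*`, evaluated on functions with left gradient `X = ∇_κ f₁ ∈ 𝒦` and
right gradient `Y = ∇'_κ f₂ ∈ 𝒦`: it is `⟨⟨X, κ Y κ⁻¹⟩⟩`. -/
def dualPoisson (κ : S) (X Y : LieAlg 𝕜 nK K) : 𝕜 := d.form (d.inK.diff X) (d.adK κ Y)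

end DrinfeldDouble

end Double

/-! ### Poisson-Lie subgroups, the bracket on `Q`, dynamical `r`-matrices -/

section PoissonLie

variable {𝕜 : Type*} [RCLike 𝕜] {nG nK nS nD : ℕ}
  {G : Type*} [TopologicalSpace G] [ChartedSpace (EuclideanSpace 𝕜 (Fin nG)) G] [Group G]
  [LieGroup (Model 𝕜 nG) ∞ G]
  {K : Type*} [TopologicalSpace K] [ChartedSpace (EuclideanSpace 𝕜 (Fin nK)) K] [Group K]
  {S : Type*} [TopologicalSpace S] [ChartedSpace (EuclideanSpace 𝕜 (Fin nS)) S] [Group S]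
  [LieGroup (Model 𝕜 nS) ∞ S]
  {D : Type*} [TopologicalSpace D] [ChartedSpace (EuclideanSpace 𝕜 (Fin nD)) D] [Group D]
  [LieGroup (Model 𝕜 nD) ∞ D]

/-- The (connected) Lie subgroup `K ⊆ G` is a Poisson-Lie subgroup of `G` with the Poisson-Lie
structure given by `R`, and `S` is its dual. That is, for `X ∈ 𝒦` the linearized Poisson structure
`[X ⊗ 1 + 1 ⊗ X, R]` lies in `𝒦 ⊗ 𝒦` (its pairing with `φ ⊗ ψ` depends only on the restrictions
`α, β ∈ 𝒦*` of `φ, ψ` to `𝒦`) and is dual to the Lie bracket of `𝒦* = Lie S`.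
The sign is the one for which the bracket `qBracket` below, and the bracket `dualPoisson`, whose
linearization at the identity is *minus* the Lie bracket of `𝒦`, are compatible. -/
def IsPoissonLieSubgroup (j : LieSubgroup 𝕜 nK nG K G) (d : DrinfeldDouble 𝕜 nK nS nD K S D)
    (R : LieAlg 𝕜 nG G ⊗[𝕜] LieAlg 𝕜 nG G) : Prop :=
  ∀ (φ ψ : Module.Dual 𝕜 (LieAlg 𝕜 nG G)) (α β : LieAlg 𝕜 nS S),
    (∀ Y, φ (j.diff Y) = d.pairing Y α) → (∀ Y, ψ (j.diff Y) = d.pairing Y β) →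
      ∀ X : LieAlg 𝕜 nK K, ev2 φ ψ (adT (j.diff X) R) = -d.pairing X ⁅α, β⁆

/-- The bracket `{F₁, F₂}_Q` at a point `(g, κ)` of `Q = G × K*`, the biderivation determined by
`{f̂₁, f̂₂}(g, κ) = {f₁, f₂}_{K*}(κ)`, `{φ', f̂}(g, κ) = ⟨∇'_g φ, ∇_κ f⟩` and
`{φ₁', φ₂'}(g, κ) = ⟨∇'_g φ₁ ⊗ ∇'_g φ₂, R + r(κ)⟩ - ⟨∇_g φ₁ ⊗ ∇_g φ₂, R⟩`
for functions `φ` of `g` and `f` of `κ`. -/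
def qBracket (j : LieSubgroup 𝕜 nK nG K G) (d : DrinfeldDouble 𝕜 nK nS nD K S D)
    (R : LieAlg 𝕜 nG G ⊗[𝕜] LieAlg 𝕜 nG G) (r : S → LieAlg 𝕜 nG G ⊗[𝕜] LieAlg 𝕜 nG G)
    (F₁ F₂ : G × S → 𝕜) (q : G × S) : 𝕜 :=
  let gL (F : G × S → 𝕜) := leftGrad 𝕜 nG (fun g => F (g, q.2)) q.1
  let gR (F : G × S → 𝕜) := rightGrad 𝕜 nG (fun g => F (g, q.2)) q.1
  let kL (F : G × S → 𝕜) := d.dualEquiv.symm (leftGrad 𝕜 nS (fun κ => F (q.1, κ)) q.2)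
  let kR (F : G × S → 𝕜) := d.dualEquiv.symm (rightGrad 𝕜 nS (fun κ => F (q.1, κ)) q.2)
  d.dualPoisson q.2 (kL F₁) (kR F₂)
    + (gR F₁ (j.diff (kL F₂)) - gR F₂ (j.diff (kL F₁)))
    + (ev2 (gR F₁) (gR F₂) (R + r q.2) - ev2 (gL F₁) (gL F₂) R)

/-- `r : V → 𝒢 ∧ 𝒢` is an admissible map on the open set `V ⊆ K*`. (Smoothness is componentwise.) -/
structure IsAdmissible (V : Set S) (r : S → LieAlg 𝕜 nG G ⊗[𝕜] LieAlg 𝕜 nG G) : Prop where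
  skew : ∀ κ ∈ V, IsSkew (r κ)
  smooth : ∀ α β : Module.Dual 𝕜 (LieAlg 𝕜 nG G),
    ContMDiffOn (Model 𝕜 nS) 𝓘(𝕜, 𝕜) ∞ (fun κ => ev2 α β (r κ)) V

/-- `r : V → 𝒢 ∧ 𝒢` is a triangular Poisson-Lie dynamical `r`-matrix with respect to `K ⊆ G`. -/
structure IsTriangularRMatrix (j : LieSubgroup 𝕜 nK nG K G)
    (d : DrinfeldDouble 𝕜 nK nS nD K S D) (R : LieAlg 𝕜 nG G ⊗[𝕜] LieAlg 𝕜 nG G) (V : Set S)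
    (r : S → LieAlg 𝕜 nG G ⊗[𝕜] LieAlg 𝕜 nG G) : Prop
    extends IsAdmissible (𝕜 := 𝕜) (nG := nG) (nS := nS) V r where
  /-- `dress_X r = [X ⊗ 1 + 1 ⊗ X, r]`, where `dress_X κ = κ (κ⁻¹ X κ)_{𝒦*}`. -/
  equivariant : ∀ κ ∈ V, ∀ (X : LieAlg 𝕜 nK K) (α β : Module.Dual 𝕜 (LieAlg 𝕜 nG G)),
    rightGrad 𝕜 nS (fun κ' => ev2 α β (r κ')) κ (d.projS (d.adK κ⁻¹ X))
      = ev2 α β (adT (j.diff X) (r κ))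
  /-- `[R₁₂ + r₁₂, R₂₃ + r₂₃] + K₁^a 𝓛_{K_a} r₂₃ + cycl. perm. = ℐ_R`, paired with
  `α ⊗ β ⊗ γ`. -/
  cdybe : ∀ κ ∈ V, ∀ α β γ : Module.Dual 𝕜 (LieAlg 𝕜 nG G),
    let T (α β γ : Module.Dual 𝕜 (LieAlg 𝕜 nG G)) : 𝕜 :=
      ev3 α β γ (br12_23 (R + r κ) (R + r κ))
        + α (j.diff (d.dualEquiv.symm (leftGrad 𝕜 nS (fun κ' => ev2 β γ (r κ')) κ)))
    T α β γ + T β γ α + T γ α β = ev3 α β γ (cyb R)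

end PoissonLie

/-! ### Dirac brackets -/

section Dirac

variable {𝕜 Q ι : Type*} [Field 𝕜] [Fintype ι] [DecidableEq ι]

/-- The matrix `{Z_i, Z_j}(q)` of brackets of constraints. -/
def bracketMatrix (B : (Q → 𝕜) → (Q → 𝕜) → Q → 𝕜) (Z : ι → Q → 𝕜) (q : Q) : Matrix ι ι 𝕜 :=
  Matrix.of fun i j => B (Z i) (Z j) q

/-- The Dirac bracket associated with the bracket `B` and the constraints `Z`. -/
def diracBracket (B : (Q → 𝕜) → (Q → 𝕜) → Q → 𝕜) (Z : ι → Q → 𝕜) (F₁ F₂ : Q → 𝕜) (q : Q) : 𝕜 :=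
  B F₁ F₂ q - ∑ i, ∑ j, B F₁ (Z i) q * (bracketMatrix B Z q)⁻¹ i j * B (Z j) F₂ q

/-- `Q(T) = G × T` as a subset of `Q(S) = G × S`, for `T → S`. -/
def inclQ {G S T : Type*} (e : T → S) (p : G × T) : G × S := (p.1, e p.2)

end Dirac

/-! ### The reduction data -/

section Reduction

variable {𝕜 : Type*} [RCLike 𝕜] {nG nK nS nD nH nT : ℕ}
  {G : Type*} [TopologicalSpace G] [ChartedSpace (EuclideanSpace 𝕜 (Fin nG)) G] [Group G]
  {K : Type*} [TopologicalSpace K] [ChartedSpace (EuclideanSpace 𝕜 (Fin nK)) K] [Group K]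
  [LieGroup (Model 𝕜 nK) ∞ K]
  {S : Type*} [TopologicalSpace S] [ChartedSpace (EuclideanSpace 𝕜 (Fin nS)) S] [Group S]
  [LieGroup (Model 𝕜 nS) ∞ S]
  {D : Type*} [TopologicalSpace D] [ChartedSpace (EuclideanSpace 𝕜 (Fin nD)) D] [Group D]
  [LieGroup (Model 𝕜 nD) ∞ D]
  {H : Type*} [TopologicalSpace H] [ChartedSpace (EuclideanSpace 𝕜 (Fin nH)) H] [Group H]
  {T : Type*} [TopologicalSpace T] [ChartedSpace (EuclideanSpace 𝕜 (Fin nT)) T] [Group T]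

/-- The structural conditions on `H ⊆ K`, `T = H* ⊆ S = K*` and `ℳ ⊆ 𝒦`: `𝒦 = ℋ + ℳ` (direct),
`Lie H* = ℋ* = ℳ^⊥`, the annihilator `ℋ^⊥` is an ideal of `𝒦*`, and `[ℋ, ℳ] ⊆ ℳ`. -/
structure IsReductiveSplitting (d : DrinfeldDouble 𝕜 nK nS nD K S D)
    (i : LieSubgroup 𝕜 nH nK H K) (iS : LieSubgroup 𝕜 nT nS T S)
    (M : Submodule 𝕜 (LieAlg 𝕜 nK K)) : Prop where
  isCompl : IsCompl M (LinearMap.range i.diff)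
  dual_eq : ∀ α : LieAlg 𝕜 nS S,
    α ∈ LinearMap.range iS.diff ↔ ∀ X ∈ M, d.pairing X α = 0
  ideal : ∀ α β : LieAlg 𝕜 nS S, (∀ X, d.pairing (i.diff X) β = 0) →
    ∀ X, d.pairing (i.diff X) ⁅α, β⁆ = 0
  reductive : ∀ (X : LieAlg 𝕜 nH H), ∀ Y ∈ M, ⁅i.diff X, Y⁆ ∈ M

variable (d : DrinfeldDouble 𝕜 nK nS nD K S D) {i : LieSubgroup 𝕜 nH nK H K}
  {M : Submodule 𝕜 (LieAlg 𝕜 nK K)} (hM : IsCompl M (LinearMap.range i.diff))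

/-- `(λ X λ⁻¹)_ℳ` for `λ ∈ K*` and `X ∈ ℳ`: the component in `ℳ` with respect to
`Lie D = ℳ + ℋ + 𝒦*`. -/
def adM (l : S) : M →ₗ[𝕜] M :=
  Submodule.projectionOnto M (LinearMap.range i.diff) hM ∘ₗ d.projK ∘ₗ d.adK l ∘ₗ M.subtype

variable {ι : Type*} (b : ι → M)

/-- The constraint matrix `C^{ij}(λ) = ⟨⟨(λ M^i λ⁻¹)_ℳ, λ M^j λ⁻¹⟩⟩`. -/
def constraintMatrix (l : S) : Matrix ι ι 𝕜 :=
  Matrix.of fun p q => d.form (d.inK.diff (adM d hM l (b p))) (d.adK l (b q))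

/-- `ρ(λ) = ∑ (C⁻¹(λ))_{ij} (λ M^i λ⁻¹)_ℳ ⊗ (λ M^j λ⁻¹)_ℳ ∈ ℳ ⊗ ℳ`. -/
def rho [Fintype ι] [DecidableEq ι] (l : S) : M ⊗[𝕜] M :=
  ∑ p, ∑ q, (constraintMatrix d hM b l)⁻¹ p q • (adM d hM l (b p) ⊗ₜ[𝕜] adM d hM l (b q))

/-- The inclusion `ℳ ⊗ ℳ ⊆ 𝒢 ⊗ 𝒢`. -/
def inclMM (j : LieSubgroup 𝕜 nK nG K G) :
    M ⊗[𝕜] M →ₗ[𝕜] LieAlg 𝕜 nG G ⊗[𝕜] LieAlg 𝕜 nG G :=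
  TensorProduct.map (j.diff ∘ₗ M.subtype) (j.diff ∘ₗ M.subtype)

/-- The reduced map `r* = r + ρ`, as a function on `H*`. -/
def rStar [Fintype ι] [DecidableEq ι] (j : LieSubgroup 𝕜 nK nG K G)
    (iS : LieSubgroup 𝕜 nT nS T S) (r : S → LieAlg 𝕜 nG G ⊗[𝕜] LieAlg 𝕜 nG G) (u : T) :
    LieAlg 𝕜 nG G ⊗[𝕜] LieAlg 𝕜 nG G :=
  r (iS.hom u) + inclMM j (rho d hM b (iS.hom u))

end Reduction

end PLDirac

end

/-!
The proof rests on the Poisson tensor of `K*` at a point `κ`, read as the bilinear form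
`B(X, Y) = ⟨⟨(κ X κ⁻¹)_𝒦, κ Y κ⁻¹⟩⟩` on right gradients `X, Y ∈ 𝒦` (`poissonForm`). This reading is
possible because the left gradient of a function is the `𝒦`-component of its conjugated right
gradient (`leftGrad_eq_projK`), which is the invariance of the scalar product of the double.

At a point `λ ∈ H*`, the form `B` splits: `ℋ` and `ℳ` are orthogonal, on `ℋ` it is the Poisson tensor
of `H*`, and on `ℳ` it is the constraint matrix `C`. Indeed, the structural conditions say that the
isometric inclusion of `ℋ + ℋ*` into `𝒦 + 𝒦*` is equivariant under `ℋ*` (`doubleIncl_lie`). Since `H*`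
is connected, it is equivariant under `H*` (`doubleIncl_Ad`), where infinitesimal invariance is
integrated by `bilin_Ad_eq`; this needs that the derivative of `Ad` is the Lie bracket
(`hasDerivOne_Ad`). Hence `λ ℳ λ⁻¹` is orthogonal to `ℋ + ℋ*`, so that its `𝒦`-component lies in
`ℳ`, the annihilator of `ℋ*`.

A function that vanishes on `G × H*` has its gradient along `K*` in `ℳ`, and restriction of a function
to `G × H*` keeps exactly the `ℋ`-component of this gradient. So constraints with independent
differentials have gradients `∑ A_{ac} M^c` with an invertible matrix `A`, their bracket matrix is
`A C Aᵀ`, and `A` drops out of the Dirac bracket. The correction term then removes everything that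
involves the `ℳ`-components of the gradients of the two functions, and what remains is the bracket of
`G × H*` together with the pairing of the gradients along `G` with `ρ` (`diracBracket_eq`).

Local constraints and local extensions come from a slice: by the inverse function theorem, `K*` is
near a point of `H*` the product of `H*` and of a complement of `ℋ*` (`exists_slice`). The transversal
component, paired with the basis of `ℳ`, gives constraints with gradients `M^a`, and functions extend
by composition with the component in `H*`. For an immersed subgroup the slice sees one sheet only;
if `U` is embedded, the neighbourhood can be shrunk so that it misses the rest of `U`.
-/

noncomputable section

namespace PLDirac

/-! ### Derivatives at the identity of a Lie group -/

section Coordinates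

variable (𝕜 : Type*) [RCLike 𝕜] (n : ℕ) (A : Type*) [TopologicalSpace A]
  [ChartedSpace (EuclideanSpace 𝕜 (Fin n)) A] [Group A]

/-- The preferred chart of a Lie group at the identity. -/
abbrev chartOne : PartialEquiv A (EuclideanSpace 𝕜 (Fin n)) := extChartAt (Model 𝕜 n) (1 : A)

/-- The coordinates of the identity in the preferred chart at the identity. -/
abbrev origin : EuclideanSpace 𝕜 (Fin n) := chartOne 𝕜 n A 1

/-- The coordinates on the Lie algebra induced by the preferred chart at the identity. As a map
it is the identity, because Mathlib's tangent space is a copy of the model space; it serves to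
transport the norm, which the tangent space does not carry. -/
def coord : LieAlg 𝕜 n A ≃L[𝕜] EuclideanSpace 𝕜 (Fin n) :=
  ContinuousLinearEquiv.refl 𝕜 (EuclideanSpace 𝕜 (Fin n))

/-- The separation axiom that makes linear maps on the Lie algebra continuous. -/
instance instT2SpaceLieAlg : T2Space (LieAlg 𝕜 n A) :=
  inferInstanceAs (T2Space (EuclideanSpace 𝕜 (Fin n)))

variable {𝕜 n A} {F F' : Type*} [NormedAddCommGroup F] [NormedSpace 𝕜 F]
  [NormedAddCommGroup F'] [NormedSpace 𝕜 F']

/-- `L` is the derivative at the identity of the function `f` with values in a normed space,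
read in the preferred chart. -/
def HasDerivOne (f : A → F) (L : LieAlg 𝕜 n A →L[𝕜] F) : Prop :=
  HasFDerivAt (𝕜 := 𝕜) (fun x => f ((chartOne 𝕜 n A).symm x))
    (L ∘L (coord 𝕜 n A).symm.toContinuousLinearMap) (origin 𝕜 n A)

theorem chartOne_symm_origin : (chartOne 𝕜 n A).symm (origin 𝕜 n A) = 1 := extChartAt_to_inv _

theorem target_mem_nhds : (chartOne 𝕜 n A).target ∈ 𝓝 (origin 𝕜 n A) := extChartAt_target_mem_nhds _

theorem source_mem_nhds : (chartOne 𝕜 n A).source ∈ 𝓝 (1 : A) := extChartAt_source_mem_nhds _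

theorem tendsto_chartOne_symm :
    Filter.Tendsto (chartOne 𝕜 n A).symm (𝓝 (origin 𝕜 n A)) (𝓝 (1 : A)) := by
  have h := continuousAt_extChartAt_symm (I := Model 𝕜 n) (1 : A)
  unfold ContinuousAt at h
  rwa [extChartAt_to_inv] at h

theorem HasDerivOne.hasMFDerivAt {f : A → F} {L : LieAlg 𝕜 n A →L[𝕜] F} (h : HasDerivOne f L) :
    HasMFDerivAt (Model 𝕜 n) 𝓘(𝕜, F) f 1 L := by
  refine ⟨?_, ?_⟩
  · have h1 : ContinuousAt (fun a => f ((chartOne 𝕜 n A).symm (chartOne 𝕜 n A a))) 1 :=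
      ContinuousAt.comp (g := fun x => f ((chartOne 𝕜 n A).symm x)) (HasFDerivAt.continuousAt h)
        (continuousAt_extChartAt (I := Model 𝕜 n) (1 : A))
    refine h1.congr ?_
    filter_upwards [source_mem_nhds (𝕜 := 𝕜) (n := n)] with a ha
    rw [(chartOne 𝕜 n A).left_inv ha]
  · simp only [writtenInExtChartAt, mfld_simps]
    exact h.hasFDerivWithinAt

theorem HasMFDerivAt.hasDerivOne {f : A → F} {L : LieAlg 𝕜 n A →L[𝕜] F}
    (h : HasMFDerivAt (Model 𝕜 n) 𝓘(𝕜, F) f 1 L) : HasDerivOne f L := by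
  have := h.2
  simp only [writtenInExtChartAt, mfld_simps] at this
  exact this.hasFDerivAt Filter.univ_mem

theorem HasDerivOne.of_mdifferentiableAt {f : A → F}
    (h : MDifferentiableAt (Model 𝕜 n) 𝓘(𝕜, F) f 1) :
    HasDerivOne f (mfderiv (Model 𝕜 n) 𝓘(𝕜, F) f 1) :=
  HasMFDerivAt.hasDerivOne h.hasMFDerivAt

theorem HasDerivOne.unique {f : A → F} {L L' : LieAlg 𝕜 n A →L[𝕜] F} (h : HasDerivOne f L)
    (h' : HasDerivOne f L') : L = L' := by
  ext v
  exact congrArg (fun T : EuclideanSpace 𝕜 (Fin n) →L[𝕜] F => T (coord 𝕜 n A v))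
    (HasFDerivAt.unique h h')

theorem HasDerivOne.congr {f g : A → F} {L : LieAlg 𝕜 n A →L[𝕜] F} (h : HasDerivOne f L)
    (hfg : ∀ᶠ a in 𝓝 (1 : A), g a = f a) : HasDerivOne g L :=
  HasFDerivAt.congr_of_eventuallyEq h (tendsto_chartOne_symm.eventually hfg)

theorem hasDerivOne_const (c : F) : HasDerivOne (𝕜 := 𝕜) (n := n) (fun _ : A => c) 0 :=
  (hasFDerivAt_const c _).congr_fderiv (by ext; rfl)

/-- The chain rule for a map out of the vector space. -/
theorem HasDerivOne.comp_hasFDerivAt {f : A → F} {L : LieAlg 𝕜 n A →L[𝕜] F} {g : F → F'}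
    {g' : F →L[𝕜] F'} (h : HasDerivOne f L) (hg : HasFDerivAt g g' (f 1)) :
    HasDerivOne (fun a => g (f a)) (g' ∘L L) := by
  refine (HasFDerivAt.comp (g := g) _ ?_ h).congr_fderiv (by ext; rfl)
  rwa [chartOne_symm_origin]

theorem HasDerivOne.clm_comp {f : A → F} {L : LieAlg 𝕜 n A →L[𝕜] F} (T : F →L[𝕜] F')
    (h : HasDerivOne f L) : HasDerivOne (fun a => T (f a)) (T ∘L L) :=
  h.comp_hasFDerivAt T.hasFDerivAt

theorem leftGrad_apply {f : A → 𝕜} {a : A} {L : LieAlg 𝕜 n A →L[𝕜] 𝕜}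
    (h : HasDerivOne (fun x => f (x * a)) L) (v : LieAlg 𝕜 n A) : leftGrad 𝕜 n f a v = L v := by
  rw [leftGrad, h.hasMFDerivAt.mfderiv]; rfl

theorem rightGrad_apply {f : A → 𝕜} {a : A} {L : LieAlg 𝕜 n A →L[𝕜] 𝕜}
    (h : HasDerivOne (fun x => f (a * x)) L) (v : LieAlg 𝕜 n A) : rightGrad 𝕜 n f a v = L v := by
  rw [rightGrad, h.hasMFDerivAt.mfderiv]; rfl

end Coordinates

/-! ### Derivatives of maps between Lie groups -/

section Hom

variable {𝕜 : Type*} [RCLike 𝕜] {m n : ℕ}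
  {A : Type*} [TopologicalSpace A] [ChartedSpace (EuclideanSpace 𝕜 (Fin m)) A] [Group A]
  {B : Type*} [TopologicalSpace B] [ChartedSpace (EuclideanSpace 𝕜 (Fin n)) B] [Group B]
  {F : Type*} [NormedAddCommGroup F] [NormedSpace 𝕜 F]

/-- `L` is the derivative at the identity of a map of Lie groups that fixes the identity, read in
the preferred charts. -/
def HasGroupDeriv (φ : A → B) (L : LieAlg 𝕜 m A →L[𝕜] LieAlg 𝕜 n B) : Prop :=
  HasFDerivAt (𝕜 := 𝕜) (fun x => chartOne 𝕜 n B (φ ((chartOne 𝕜 m A).symm x)))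
    ((coord 𝕜 n B).toContinuousLinearMap ∘L L ∘L (coord 𝕜 m A).symm.toContinuousLinearMap)
    (origin 𝕜 m A)

theorem hasGroupDeriv_mfderiv {φ : A → B}
    (h : MDifferentiableAt (Model 𝕜 m) (Model 𝕜 n) φ 1) (h1 : φ 1 = 1) :
    HasGroupDeriv φ
      (show LieAlg 𝕜 m A →L[𝕜] LieAlg 𝕜 n B from mfderiv (Model 𝕜 m) (Model 𝕜 n) φ 1) := by
  have := h.hasMFDerivAt.2
  simp only [writtenInExtChartAt, mfld_simps, h1] at this
  exact this.hasFDerivAt Filter.univ_mem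

theorem HasDerivOne.comp_hasGroupDeriv {φ : A → B} {L : LieAlg 𝕜 m A →L[𝕜] LieAlg 𝕜 n B}
    {f : B → F} {f' : LieAlg 𝕜 n B →L[𝕜] F} (hf : HasDerivOne f f') (hφ : HasGroupDeriv φ L)
    (h1 : φ 1 = 1) (hc : ContinuousAt φ 1) : HasDerivOne (fun a => f (φ a)) (f' ∘L L) := by
  have hf' : HasFDerivAt (𝕜 := 𝕜) (fun x => f ((chartOne 𝕜 n B).symm x))
      (f' ∘L (coord 𝕜 n B).symm.toContinuousLinearMap)
      (chartOne 𝕜 n B (φ ((chartOne 𝕜 m A).symm (origin 𝕜 m A)))) := by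
    rw [chartOne_symm_origin, h1]; exact hf
  refine ((hf'.comp (origin 𝕜 m A) hφ).congr_of_eventuallyEq ?_).congr_fderiv (by ext; rfl)
  have hc' : Filter.Tendsto φ (𝓝 1) (𝓝 1) := by
    have := hc.tendsto; rwa [h1] at this
  filter_upwards [tendsto_chartOne_symm (hc' (source_mem_nhds (𝕜 := 𝕜) (n := n)))] with x hx
  simp only [Function.comp_apply]
  rw [(chartOne 𝕜 n B).left_inv hx]

theorem LieSubgroup.hasGroupDeriv (j : LieSubgroup 𝕜 m n A B) :
    HasGroupDeriv j.hom (LinearMap.toContinuousLinearMap j.diff) :=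
  hasGroupDeriv_mfderiv (j.smooth.mdifferentiableAt (by simp)) (map_one _)

theorem HasDerivOne.comp_hom {f : B → F} {f' : LieAlg 𝕜 n B →L[𝕜] F} (hf : HasDerivOne f f')
    (j : LieSubgroup 𝕜 m n A B) :
    HasDerivOne (fun a => f (j.hom a)) (f' ∘L LinearMap.toContinuousLinearMap j.diff) :=
  hf.comp_hasGroupDeriv j.hasGroupDeriv (map_one _) j.smooth.continuous.continuousAt

end Hom

section GroupDeriv

variable {𝕜 : Type*} [RCLike 𝕜] {m n p : ℕ}
  {A : Type*} [TopologicalSpace A] [ChartedSpace (EuclideanSpace 𝕜 (Fin m)) A] [Group A]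
  {B : Type*} [TopologicalSpace B] [ChartedSpace (EuclideanSpace 𝕜 (Fin n)) B] [Group B]
  {C : Type*} [TopologicalSpace C] [ChartedSpace (EuclideanSpace 𝕜 (Fin p)) C] [Group C]

theorem HasGroupDeriv.unique {φ : A → B} {L L' : LieAlg 𝕜 m A →L[𝕜] LieAlg 𝕜 n B}
    (h : HasGroupDeriv φ L) (h' : HasGroupDeriv φ L') : L = L' := by
  ext v
  apply (coord 𝕜 n B).injective
  exact congrArg (fun T : EuclideanSpace 𝕜 (Fin m) →L[𝕜] EuclideanSpace 𝕜 (Fin n) =>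
    T (coord 𝕜 m A v)) (HasFDerivAt.unique h h')

theorem HasGroupDeriv.comp {φ : A → B} {ψ : B → C} {L : LieAlg 𝕜 m A →L[𝕜] LieAlg 𝕜 n B}
    {L' : LieAlg 𝕜 n B →L[𝕜] LieAlg 𝕜 p C} (hψ : HasGroupDeriv ψ L') (hφ : HasGroupDeriv φ L)
    (h1 : φ 1 = 1) (hc : ContinuousAt φ 1) : HasGroupDeriv (fun a => ψ (φ a)) (L' ∘L L) := by
  have h : HasDerivOne (fun b => chartOne 𝕜 p C (ψ b))
      ((coord 𝕜 p C).toContinuousLinearMap ∘L L') := hψ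
  exact h.comp_hasGroupDeriv hφ h1 hc

end GroupDeriv

/-! ### The adjoint action -/

section Adjoint

variable {𝕜 : Type*} [RCLike 𝕜] {m n : ℕ}
  {A : Type*} [TopologicalSpace A] [ChartedSpace (EuclideanSpace 𝕜 (Fin n)) A] [Group A]
  [LieGroup (Model 𝕜 n) ∞ A]
  {B : Type*} [TopologicalSpace B] [ChartedSpace (EuclideanSpace 𝕜 (Fin m)) B] [Group B]
  [LieGroup (Model 𝕜 m) ∞ B]

theorem contMDiff_conj (a : A) :
    ContMDiff (Model 𝕜 n) (Model 𝕜 n) ∞ (fun x : A => a * x * a⁻¹) :=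
  (contMDiff_mul_right (a := a⁻¹)).comp (contMDiff_mul_left (a := a))

theorem hasGroupDeriv_conj (a : A) :
    HasGroupDeriv (fun x : A => a * x * a⁻¹) (LinearMap.toContinuousLinearMap (Ad 𝕜 n a)) :=
  hasGroupDeriv_mfderiv ((contMDiff_conj a).mdifferentiableAt (by simp)) (by simp)

/-- The adjoint action as a derivative in the preferred chart. -/
theorem coord_Ad (a : A) (w : LieAlg 𝕜 n A) :
    coord 𝕜 n A (Ad 𝕜 n a w)
      = fderiv 𝕜 (fun y => chartOne 𝕜 n A (a * (chartOne 𝕜 n A).symm y * a⁻¹))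
          (origin 𝕜 n A) (coord 𝕜 n A w) := by
  rw [(hasGroupDeriv_conj (𝕜 := 𝕜) (n := n) a).fderiv]; rfl

theorem Ad_one (w : LieAlg 𝕜 n A) : Ad 𝕜 n (1 : A) w = w := by
  have h : HasGroupDeriv (fun x : A => (1 : A) * x * (1 : A)⁻¹)
      (ContinuousLinearMap.id 𝕜 (LieAlg 𝕜 n A)) := by
    refine ((hasFDerivAt_id (𝕜 := 𝕜) (origin 𝕜 n A)).congr_of_eventuallyEq ?_).congr_fderiv
      (by ext; rfl)
    filter_upwards [target_mem_nhds (𝕜 := 𝕜) (n := n) (A := A)] with x hx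
    simpa using (chartOne 𝕜 n A).right_inv hx
  exact congrArg (fun T : LieAlg 𝕜 n A →L[𝕜] LieAlg 𝕜 n A => T w)
    ((hasGroupDeriv_conj (𝕜 := 𝕜) (n := n) (1 : A)).unique h)

theorem Ad_mul (a b : A) (w : LieAlg 𝕜 n A) : Ad 𝕜 n (a * b) w = Ad 𝕜 n a (Ad 𝕜 n b w) := by
  have h := (hasGroupDeriv_conj (𝕜 := 𝕜) (n := n) a).comp (hasGroupDeriv_conj b) (by simp)
    (contMDiff_conj (𝕜 := 𝕜) (n := n) b).continuous.continuousAt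
  have h' := hasGroupDeriv_conj (𝕜 := 𝕜) (n := n) (a * b)
  have e : (fun x : A => a * b * x * (a * b)⁻¹) = fun x => a * (b * x * b⁻¹) * a⁻¹ := by
    ext x; group
  rw [e] at h'
  exact congrArg (fun T : LieAlg 𝕜 n A →L[𝕜] LieAlg 𝕜 n A => T w) (h'.unique h)

theorem Ad_Ad_inv (a : A) (w : LieAlg 𝕜 n A) : Ad 𝕜 n a (Ad 𝕜 n a⁻¹ w) = w := by
  rw [← Ad_mul, mul_inv_cancel, Ad_one]

theorem LieSubgroup.diff_Ad (j : LieSubgroup 𝕜 n m A B) (a : A) (w : LieAlg 𝕜 n A) :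
    j.diff (Ad 𝕜 n a w) = Ad 𝕜 m (j.hom a) (j.diff w) := by
  have h := j.hasGroupDeriv.comp (hasGroupDeriv_conj a) (by simp)
    (contMDiff_conj (𝕜 := 𝕜) (n := n) a).continuous.continuousAt
  have h' := (hasGroupDeriv_conj (𝕜 := 𝕜) (n := m) (j.hom a)).comp j.hasGroupDeriv (map_one _)
    j.smooth.continuous.continuousAt
  have e : (fun x : A => j.hom (a * x * a⁻¹)) = fun x => j.hom a * j.hom x * (j.hom a)⁻¹ := by
    ext x; simp
  rw [e] at h
  exact congrArg (fun T : LieAlg 𝕜 n A →L[𝕜] LieAlg 𝕜 m B => T w) (h.unique h')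

/-- Left and right gradients differ by the coadjoint action. -/
theorem HasDerivOne.leftGrad_eq {f : A → 𝕜} {a : A} {L : LieAlg 𝕜 n A →L[𝕜] 𝕜}
    (h : HasDerivOne (fun x => f (a * x)) L) (v : LieAlg 𝕜 n A) :
    leftGrad 𝕜 n f a v = rightGrad 𝕜 n f a (Ad 𝕜 n a⁻¹ v) := by
  have h' := h.comp_hasGroupDeriv (hasGroupDeriv_conj a⁻¹) (by simp)
    (contMDiff_conj (𝕜 := 𝕜) (n := n) a⁻¹).continuous.continuousAt
  have e : (fun x : A => f (a * (a⁻¹ * x * a⁻¹⁻¹))) = fun x => f (x * a) := by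
    ext x; congr 1; group
  rw [e] at h'
  rw [leftGrad_apply h', rightGrad_apply h]
  rfl

theorem contMDiff_Ad (w : LieAlg 𝕜 n A) :
    ContMDiff (Model 𝕜 n) (Model 𝕜 n) ∞ (fun a : A => coord 𝕜 n A (Ad 𝕜 n a w)) := by
  intro a₀
  simp only [coord_Ad]
  have hf : ContMDiffAt ((Model 𝕜 n).prod (Model 𝕜 n)) (Model 𝕜 n) ∞
      (Function.uncurry fun (a : A) (y : EuclideanSpace 𝕜 (Fin n)) =>
        chartOne 𝕜 n A (a * (chartOne 𝕜 n A).symm y * a⁻¹)) (a₀, origin 𝕜 n A) := by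
    have h1 : ContMDiffAt ((Model 𝕜 n).prod (Model 𝕜 n)) (Model 𝕜 n) ∞
        (fun p : A × EuclideanSpace 𝕜 (Fin n) => (chartOne 𝕜 n A).symm p.2)
        (a₀, origin 𝕜 n A) :=
      ContMDiffAt.comp (a₀, origin 𝕜 n A)
        ((contMDiffOn_extChartAt_symm (I := Model 𝕜 n) (1 : A)).contMDiffAt target_mem_nhds)
        contMDiffAt_snd
    have h2 := (contMDiffAt_fst.mul h1).mul (contMDiffAt_fst (n := ∞) (I := Model 𝕜 n)
      (J := Model 𝕜 n) (p := (a₀, origin 𝕜 n A))).inv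
    refine ContMDiffAt.comp (I' := Model 𝕜 n) (g := chartOne 𝕜 n A) (a₀, origin 𝕜 n A) ?_ h2
    simp only [chartOne_symm_origin, mul_one, mul_inv_cancel]
    exact contMDiffAt_extChartAt
  have h := ContMDiffAt.mfderiv (m := ∞) (n := ∞) _ (fun _ : A => origin 𝕜 n A) hf
    contMDiffAt_const le_rfl
  simp only [inTangentCoordinates_model_space, mfderiv_eq_fderiv] at h
  exact h.clm_apply contMDiffAt_const

end Adjoint

/-! ### The derivative of the adjoint action -/

section AdDeriv

open VectorField

variable {𝕜 : Type*} [RCLike 𝕜] {n : ℕ}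
  {A : Type*} [TopologicalSpace A] [ChartedSpace (EuclideanSpace 𝕜 (Fin n)) A] [Group A]
  [LieGroup (Model 𝕜 n) ∞ A]

variable (𝕜 n A) in
/-- The multiplication of a Lie group in the preferred chart at the identity. -/
def chartMul (p : EuclideanSpace 𝕜 (Fin n) × EuclideanSpace 𝕜 (Fin n)) :
    EuclideanSpace 𝕜 (Fin n) :=
  chartOne 𝕜 n A ((chartOne 𝕜 n A).symm p.1 * (chartOne 𝕜 n A).symm p.2)

theorem contDiffAt_chartMul :
    ContDiffAt 𝕜 ∞ (chartMul 𝕜 n A) (origin 𝕜 n A, origin 𝕜 n A) := by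
  rw [← contMDiffAt_iff_contDiffAt, modelWithCornersSelf_prod, ← chartedSpaceSelf_prod]
  have hs : ContMDiffAt (Model 𝕜 n) (Model 𝕜 n) ∞ (chartOne 𝕜 n A).symm (origin 𝕜 n A) :=
    (contMDiffOn_extChartAt_symm (I := Model 𝕜 n) (1 : A)).contMDiffAt target_mem_nhds
  have h1 := (ContMDiffAt.comp (I := (Model 𝕜 n).prod (Model 𝕜 n))
      (origin 𝕜 n A, origin 𝕜 n A) hs contMDiffAt_fst).mul
    (ContMDiffAt.comp (I := (Model 𝕜 n).prod (Model 𝕜 n))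
      (origin 𝕜 n A, origin 𝕜 n A) hs contMDiffAt_snd)
  refine ContMDiffAt.comp (I := (Model 𝕜 n).prod (Model 𝕜 n)) (I' := Model 𝕜 n)
    (g := chartOne 𝕜 n A) _ ?_ h1
  simp only [chartOne_symm_origin, mul_one]
  exact contMDiffAt_extChartAt

theorem eventually_differentiableAt_chartMul :
    ∀ᶠ p in 𝓝 (origin 𝕜 n A, origin 𝕜 n A), DifferentiableAt 𝕜 (chartMul 𝕜 n A) p := by
  have h : ContDiffAt 𝕜 1 (chartMul 𝕜 n A) (origin 𝕜 n A, origin 𝕜 n A) :=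
    contDiffAt_chartMul.of_le (by simp)
  filter_upwards [h.eventually (by simp)] with p hp
  exact hp.differentiableAt (by simp)

theorem differentiableAt_fderiv_chartMul :
    DifferentiableAt 𝕜 (fderiv 𝕜 (chartMul 𝕜 n A)) (origin 𝕜 n A, origin 𝕜 n A) :=
  ((contDiffAt_chartMul (𝕜 := 𝕜) (n := n) (A := A)).fderiv_right (m := ∞) le_rfl).differentiableAt
    (by simp)

variable (𝕜 n A) in
/-- The mixed second derivative of the multiplication at the identity. -/
def chartMul₂ (v w : EuclideanSpace 𝕜 (Fin n)) : EuclideanSpace 𝕜 (Fin n) :=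
  fderiv 𝕜 (fderiv 𝕜 (chartMul 𝕜 n A)) (origin 𝕜 n A, origin 𝕜 n A) (v, 0) (0, w)

theorem fderiv_chartMul_fst (v : EuclideanSpace 𝕜 (Fin n)) :
    fderiv 𝕜 (chartMul 𝕜 n A) (origin 𝕜 n A, origin 𝕜 n A) (v, 0) = v := by
  have h : HasFDerivAt (chartMul 𝕜 n A) _ (origin 𝕜 n A, origin 𝕜 n A) :=
    (contDiffAt_chartMul.differentiableAt (by simp)).hasFDerivAt
  have h1 := h.comp (f := fun x => (x, origin 𝕜 n A)) (origin 𝕜 n A)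
    (hasFDerivAt_prodMk_left (𝕜 := 𝕜) (origin 𝕜 n A) (origin 𝕜 n A))
  have h2 : HasFDerivAt (chartMul 𝕜 n A ∘ fun x => (x, origin 𝕜 n A))
      (ContinuousLinearMap.id 𝕜 (EuclideanSpace 𝕜 (Fin n))) (origin 𝕜 n A) := by
    refine (hasFDerivAt_id _).congr_of_eventuallyEq ?_
    filter_upwards [target_mem_nhds (𝕜 := 𝕜) (n := n) (A := A)] with x hx
    simp only [Function.comp_apply, chartMul, chartOne_symm_origin, mul_one, id]
    exact (chartOne 𝕜 n A).right_inv hx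
  exact congrArg (fun T : EuclideanSpace 𝕜 (Fin n) →L[𝕜] EuclideanSpace 𝕜 (Fin n) => T v)
    (h1.unique h2)

theorem fderiv_chartMul_snd (v : EuclideanSpace 𝕜 (Fin n)) :
    fderiv 𝕜 (chartMul 𝕜 n A) (origin 𝕜 n A, origin 𝕜 n A) (0, v) = v := by
  have h : HasFDerivAt (chartMul 𝕜 n A) _ (origin 𝕜 n A, origin 𝕜 n A) :=
    (contDiffAt_chartMul.differentiableAt (by simp)).hasFDerivAt
  have h1 := h.comp (f := fun x => (origin 𝕜 n A, x)) (origin 𝕜 n A)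
    (hasFDerivAt_prodMk_right (𝕜 := 𝕜) (origin 𝕜 n A) (origin 𝕜 n A))
  have h2 : HasFDerivAt (chartMul 𝕜 n A ∘ fun x => (origin 𝕜 n A, x))
      (ContinuousLinearMap.id 𝕜 (EuclideanSpace 𝕜 (Fin n))) (origin 𝕜 n A) := by
    refine (hasFDerivAt_id _).congr_of_eventuallyEq ?_
    filter_upwards [target_mem_nhds (𝕜 := 𝕜) (n := n) (A := A)] with x hx
    simp only [Function.comp_apply, chartMul, chartOne_symm_origin, one_mul, id]
    exact (chartOne 𝕜 n A).right_inv hx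
  exact congrArg (fun T : EuclideanSpace 𝕜 (Fin n) →L[𝕜] EuclideanSpace 𝕜 (Fin n) => T v)
    (h1.unique h2)

/-- The derivative at the identity of `x ↦ D₂(xy)|_{y=1} w`. -/
theorem hasFDerivAt_chartMul_right (w : EuclideanSpace 𝕜 (Fin n)) :
    HasFDerivAt (fun x => fderiv 𝕜 (chartMul 𝕜 n A) (x, origin 𝕜 n A) (0, w))
      ((fderiv 𝕜 (fderiv 𝕜 (chartMul 𝕜 n A)) (origin 𝕜 n A, origin 𝕜 n A)
        ∘L ContinuousLinearMap.inl 𝕜 _ _).flip (0, w)) (origin 𝕜 n A) := by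
  have h := (differentiableAt_fderiv_chartMul (𝕜 := 𝕜) (n := n) (A := A)).hasFDerivAt.comp
    (f := fun x => (x, origin 𝕜 n A)) (origin 𝕜 n A)
    (hasFDerivAt_prodMk_left (𝕜 := 𝕜) (origin 𝕜 n A) (origin 𝕜 n A))
  exact (h.clm_apply (hasFDerivAt_const (0, w) _)).congr_fderiv (by ext; simp)

/-- The left-invariant vector field with value `v` at the identity, in the preferred chart. -/
def leftField (v : LieAlg 𝕜 n A) (x : EuclideanSpace 𝕜 (Fin n)) : EuclideanSpace 𝕜 (Fin n) :=
  (mfderivWithin 𝓘(𝕜, EuclideanSpace 𝕜 (Fin n)) (Model 𝕜 n) (chartOne 𝕜 n A).symm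
    (Set.range (Model 𝕜 n)) x).inverse (mulInvariantVectorField v ((chartOne 𝕜 n A).symm x))

/-- In the chart, the left-invariant vector field is `x ↦ D₂(xy)|_{y=1} v`. -/
theorem leftField_eq {x : EuclideanSpace 𝕜 (Fin n)} (hx : x ∈ (chartOne 𝕜 n A).target)
    (hd : DifferentiableAt 𝕜 (chartMul 𝕜 n A) (x, origin 𝕜 n A)) (v : LieAlg 𝕜 n A) :
    leftField v x = fderiv 𝕜 (chartMul 𝕜 n A) (x, origin 𝕜 n A) (0, coord 𝕜 n A v) := by
  have ha : (chartOne 𝕜 n A).symm x ∈ (chartOne 𝕜 n A).source := (chartOne 𝕜 n A).map_target hx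
  have h1 : HasDerivOne (fun y : A => chartOne 𝕜 n A ((chartOne 𝕜 n A).symm x * y))
      ((fderiv 𝕜 (chartMul 𝕜 n A) (x, origin 𝕜 n A) ∘L ContinuousLinearMap.inr 𝕜 _ _) ∘L
        (coord 𝕜 n A).toContinuousLinearMap) :=
    hd.hasFDerivAt.comp (f := fun y => (x, y)) (origin 𝕜 n A)
      (hasFDerivAt_prodMk_right (𝕜 := 𝕜) x (origin 𝕜 n A))
  have h2 : MDifferentiableAt (Model 𝕜 n) (Model 𝕜 n)
      (fun y : A => (chartOne 𝕜 n A).symm x * y) 1 :=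
    (contMDiff_mul_left (I := Model 𝕜 n) (n := ∞)).mdifferentiableAt (by simp)
  have h3 : MDifferentiableAt (Model 𝕜 n) 𝓘(𝕜, EuclideanSpace 𝕜 (Fin n)) (chartOne 𝕜 n A)
      ((chartOne 𝕜 n A).symm x * 1) := by
    rw [mul_one]
    exact mdifferentiableAt_extChartAt (by simpa using ha)
  have h4 := (h3.hasMFDerivAt.comp (1 : A) h2.hasMFDerivAt).mfderiv
  have h5 := h1.hasMFDerivAt.mfderiv
  have h6 := mfderivWithin_extChartAt_symm_comp_mfderiv_extChartAt' (I := Model 𝕜 n)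
    (x := (1 : A)) ha
  rw [(chartOne 𝕜 n A).right_inv hx] at h6
  have h7 : mfderiv (Model 𝕜 n) 𝓘(𝕜, EuclideanSpace 𝕜 (Fin n)) (chartOne 𝕜 n A)
      ((chartOne 𝕜 n A).symm x) (mulInvariantVectorField v ((chartOne 𝕜 n A).symm x))
      = fderiv 𝕜 (chartMul 𝕜 n A) (x, origin 𝕜 n A) (0, coord 𝕜 n A v) := by
    have hb : ∀ (a b : A), b = a → ∀ z : EuclideanSpace 𝕜 (Fin n),
        mfderiv (Model 𝕜 n) 𝓘(𝕜, EuclideanSpace 𝕜 (Fin n)) (chartOne 𝕜 n A) a z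
          = mfderiv (Model 𝕜 n) 𝓘(𝕜, EuclideanSpace 𝕜 (Fin n)) (chartOne 𝕜 n A) b z := by
      rintro _ _ rfl _; rfl
    exact (hb _ _ (mul_one _) _).trans
      (congrArg (fun T : LieAlg 𝕜 n A →L[𝕜] EuclideanSpace 𝕜 (Fin n) => T v) (h4.symm.trans h5))
  refine ((isInvertible_mfderivWithin_extChartAt_symm hx).inverse_apply_eq).2 ?_
  rw [← h7]
  exact (congrArg (fun T : TangentSpace (Model 𝕜 n) ((chartOne 𝕜 n A).symm x) →L[𝕜]
    TangentSpace (Model 𝕜 n) ((chartOne 𝕜 n A).symm x) =>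
      T (mulInvariantVectorField v ((chartOne 𝕜 n A).symm x))) h6).symm

/-- The Lie bracket, which Mathlib defines through left-invariant vector fields, is the
antisymmetrized mixed second derivative of the multiplication. -/
theorem coord_lie (v w : LieAlg 𝕜 n A) :
    coord 𝕜 n A ⁅v, w⁆ = chartMul₂ 𝕜 n A (coord 𝕜 n A v) (coord 𝕜 n A w)
      - chartMul₂ 𝕜 n A (coord 𝕜 n A w) (coord 𝕜 n A v) := by
  have hE : ∀ v : LieAlg 𝕜 n A, leftField v =ᶠ[𝓝 (origin 𝕜 n A)]
        fun x => fderiv 𝕜 (chartMul 𝕜 n A) (x, origin 𝕜 n A) (0, coord 𝕜 n A v) := by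
    intro v
    have ht : Filter.Tendsto (fun x => (x, origin 𝕜 n A)) (𝓝 (origin 𝕜 n A))
        (𝓝 (origin 𝕜 n A, origin 𝕜 n A)) := Continuous.tendsto' (by fun_prop) _ _ rfl
    filter_upwards [target_mem_nhds (𝕜 := 𝕜) (n := n) (A := A),
      ht.eventually eventually_differentiableAt_chartMul] with x hx hd
    exact leftField_eq hx hd v
  have hr : ((chartOne 𝕜 n A).symm ⁻¹' Set.univ ∩ Set.range (Model 𝕜 n)) = Set.univ := by simp
  have hm : (mfderiv (Model 𝕜 n) 𝓘(𝕜, EuclideanSpace 𝕜 (Fin n)) (chartOne 𝕜 n A) 1).inverse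
      = ContinuousLinearMap.id 𝕜 _ := by
    rw [mfderiv_extChartAt_self]
    exact ContinuousLinearMap.inverse_id
  have hb : coord 𝕜 n A ⁅v, w⁆ = lieBracketWithin 𝕜 (leftField v) (leftField w)
      ((chartOne 𝕜 n A).symm ⁻¹' Set.univ ∩ Set.range (Model 𝕜 n)) (origin 𝕜 n A) :=
    congrArg (fun T : EuclideanSpace 𝕜 (Fin n) →L[𝕜] EuclideanSpace 𝕜 (Fin n) =>
      T (lieBracketWithin 𝕜 (leftField v) (leftField w)
      ((chartOne 𝕜 n A).symm ⁻¹' Set.univ ∩ Set.range (Model 𝕜 n)) (origin 𝕜 n A))) hm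
  have hv : ∀ v : LieAlg 𝕜 n A, fderiv 𝕜 (chartMul 𝕜 n A) (origin 𝕜 n A, origin 𝕜 n A)
      (0, coord 𝕜 n A v) = coord 𝕜 n A v := fun _ => fderiv_chartMul_snd _
  rw [hb, hr, lieBracketWithin_univ, (hE v).lieBracket_vectorField_eq (hE w), lieBracket,
    (hasFDerivAt_chartMul_right _).fderiv, (hasFDerivAt_chartMul_right _).fderiv, hv, hv]
  rfl

/-- The identity `x w = (Ad_x w) x` of tangent vectors at the point with coordinates `x`. -/
theorem fderiv_chartMul_eq_Ad {x : EuclideanSpace 𝕜 (Fin n)}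
    (hd : DifferentiableAt 𝕜 (chartMul 𝕜 n A) (x, origin 𝕜 n A))
    (hd' : DifferentiableAt 𝕜 (chartMul 𝕜 n A) (origin 𝕜 n A, x)) (w : LieAlg 𝕜 n A) :
    fderiv 𝕜 (chartMul 𝕜 n A) (x, origin 𝕜 n A) (0, coord 𝕜 n A w)
      = fderiv 𝕜 (chartMul 𝕜 n A) (origin 𝕜 n A, x)
          (coord 𝕜 n A (Ad 𝕜 n ((chartOne 𝕜 n A).symm x) w), 0) := by
  have h := hd.hasFDerivAt.comp (origin 𝕜 n A) (hasFDerivAt_prodMk_right (𝕜 := 𝕜) x (origin 𝕜 n A))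
  have hc := hasGroupDeriv_conj (𝕜 := 𝕜) (n := n) ((chartOne 𝕜 n A).symm x)
  unfold HasGroupDeriv at hc
  have hd'' : HasFDerivAt (chartMul 𝕜 n A) (fderiv 𝕜 (chartMul 𝕜 n A) (origin 𝕜 n A, x))
      (chartOne 𝕜 n A ((chartOne 𝕜 n A).symm x * (chartOne 𝕜 n A).symm (origin 𝕜 n A)
        * ((chartOne 𝕜 n A).symm x)⁻¹), x) := by
    rw [chartOne_symm_origin, mul_one, mul_inv_cancel]; exact hd'.hasFDerivAt
  have h' := hd''.comp (origin 𝕜 n A) (hc.prodMk (hasFDerivAt_const x _))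
  have e := h.unique (h'.congr_of_eventuallyEq ?_)
  · exact congrArg (fun T : EuclideanSpace 𝕜 (Fin n) →L[𝕜] EuclideanSpace 𝕜 (Fin n) =>
      T (coord 𝕜 n A w)) e
  · have ht := (contMDiff_conj (𝕜 := 𝕜) (n := n) ((chartOne 𝕜 n A).symm x)).continuous.tendsto 1
    simp only [mul_one, mul_inv_cancel] at ht
    filter_upwards [tendsto_chartOne_symm (ht (source_mem_nhds (𝕜 := 𝕜) (n := n)))] with y hy
    simp only [Function.comp_apply, chartMul]
    rw [(chartOne 𝕜 n A).left_inv hy, inv_mul_cancel_right]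

/-- The derivative of the adjoint action at the identity is the Lie bracket: this follows by
differentiating `D₂(xy)|_{y=1} w = D₁(yx)|_{y=1} (Ad_x w)` with respect to `x`. -/
theorem hasDerivOne_Ad (w : LieAlg 𝕜 n A) :
    HasDerivOne (fun a : A => coord 𝕜 n A (Ad 𝕜 n a w))
      ((coord 𝕜 n A).toContinuousLinearMap ∘L LinearMap.toContinuousLinearMap
        (-LieAlgebra.ad 𝕜 (LieAlg 𝕜 n A) w : LieAlg 𝕜 n A →ₗ[𝕜] LieAlg 𝕜 n A)) := by
  obtain ⟨L, h⟩ : ∃ L : LieAlg 𝕜 n A →L[𝕜] EuclideanSpace 𝕜 (Fin n),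
      HasDerivOne (fun a : A => coord 𝕜 n A (Ad 𝕜 n a w)) L :=
    ⟨_, HasDerivOne.of_mdifferentiableAt
      ((contMDiff_Ad (𝕜 := 𝕜) (n := n) (A := A) w).mdifferentiableAt (x := 1) (by simp))⟩
  have h1 := (differentiableAt_fderiv_chartMul (𝕜 := 𝕜) (n := n) (A := A)).hasFDerivAt.comp
    (f := fun x => (origin 𝕜 n A, x)) (origin 𝕜 n A)
    (hasFDerivAt_prodMk_right (𝕜 := 𝕜) (origin 𝕜 n A) (origin 𝕜 n A))
  have h2 := h1.clm_apply
    (HasFDerivAt.prodMk h (hasFDerivAt_const (0 : EuclideanSpace 𝕜 (Fin n)) _))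
  have h3 := hasFDerivAt_chartMul_right (A := A) (coord 𝕜 n A w)
  have e := h3.unique (h2.congr_of_eventuallyEq ?_)
  · have hv : ∀ v : LieAlg 𝕜 n A, L v = coord 𝕜 n A ⁅v, w⁆ := by
      intro v
      have ev : chartMul₂ 𝕜 n A (coord 𝕜 n A v) (coord 𝕜 n A w)
          = fderiv 𝕜 (chartMul 𝕜 n A) (origin 𝕜 n A, origin 𝕜 n A) (L v, 0)
            + fderiv 𝕜 (fderiv 𝕜 (chartMul 𝕜 n A)) (origin 𝕜 n A, origin 𝕜 n A)
              (0, coord 𝕜 n A v)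
              (coord 𝕜 n A (Ad 𝕜 n ((chartOne 𝕜 n A).symm (origin 𝕜 n A)) w), 0) :=
        congrArg (fun T : EuclideanSpace 𝕜 (Fin n) →L[𝕜] EuclideanSpace 𝕜 (Fin n) =>
          T (coord 𝕜 n A v)) e
      have hs : IsSymmSndFDerivAt 𝕜 (chartMul 𝕜 n A) (origin 𝕜 n A, origin 𝕜 n A) :=
        contDiffAt_chartMul.isSymmSndFDerivAt (by
          rw [minSmoothness_of_isRCLikeNormedField]; exact WithTop.coe_le_coe.2 le_top)
      rw [chartOne_symm_origin, Ad_one, fderiv_chartMul_fst, hs] at ev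
      rw [coord_lie, ev]
      exact (add_sub_cancel_right _ _).symm
    convert h using 1
    refine ContinuousLinearMap.ext fun v => ?_
    change coord 𝕜 n A (-⁅w, v⁆) = L v
    rw [hv, lie_skew]
  · have ht : Filter.Tendsto (fun x => (x, origin 𝕜 n A)) (𝓝 (origin 𝕜 n A))
        (𝓝 (origin 𝕜 n A, origin 𝕜 n A)) := Continuous.tendsto' (by fun_prop) _ _ rfl
    have ht' : Filter.Tendsto (fun x => (origin 𝕜 n A, x)) (𝓝 (origin 𝕜 n A))
        (𝓝 (origin 𝕜 n A, origin 𝕜 n A)) := Continuous.tendsto' (by fun_prop) _ _ rfl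
    filter_upwards [ht.eventually eventually_differentiableAt_chartMul,
      ht'.eventually eventually_differentiableAt_chartMul] with x hd hd'
    exact fderiv_chartMul_eq_Ad hd hd' w

end AdDeriv

/-! ### Infinitesimal and global invariance -/

section Invariance

variable {𝕜 : Type*} [RCLike 𝕜] {m n p : ℕ}
  {T : Type*} [TopologicalSpace T] [ChartedSpace (EuclideanSpace 𝕜 (Fin m)) T] [Group T]
  [LieGroup (Model 𝕜 m) ∞ T]
  {D : Type*} [TopologicalSpace D] [ChartedSpace (EuclideanSpace 𝕜 (Fin n)) D] [Group D]
  [LieGroup (Model 𝕜 n) ∞ D]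
  {E : Type*} [TopologicalSpace E] [ChartedSpace (EuclideanSpace 𝕜 (Fin p)) E] [Group E]
  [LieGroup (Model 𝕜 p) ∞ E]
  {F : Type*} [NormedAddCommGroup F] [NormedSpace 𝕜 F]

/-- Lie subgroups have Lie subalgebras: differentiate `diff_Ad` at the identity. -/
theorem LieSubgroup.diff_lie (j : LieSubgroup 𝕜 m n T D) (v w : LieAlg 𝕜 m T) :
    j.diff ⁅v, w⁆ = ⁅j.diff v, j.diff w⁆ := by
  have h1 := (hasDerivOne_Ad (j.diff w)).comp_hom j
  have h2 := (hasDerivOne_Ad w).clm_comp (((coord 𝕜 n D).toContinuousLinearMap ∘L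
    LinearMap.toContinuousLinearMap j.diff) ∘L (coord 𝕜 m T).symm.toContinuousLinearMap)
  have e : (fun a : T => (((coord 𝕜 n D).toContinuousLinearMap ∘L
      LinearMap.toContinuousLinearMap j.diff) ∘L (coord 𝕜 m T).symm.toContinuousLinearMap)
        (coord 𝕜 m T (Ad 𝕜 m a w))) = fun a => coord 𝕜 n D (Ad 𝕜 n (j.hom a) (j.diff w)) :=
    funext fun a => congrArg (coord 𝕜 n D) (j.diff_Ad a w)
  rw [e] at h2
  have h3 : coord 𝕜 n D (j.diff (-⁅w, v⁆)) = coord 𝕜 n D (-⁅j.diff w, j.diff v⁆) :=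
    congrArg (fun L : LieAlg 𝕜 m T →L[𝕜] EuclideanSpace 𝕜 (Fin n) => L v) (h2.unique h1)
  rwa [lie_skew, lie_skew, (coord 𝕜 n D).injective.eq_iff] at h3

theorem HasDerivOne.bilinear {A : Type*} [TopologicalSpace A]
    [ChartedSpace (EuclideanSpace 𝕜 (Fin m)) A] [Group A]
    {F₁ F₂ : Type*} [NormedAddCommGroup F₁] [NormedSpace 𝕜 F₁] [NormedAddCommGroup F₂]
    [NormedSpace 𝕜 F₂] (B : F₁ →L[𝕜] F₂ →L[𝕜] F) {f : A → F₁} {g : A → F₂}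
    {f' : LieAlg 𝕜 m A →L[𝕜] F₁} {g' : LieAlg 𝕜 m A →L[𝕜] F₂} (hf : HasDerivOne f f')
    (hg : HasDerivOne g g') :
    HasDerivOne (fun a => B (f a) (g a)) (B (f 1) ∘L g' + B.flip (g 1) ∘L f') := by
  refine (B.hasFDerivAt_of_bilinear hf hg).congr_fderiv ?_
  rw [chartOne_symm_origin]
  ext v
  rfl

/-- A function on a connected Lie group whose derivative along all right-invariant vector fields
vanishes is constant. -/
theorem eq_of_hasDerivOne_zero [ConnectedSpace T] {f : T → F}
    (hf : MDifferentiable (Model 𝕜 m) 𝓘(𝕜, F) f)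
    (h : ∀ u, HasDerivOne (𝕜 := 𝕜) (n := m) (fun x => f (x * u)) 0) (u v : T) : f u = f v := by
  have h0 : ∀ u, mfderiv (Model 𝕜 m) 𝓘(𝕜, F) f u = 0 := by
    intro u
    have h1 : HasMFDerivAt (Model 𝕜 m) 𝓘(𝕜, F) (fun x => f (x * u)) (u * u⁻¹)
        (0 : EuclideanSpace 𝕜 (Fin m) →L[𝕜] F) := by
      rw [mul_inv_cancel]; exact (h u).hasMFDerivAt
    have h2 : MDifferentiableAt (Model 𝕜 m) (Model 𝕜 m) (fun x => x * u⁻¹) u :=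
      (contMDiff_mul_right (I := Model 𝕜 m) (n := ∞)).mdifferentiableAt (by simp)
    have h3 := (h1.comp u h2.hasMFDerivAt).mfderiv
    have e : (fun x => f (x * u)) ∘ (fun x => x * u⁻¹) = f := by
      ext x; simp
    rw [e] at h3
    rw [h3]
    exact ContinuousLinearMap.zero_comp _
  -- in a ball of a chart, `f` is constant by the mean value inequality
  have hl : IsLocallyConstant f := by
    rw [IsLocallyConstant.iff_eventually_eq]
    intro u
    set c := extChartAt (Model 𝕜 m) u
    have ht : c.target ∈ 𝓝 (c u) := extChartAt_target_mem_nhds u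
    obtain ⟨ε, hε, hb⟩ := Metric.mem_nhds_iff.1 ht
    have hc : ∀ x ∈ Metric.ball (c u) ε, HasFDerivAt (𝕜 := 𝕜) (fun x => f (c.symm x)) 0 x := by
      intro x hx
      have h1 : MDifferentiableAt (Model 𝕜 m) (Model 𝕜 m) c.symm x :=
        ((contMDiffOn_extChartAt_symm (I := Model 𝕜 m) (n := ∞) u).contMDiffAt
          ((isOpen_extChartAt_target u).mem_nhds (hb hx))).mdifferentiableAt (by simp)
      have h2 := (hf (c.symm x)).hasMFDerivAt.comp x h1.hasMFDerivAt
      rw [h0] at h2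
      have h3 : HasMFDerivAt (Model 𝕜 m) 𝓘(𝕜, F) (f ∘ c.symm) x
        (0 : EuclideanSpace 𝕜 (Fin m) →L[𝕜] F) := by
        refine h2.congr_mfderiv ?_
        exact ContinuousLinearMap.zero_comp _
      exact h3.hasFDerivAt
    have hs : c.source ∩ c ⁻¹' Metric.ball (c u) ε ∈ 𝓝 u :=
      Filter.inter_mem (extChartAt_source_mem_nhds u)
        ((continuousAt_extChartAt u).preimage_mem_nhds (Metric.ball_mem_nhds _ hε))
    filter_upwards [hs] with y hy
    have := (convex_ball (c u) ε).is_const_of_fderivWithin_eq_zero (𝕜 := 𝕜)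
      (f := fun x => f (c.symm x)) (fun x hx => (hc x hx).differentiableAt.differentiableWithinAt)
      (fun x hx => ((hc x hx).hasFDerivWithinAt.fderivWithin
        (Metric.isOpen_ball.uniqueDiffWithinAt hx))) hy.2 (Metric.mem_ball_self hε)
    simpa only [c.left_inv hy.1, c, extChartAt_to_inv] using this
  exact hl.apply_eq_of_preconnectedSpace u v

/-- A bilinear form on a pair of Lie algebras that is infinitesimally invariant under a connected
Lie group acting through two adjoint actions is invariant. -/
theorem bilin_Ad_eq [ConnectedSpace T] (j : LieSubgroup 𝕜 m n T D) (j' : LieSubgroup 𝕜 m p T E)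
    (β : LieAlg 𝕜 n D →ₗ[𝕜] LieAlg 𝕜 p E →ₗ[𝕜] 𝕜)
    (hβ : ∀ v x y, β ⁅j.diff v, x⁆ y + β x ⁅j'.diff v, y⁆ = 0) (u : T)
    (x : LieAlg 𝕜 n D) (y : LieAlg 𝕜 p E) :
    β (Ad 𝕜 n (j.hom u) x) (Ad 𝕜 p (j'.hom u) y) = β x y := by
  let B : EuclideanSpace 𝕜 (Fin n) →L[𝕜] EuclideanSpace 𝕜 (Fin p) →L[𝕜] 𝕜 :=
    LinearMap.toContinuousBilinearMap (β.compl₁₂ (coord 𝕜 n D).symm.toLinearMap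
      (coord 𝕜 p E).symm.toLinearMap)
  have hB : ∀ x y, B (coord 𝕜 n D x) (coord 𝕜 p E y) = β x y := fun x y => rfl
  have hN : ∀ x y, HasDerivOne (𝕜 := 𝕜) (n := m)
      (fun u : T => β (Ad 𝕜 n (j.hom u) x) (Ad 𝕜 p (j'.hom u) y)) 0 := by
    intro x y
    have h := HasDerivOne.bilinear B ((hasDerivOne_Ad x).comp_hom j)
      ((hasDerivOne_Ad y).comp_hom j')
    simp only [hB] at h
    convert h using 1
    refine ContinuousLinearMap.ext fun v => ?_
    change 0 = β _ (-⁅y, j'.diff v⁆) + β (-⁅x, j.diff v⁆) _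
    rw [map_one, map_one, Ad_one, Ad_one, lie_skew, lie_skew, add_comm]
    exact (hβ v x y).symm
  have hd : MDifferentiable (Model 𝕜 m) 𝓘(𝕜, 𝕜)
      (fun u : T => B (coord 𝕜 n D (Ad 𝕜 n (j.hom u) x)) (coord 𝕜 p E (Ad 𝕜 p (j'.hom u) y))) := by
    have h1 := (contMDiff_Ad (𝕜 := 𝕜) x).comp j.smooth
    have h2 := (contMDiff_Ad (𝕜 := 𝕜) y).comp j'.smooth
    have h3 : ContMDiff (Model 𝕜 m) 𝓘(𝕜, EuclideanSpace 𝕜 (Fin p) →L[𝕜] 𝕜) ∞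
        (fun u : T => B (coord 𝕜 n D (Ad 𝕜 n (j.hom u) x))) :=
      (contMDiff_const (c := B)).clm_apply h1
    exact (h3.clm_apply h2).mdifferentiable (by simp)
  have hc := eq_of_hasDerivOne_zero hd (fun u => ?_) u 1
  · simpa only [hB, map_one, Ad_one] using hc
  · simp only [hB, map_mul, Ad_mul]
    exact hN _ _

end Invariance

section Comp

variable {𝕜 : Type*} [RCLike 𝕜] {m n p : ℕ}
  {A : Type*} [TopologicalSpace A] [ChartedSpace (EuclideanSpace 𝕜 (Fin m)) A] [Group A]
  {B : Type*} [TopologicalSpace B] [ChartedSpace (EuclideanSpace 𝕜 (Fin n)) B] [Group B]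
  {C : Type*} [TopologicalSpace C] [ChartedSpace (EuclideanSpace 𝕜 (Fin p)) C] [Group C]

theorem LieSubgroup.comp_diff (k : LieSubgroup 𝕜 n p B C) (j : LieSubgroup 𝕜 m n A B)
    (v : LieAlg 𝕜 m A) : (k.comp j).diff v = k.diff (j.diff v) :=
  congrArg (fun L : LieAlg 𝕜 m A →L[𝕜] LieAlg 𝕜 p C => L v)
    ((k.comp j).hasGroupDeriv.unique (k.hasGroupDeriv.comp j.hasGroupDeriv (map_one _)
      j.smooth.continuous.continuousAt))

end Comp

/-! ### Linear algebra of a Drinfeld double -/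

section DoubleAlgebra

variable {𝕜 : Type*} [RCLike 𝕜] {nK nS nD : ℕ}
  {K : Type*} [TopologicalSpace K] [ChartedSpace (EuclideanSpace 𝕜 (Fin nK)) K] [Group K]
  {S : Type*} [TopologicalSpace S] [ChartedSpace (EuclideanSpace 𝕜 (Fin nS)) S] [Group S]
  {D : Type*} [TopologicalSpace D] [ChartedSpace (EuclideanSpace 𝕜 (Fin nD)) D] [Group D]
  [LieGroup (Model 𝕜 nD) ∞ D]

namespace DrinfeldDouble

variable (d : DrinfeldDouble 𝕜 nK nS nD K S D)

theorem projK_inK_add_inS (X : LieAlg 𝕜 nK K) (α : LieAlg 𝕜 nS S) :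
    d.projK (d.inK.diff X + d.inS.diff α) = X := by
  have h1 : Submodule.projectionOnto _ _ d.isCompl (d.inK.diff X)
      = LinearEquiv.ofInjective d.inK.diff d.inK.diff_injective X :=
    Submodule.projectionOnto_apply_left d.isCompl ⟨d.inK.diff X, ⟨X, rfl⟩⟩
  have h2 : Submodule.projectionOnto _ _ d.isCompl (d.inS.diff α) = 0 :=
    Submodule.projectionOnto_apply_right d.isCompl ⟨d.inS.diff α, ⟨α, rfl⟩⟩
  rw [projK, LinearMap.comp_apply, map_add, h1, h2, add_zero]
  exact LinearEquiv.symm_apply_apply _ X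

theorem projS_inK_add_inS (X : LieAlg 𝕜 nK K) (α : LieAlg 𝕜 nS S) :
    d.projS (d.inK.diff X + d.inS.diff α) = α := by
  have h1 : Submodule.projectionOnto _ _ d.isCompl.symm (d.inS.diff α)
      = LinearEquiv.ofInjective d.inS.diff d.inS.diff_injective α :=
    Submodule.projectionOnto_apply_left d.isCompl.symm ⟨d.inS.diff α, ⟨α, rfl⟩⟩
  have h2 : Submodule.projectionOnto _ _ d.isCompl.symm (d.inK.diff X) = 0 :=
    Submodule.projectionOnto_apply_right d.isCompl.symm ⟨d.inK.diff X, ⟨X, rfl⟩⟩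
  rw [projS, LinearMap.comp_apply, map_add, h1, h2, zero_add]
  exact LinearEquiv.symm_apply_apply _ α

theorem inK_projK_add_inS_projS (x : LieAlg 𝕜 nD D) :
    d.inK.diff (d.projK x) + d.inS.diff (d.projS x) = x := by
  obtain ⟨X, α, rfl⟩ := d.exists_add x
  rw [projK_inK_add_inS, projS_inK_add_inS]

theorem projK_inK (X : LieAlg 𝕜 nK K) : d.projK (d.inK.diff X) = X := by
  simpa using d.projK_inK_add_inS X 0

theorem projS_inK (X : LieAlg 𝕜 nK K) : d.projS (d.inK.diff X) = 0 := by
  simpa using d.projS_inK_add_inS X 0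

theorem projK_inS (α : LieAlg 𝕜 nS S) : d.projK (d.inS.diff α) = 0 := by
  simpa using d.projK_inK_add_inS 0 α

theorem projS_inS (α : LieAlg 𝕜 nS S) : d.projS (d.inS.diff α) = α := by
  simpa using d.projS_inK_add_inS 0 α

theorem form_inK (X : LieAlg 𝕜 nK K) (y : LieAlg 𝕜 nD D) :
    d.form (d.inK.diff X) y = d.pairing X (d.projS y) := by
  conv_lhs => rw [← d.inK_projK_add_inS_projS y]
  rw [map_add, d.isotropicK, zero_add, pairing_apply]

theorem form_inS (x : LieAlg 𝕜 nD D) (α : LieAlg 𝕜 nS S) :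
    d.form x (d.inS.diff α) = d.pairing (d.projK x) α := by
  conv_lhs => rw [← d.inK_projK_add_inS_projS x]
  rw [map_add, LinearMap.add_apply, d.isotropicS, add_zero, pairing_apply]

theorem form_eq (x y : LieAlg 𝕜 nD D) :
    d.form x y = d.pairing (d.projK x) (d.projS y) + d.pairing (d.projK y) (d.projS x) := by
  conv_lhs => rw [← d.inK_projK_add_inS_projS x]
  rw [map_add, LinearMap.add_apply, form_inK, d.symm (d.inS.diff _), form_inS]

theorem pairing_dualEquiv_symm (φ : Module.Dual 𝕜 (LieAlg 𝕜 nS S)) (α : LieAlg 𝕜 nS S) :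
    d.pairing (d.dualEquiv.symm φ) α = φ α :=
  congrArg (fun f : Module.Dual 𝕜 (LieAlg 𝕜 nS S) => f α) (d.dualEquiv.apply_symm_apply φ)

theorem pairing_left_cancel {X Y : LieAlg 𝕜 nK K} (h : ∀ α, d.pairing X α = d.pairing Y α) :
    X = Y :=
  d.pairing_injective (LinearMap.ext h)

theorem form_left_cancel {x y : LieAlg 𝕜 nD D} (h : ∀ z, d.form x z = d.form y z) : x = y := by
  rw [← sub_eq_zero]
  apply d.nondegenerate
  intro z
  rw [map_sub, LinearMap.sub_apply, h, sub_self]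

theorem pairing_flip_surjective : Function.Surjective d.pairing.flip := by
  have h := LinearMap.finrank_le_finrank_of_injective d.pairing_injective
  have h' := LinearMap.finrank_le_finrank_of_injective d.pairing_flip_injective
  rw [Subspace.dual_finrank_eq] at h h'
  refine (LinearMap.injective_iff_surjective_of_finrank_eq_finrank ?_).1 d.pairing_flip_injective
  rw [Subspace.dual_finrank_eq]
  exact le_antisymm h' h

theorem form_lie (v x y : LieAlg 𝕜 nD D) : d.form ⁅v, x⁆ y + d.form x ⁅v, y⁆ = 0 := by
  rw [← lie_skew v x, map_neg, LinearMap.neg_apply, d.invariant, neg_add_cancel]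

variable [LieGroup (Model 𝕜 nS) ∞ S] [ConnectedSpace S]

theorem form_Ad (κ : S) (x y : LieAlg 𝕜 nD D) :
    d.form (Ad 𝕜 nD (d.inS.hom κ) x) (Ad 𝕜 nD (d.inS.hom κ) y) = d.form x y :=
  bilin_Ad_eq d.inS d.inS d.form (fun _ x y => d.form_lie _ x y) κ x y

theorem form_Ad_left (κ : S) (x y : LieAlg 𝕜 nD D) :
    d.form (Ad 𝕜 nD (d.inS.hom κ) x) y = d.form x (Ad 𝕜 nD (d.inS.hom κ⁻¹) y) := by
  rw [← d.form_Ad κ x, map_inv, Ad_Ad_inv]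

/-- The left gradient of a function on `K*` is the `𝒦`-component of the conjugate of its right
gradient. -/
theorem leftGrad_eq_projK {f : S → 𝕜} {κ : S} {L : LieAlg 𝕜 nS S →L[𝕜] 𝕜}
    (h : HasDerivOne (fun x => f (κ * x)) L) :
    d.dualEquiv.symm (leftGrad 𝕜 nS f κ)
      = d.projK (d.adK κ (d.dualEquiv.symm (rightGrad 𝕜 nS f κ))) := by
  apply d.pairing_left_cancel
  intro α
  rw [d.pairing_dualEquiv_symm, h.leftGrad_eq, ← d.pairing_dualEquiv_symm, ← d.form_inS, adK,
    LinearMap.comp_apply, d.form_Ad_left, ← d.inS.diff_Ad, ← pairing_apply]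

/-- The Poisson tensor of `K*` is skew. -/
theorem dualPoisson_skew (κ : S) (X Y : LieAlg 𝕜 nK K) :
    d.dualPoisson κ (d.projK (d.adK κ X)) Y = -d.dualPoisson κ (d.projK (d.adK κ Y)) X := by
  have h := d.form_Ad κ (d.inK.diff X) (d.inK.diff Y)
  rw [d.isotropicK, form_eq] at h
  rw [dualPoisson, dualPoisson, form_inK, form_inK]
  exact eq_neg_of_add_eq_zero_left h

end DrinfeldDouble

end DoubleAlgebra

/-! ### The double of `H` inside the double of `K` -/

section Splitting

variable {𝕜 : Type*} [RCLike 𝕜] {nK nS nD nH nT nE : ℕ}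
  {K : Type*} [TopologicalSpace K] [ChartedSpace (EuclideanSpace 𝕜 (Fin nK)) K] [Group K]
  [LieGroup (Model 𝕜 nK) ∞ K]
  {S : Type*} [TopologicalSpace S] [ChartedSpace (EuclideanSpace 𝕜 (Fin nS)) S] [Group S]
  [LieGroup (Model 𝕜 nS) ∞ S] [ConnectedSpace S]
  {D : Type*} [TopologicalSpace D] [ChartedSpace (EuclideanSpace 𝕜 (Fin nD)) D] [Group D]
  [LieGroup (Model 𝕜 nD) ∞ D]
  {H : Type*} [TopologicalSpace H] [ChartedSpace (EuclideanSpace 𝕜 (Fin nH)) H] [Group H]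
  [LieGroup (Model 𝕜 nH) ∞ H]
  {T : Type*} [TopologicalSpace T] [ChartedSpace (EuclideanSpace 𝕜 (Fin nT)) T] [Group T]
  [LieGroup (Model 𝕜 nT) ∞ T] [ConnectedSpace T]
  {E : Type*} [TopologicalSpace E] [ChartedSpace (EuclideanSpace 𝕜 (Fin nE)) E] [Group E]
  [LieGroup (Model 𝕜 nE) ∞ E]
  (d : DrinfeldDouble 𝕜 nK nS nD K S D) (i : LieSubgroup 𝕜 nH nK H K)
  (dH : DrinfeldDouble 𝕜 nH nT nE H T E) (iS : LieSubgroup 𝕜 nT nS T S)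

/-- The linear inclusion `ℋ + ℋ* ⊆ 𝒦 + 𝒦*` of the Lie algebras of the doubles. -/
def doubleIncl : LieAlg 𝕜 nE E →ₗ[𝕜] LieAlg 𝕜 nD D :=
  d.inK.diff ∘ₗ i.diff ∘ₗ dH.projK + d.inS.diff ∘ₗ iS.diff ∘ₗ dH.projS

theorem doubleIncl_apply (x : LieAlg 𝕜 nE E) : doubleIncl d i dH iS x
    = d.inK.diff (i.diff (dH.projK x)) + d.inS.diff (iS.diff (dH.projS x)) := rfl

theorem doubleIncl_inK (X : LieAlg 𝕜 nH H) :
    doubleIncl d i dH iS (dH.inK.diff X) = d.inK.diff (i.diff X) := by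
  rw [doubleIncl_apply, dH.projK_inK, dH.projS_inK, map_zero, map_zero, add_zero]

theorem doubleIncl_inS (α : LieAlg 𝕜 nT T) :
    doubleIncl d i dH iS (dH.inS.diff α) = d.inS.diff (iS.diff α) := by
  rw [doubleIncl_apply, dH.projK_inS, dH.projS_inS, map_zero, map_zero, zero_add]

theorem projK_doubleIncl (x : LieAlg 𝕜 nE E) :
    d.projK (doubleIncl d i dH iS x) = i.diff (dH.projK x) := by
  rw [doubleIncl_apply, d.projK_inK_add_inS]

theorem projS_doubleIncl (x : LieAlg 𝕜 nE E) :
    d.projS (doubleIncl d i dH iS x) = iS.diff (dH.projS x) := by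
  rw [doubleIncl_apply, d.projS_inK_add_inS]

variable {d i dH iS}

theorem form_doubleIncl (hpair : ∀ X α, dH.pairing X α = d.pairing (i.diff X) (iS.diff α))
    (x y : LieAlg 𝕜 nE E) :
    d.form (doubleIncl d i dH iS x) (doubleIncl d i dH iS y) = dH.form x y := by
  rw [d.form_eq, dH.form_eq, projK_doubleIncl, projK_doubleIncl, projS_doubleIncl,
    projS_doubleIncl, hpair, hpair]

variable {M : Submodule 𝕜 (LieAlg 𝕜 nK K)}

theorem IsReductiveSplitting.pairing_eq_zero (hM : IsReductiveSplitting d i iS M)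
    {X : LieAlg 𝕜 nK K} (hX : X ∈ M) (α : LieAlg 𝕜 nT T) : d.pairing X (iS.diff α) = 0 :=
  (hM.dual_eq _).1 ⟨α, rfl⟩ X hX

theorem IsReductiveSplitting.exists_add (hM : IsReductiveSplitting d i iS M)
    (Y : LieAlg 𝕜 nK K) : ∃ m ∈ M, ∃ X, m + i.diff X = Y := by
  have h : Y ∈ M ⊔ LinearMap.range i.diff := by rw [hM.isCompl.sup_eq_top]; trivial
  obtain ⟨m, hm, _, ⟨X, rfl⟩, rfl⟩ := Submodule.mem_sup.1 h
  exact ⟨m, hm, X, rfl⟩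

/-- `ℳ` is the annihilator of `ℋ*`. -/
theorem IsReductiveSplitting.mem_of_pairing_eq_zero (hM : IsReductiveSplitting d i iS M)
    (hpair : ∀ X α, dH.pairing X α = d.pairing (i.diff X) (iS.diff α)) {X : LieAlg 𝕜 nK K}
    (hX : ∀ α, d.pairing X (iS.diff α) = 0) : X ∈ M := by
  obtain ⟨m, hm, Y, rfl⟩ := hM.exists_add X
  have hY : Y = 0 := by
    apply dH.pairing_left_cancel
    intro α
    have := hX α
    rw [map_add, LinearMap.add_apply, hM.pairing_eq_zero hm, zero_add] at this
    rw [hpair, this, map_zero, LinearMap.zero_apply]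
  rw [hY, map_zero, add_zero]
  exact hm

/-- The inclusion `ℋ + ℋ* ⊆ 𝒦 + 𝒦*` commutes with the action of `ℋ*`. The scalar product of the two
sides with `ℋ` and `ℋ*` agrees because the inclusion is isometric, the one with `ℳ` because
`[ℋ, ℳ] ⊆ ℳ`, and the one with `ℋ^⊥ ⊆ 𝒦*` because `ℋ^⊥` is an ideal. -/
theorem IsReductiveSplitting.doubleIncl_lie (hM : IsReductiveSplitting d i iS M)
    (hpair : ∀ X α, dH.pairing X α = d.pairing (i.diff X) (iS.diff α))
    (α : LieAlg 𝕜 nT T) (y : LieAlg 𝕜 nE E) :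
    doubleIncl d i dH iS ⁅dH.inS.diff α, y⁆
      = ⁅d.inS.diff (iS.diff α), doubleIncl d i dH iS y⁆ := by
  obtain ⟨X, β, rfl⟩ := dH.exists_add y
  rw [lie_add, map_add, map_add, lie_add]
  congr 1
  · apply d.form_left_cancel
    intro z
    obtain ⟨Y, γ, rfl⟩ := d.exists_add z
    obtain ⟨m, hm, Z, rfl⟩ := hM.exists_add Y
    -- split `γ` into a part `δ ∈ ℋ^⊥` and a part in `ℋ*`
    obtain ⟨γ', hγ'⟩ := dH.pairing_flip_surjective (d.pairing.flip γ ∘ₗ i.diff)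
    obtain ⟨δ, hδ⟩ : ∃ δ, δ = γ - iS.diff γ' := ⟨_, rfl⟩
    have hγ : γ = δ + iS.diff γ' := by rw [hδ, sub_add_cancel]
    have hδ0 : ∀ Z, d.pairing (i.diff Z) δ = 0 := by
      intro Z
      have h := congrArg (fun f : Module.Dual 𝕜 (LieAlg 𝕜 nH H) => f Z) hγ'
      change dH.pairing Z γ' = d.pairing (i.diff Z) γ at h
      rw [hδ, map_sub, ← hpair, h, sub_self]
    subst hγ
    simp only [map_add]
    have hK : ∀ Z : LieAlg 𝕜 nH H,
        d.form (doubleIncl d i dH iS ⁅dH.inS.diff α, dH.inK.diff X⁆) (d.inK.diff (i.diff Z))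
        = d.form ⁅d.inS.diff (iS.diff α), doubleIncl d i dH iS (dH.inK.diff X)⁆
          (d.inK.diff (i.diff Z)) := by
      intro Z
      rw [← doubleIncl_inK d i dH iS Z, form_doubleIncl hpair, dH.invariant, doubleIncl_inK,
        doubleIncl_inK, d.invariant, ← LieSubgroup.diff_lie, ← d.inK.diff_lie,
        ← i.diff_lie, dH.symm, ← dH.pairing_apply, d.symm, ← d.pairing_apply, hpair]
    have hS : ∀ γ : LieAlg 𝕜 nT T,
        d.form (doubleIncl d i dH iS ⁅dH.inS.diff α, dH.inK.diff X⁆) (d.inS.diff (iS.diff γ))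
        = d.form ⁅d.inS.diff (iS.diff α), doubleIncl d i dH iS (dH.inK.diff X)⁆
          (d.inS.diff (iS.diff γ)) := by
      intro γ
      rw [← doubleIncl_inS d i dH iS γ, form_doubleIncl hpair, doubleIncl_inK,
        doubleIncl_inS, eq_neg_of_add_eq_zero_left (dH.form_lie _ _ _),
        eq_neg_of_add_eq_zero_left (d.form_lie _ _ _), ← dH.inS.diff_lie, ← d.inS.diff_lie,
        ← iS.diff_lie, ← dH.pairing_apply, ← d.pairing_apply, hpair]
    have hm0 : d.form (doubleIncl d i dH iS ⁅dH.inS.diff α, dH.inK.diff X⁆) (d.inK.diff m)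
        = d.form ⁅d.inS.diff (iS.diff α), doubleIncl d i dH iS (dH.inK.diff X)⁆
          (d.inK.diff m) := by
      rw [d.symm, d.form_inK, projS_doubleIncl, hM.pairing_eq_zero hm, doubleIncl_inK,
        d.invariant, ← d.inK.diff_lie, d.symm, ← d.pairing_apply,
        hM.pairing_eq_zero (hM.reductive X m hm)]
    have hδ1 : d.form (doubleIncl d i dH iS ⁅dH.inS.diff α, dH.inK.diff X⁆) (d.inS.diff δ)
        = d.form ⁅d.inS.diff (iS.diff α), doubleIncl d i dH iS (dH.inK.diff X)⁆
          (d.inS.diff δ) := by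
      rw [d.form_inS, projK_doubleIncl, hδ0, doubleIncl_inK,
        eq_neg_of_add_eq_zero_left (d.form_lie _ _ _), ← d.inS.diff_lie, ← d.pairing_apply,
        hM.ideal _ _ hδ0, neg_zero]
    rw [hK, hS, hm0, hδ1]
  · rw [← dH.inS.diff_lie, doubleIncl_inS, doubleIncl_inS, iS.diff_lie, d.inS.diff_lie]

/-- The inclusion `ℋ + ℋ* ⊆ 𝒦 + 𝒦*` intertwines the adjoint actions of `H*` on the Lie algebras
of the two doubles. -/
theorem IsReductiveSplitting.doubleIncl_Ad (hM : IsReductiveSplitting d i iS M)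
    (hpair : ∀ X α, dH.pairing X α = d.pairing (i.diff X) (iS.diff α))
    (u : T) (y : LieAlg 𝕜 nE E) :
    doubleIncl d i dH iS (Ad 𝕜 nE (dH.inS.hom u) y)
      = Ad 𝕜 nD (d.inS.hom (iS.hom u)) (doubleIncl d i dH iS y) := by
  have h := bilin_Ad_eq (d.inS.comp iS) dH.inS (d.form.compl₂ (doubleIncl d i dH iS))
    (fun v x y => by
      rw [LinearMap.compl₂_apply, LinearMap.compl₂_apply, hM.doubleIncl_lie hpair,
        LieSubgroup.comp_diff, d.form_lie]) u
  apply d.form_left_cancel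
  intro z
  have h' := h (Ad 𝕜 nD (d.inS.hom (iS.hom u))⁻¹ z) y
  rw [LinearMap.compl₂_apply, LinearMap.compl₂_apply] at h'
  change d.form (Ad 𝕜 nD (d.inS.hom (iS.hom u)) _) _ = _ at h'
  rw [Ad_Ad_inv] at h'
  rw [d.symm, h', d.form_Ad_left, d.symm, map_inv]

/-- For `λ ∈ H*`, the space `λ ℳ λ⁻¹` is orthogonal to `ℋ + ℋ*`. -/
theorem IsReductiveSplitting.form_adK_doubleIncl (hM : IsReductiveSplitting d i iS M)
    (hpair : ∀ X α, dH.pairing X α = d.pairing (i.diff X) (iS.diff α))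
    (u : T) {Y : LieAlg 𝕜 nK K} (hY : Y ∈ M) (x : LieAlg 𝕜 nE E) :
    d.form (d.adK (iS.hom u) Y) (doubleIncl d i dH iS x) = 0 := by
  rw [DrinfeldDouble.adK, LinearMap.comp_apply, d.form_Ad_left, ← map_inv,
    ← hM.doubleIncl_Ad hpair, d.form_inK, projS_doubleIncl, hM.pairing_eq_zero hY]

theorem IsReductiveSplitting.adK_diff (hM : IsReductiveSplitting d i iS M)
    (hpair : ∀ X α, dH.pairing X α = d.pairing (i.diff X) (iS.diff α))
    (u : T) (X : LieAlg 𝕜 nH H) :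
    d.adK (iS.hom u) (i.diff X) = doubleIncl d i dH iS (dH.adK u X) := by
  rw [DrinfeldDouble.adK, DrinfeldDouble.adK, LinearMap.comp_apply, LinearMap.comp_apply,
    hM.doubleIncl_Ad hpair, doubleIncl_inK]

theorem IsReductiveSplitting.projK_adK_diff (hM : IsReductiveSplitting d i iS M)
    (hpair : ∀ X α, dH.pairing X α = d.pairing (i.diff X) (iS.diff α))
    (u : T) (X : LieAlg 𝕜 nH H) :
    d.projK (d.adK (iS.hom u) (i.diff X)) = i.diff (dH.projK (dH.adK u X)) := by
  rw [hM.adK_diff hpair, projK_doubleIncl]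

theorem IsReductiveSplitting.projK_adK_mem (hM : IsReductiveSplitting d i iS M)
    (hpair : ∀ X α, dH.pairing X α = d.pairing (i.diff X) (iS.diff α))
    (u : T) {Y : LieAlg 𝕜 nK K} (hY : Y ∈ M) : d.projK (d.adK (iS.hom u) Y) ∈ M := by
  refine hM.mem_of_pairing_eq_zero hpair fun α => ?_
  rw [← d.form_inS, ← doubleIncl_inS d i dH iS, hM.form_adK_doubleIncl hpair u hY]

theorem IsReductiveSplitting.dualPoisson_diff_mem (hM : IsReductiveSplitting d i iS M)
    (hpair : ∀ X α, dH.pairing X α = d.pairing (i.diff X) (iS.diff α))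
    (u : T) (X : LieAlg 𝕜 nH H) {Y : LieAlg 𝕜 nK K} (hY : Y ∈ M) :
    d.dualPoisson (iS.hom u) (i.diff X) Y = 0 := by
  rw [DrinfeldDouble.dualPoisson, d.symm, ← doubleIncl_inK d i dH iS,
    hM.form_adK_doubleIncl hpair u hY]

theorem IsReductiveSplitting.dualPoisson_diff_diff (hM : IsReductiveSplitting d i iS M)
    (hpair : ∀ X α, dH.pairing X α = d.pairing (i.diff X) (iS.diff α))
    (u : T) (X Y : LieAlg 𝕜 nH H) :
    d.dualPoisson (iS.hom u) (i.diff X) (i.diff Y) = dH.dualPoisson u X Y := by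
  rw [DrinfeldDouble.dualPoisson, DrinfeldDouble.dualPoisson, hM.adK_diff hpair,
    ← doubleIncl_inK d i dH iS, form_doubleIncl hpair]

end Splitting

/-! ### Linear algebra of the Dirac bracket -/

section MatrixAlgebra

open Matrix

variable {k ι : Type*} [Field k] [Fintype ι] [DecidableEq ι]

/-- The correction term of the Dirac bracket does not depend on the choice of constraints: a change
of constraints by an invertible matrix `A` drops out. -/
theorem sum_mulVec_inv_congr (A C : Matrix ι ι k) (hA : IsUnit A.det) (x y : ι → k) :
    ∑ a, ∑ b, (A *ᵥ x) a * (A * C * Aᵀ)⁻¹ a b * (A *ᵥ y) b = x ⬝ᵥ (C⁻¹ *ᵥ y) := by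
  have h1 : ∑ a, ∑ b, (A *ᵥ x) a * (A * C * Aᵀ)⁻¹ a b * (A *ᵥ y) b
      = (A *ᵥ x) ⬝ᵥ ((A * C * Aᵀ)⁻¹ *ᵥ (A *ᵥ y)) := by
    simp only [dotProduct, Matrix.mulVec, Finset.mul_sum, mul_assoc]
  have hAt : IsUnit Aᵀ.det := by rwa [Matrix.det_transpose]
  rw [h1, Matrix.mul_inv_rev, Matrix.mul_inv_rev, Matrix.mulVec_mulVec, Matrix.mul_assoc,
    Matrix.mul_assoc, Matrix.nonsing_inv_mul _ hA, Matrix.mul_one, ← Matrix.mulVec_mulVec,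
    Matrix.dotProduct_mulVec, Matrix.vecMul_mulVec, Matrix.mul_nonsing_inv _ hAt, Matrix.vecMul_one]

/-- The correction term of the Dirac bracket for functions with `ℳ`-components `μ`, `ν` of the
gradients along `K*`, where `P`, `P'` are the contributions of the gradients along `G`. -/
theorem dotProduct_inv_mulVec (C : Matrix ι ι k) (hC : IsUnit C.det) (μ ν P P' : ι → k) :
    (μ ᵥ* C + P) ⬝ᵥ (C⁻¹ *ᵥ (C *ᵥ ν - P'))
      = μ ⬝ᵥ (C *ᵥ ν) - μ ⬝ᵥ P' + P ⬝ᵥ ν - P ⬝ᵥ (C⁻¹ *ᵥ P') := by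
  rw [Matrix.mulVec_sub, Matrix.mulVec_mulVec, Matrix.nonsing_inv_mul _ hC, Matrix.one_mulVec,
    add_dotProduct, dotProduct_sub, dotProduct_sub, ← Matrix.dotProduct_mulVec,
    ← Matrix.dotProduct_mulVec, Matrix.mulVec_mulVec, Matrix.mul_nonsing_inv _ hC,
    Matrix.one_mulVec]
  ring

theorem transpose_nonsing_inv_eq_neg {C : Matrix ι ι k} (hC : Cᵀ = -C) (hdet : IsUnit C.det) :
    C⁻¹ᵀ = -C⁻¹ := by
  rw [Matrix.transpose_nonsing_inv, hC]
  exact Matrix.inv_eq_left_inv (by rw [neg_mul_neg, Matrix.nonsing_inv_mul _ hdet])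

theorem isSkew_sum {L : Type*} [AddCommGroup L] [Module k L] {C : Matrix ι ι k} (hC : Cᵀ = -C)
    (x : ι → L) : IsSkew (∑ p, ∑ q, C p q • (x p ⊗ₜ[k] x q)) := by
  rw [IsSkew, map_sum]
  simp only [map_sum, map_smul, TensorProduct.comm_tmul]
  rw [Finset.sum_comm, ← Finset.sum_neg_distrib]
  refine Finset.sum_congr rfl fun p _ => ?_
  rw [← Finset.sum_neg_distrib]
  refine Finset.sum_congr rfl fun q _ => ?_
  rw [← neg_smul]
  congr 1
  exact congrFun (congrFun hC p) q

end MatrixAlgebra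

/-! ### The Poisson tensor of `K*` along `H*` -/

section Constraints

variable {𝕜 : Type*} [RCLike 𝕜] {nK nS nD nH nT nE : ℕ}
  {K : Type*} [TopologicalSpace K] [ChartedSpace (EuclideanSpace 𝕜 (Fin nK)) K] [Group K]
  [LieGroup (Model 𝕜 nK) ∞ K]
  {S : Type*} [TopologicalSpace S] [ChartedSpace (EuclideanSpace 𝕜 (Fin nS)) S] [Group S]
  [LieGroup (Model 𝕜 nS) ∞ S] [ConnectedSpace S]
  {D : Type*} [TopologicalSpace D] [ChartedSpace (EuclideanSpace 𝕜 (Fin nD)) D] [Group D]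
  [LieGroup (Model 𝕜 nD) ∞ D]
  {H : Type*} [TopologicalSpace H] [ChartedSpace (EuclideanSpace 𝕜 (Fin nH)) H] [Group H]
  [LieGroup (Model 𝕜 nH) ∞ H]
  {T : Type*} [TopologicalSpace T] [ChartedSpace (EuclideanSpace 𝕜 (Fin nT)) T] [Group T]
  [LieGroup (Model 𝕜 nT) ∞ T] [ConnectedSpace T]
  {E : Type*} [TopologicalSpace E] [ChartedSpace (EuclideanSpace 𝕜 (Fin nE)) E] [Group E]
  [LieGroup (Model 𝕜 nE) ∞ E]
  {d : DrinfeldDouble 𝕜 nK nS nD K S D} {i : LieSubgroup 𝕜 nH nK H K}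
  {dH : DrinfeldDouble 𝕜 nH nT nE H T E} {iS : LieSubgroup 𝕜 nT nS T S}
  {M : Submodule 𝕜 (LieAlg 𝕜 nK K)}

/-- The Poisson tensor of `K*` at `κ`, as a bilinear form on right gradients. -/
def poissonForm (d : DrinfeldDouble 𝕜 nK nS nD K S D) (κ : S) :
    LinearMap.BilinForm 𝕜 (LieAlg 𝕜 nK K) :=
  d.form.compl₁₂ (d.inK.diff ∘ₗ d.projK ∘ₗ d.adK κ) (d.adK κ)

theorem poissonForm_apply (κ : S) (X Y : LieAlg 𝕜 nK K) :
    poissonForm d κ X Y = d.dualPoisson κ (d.projK (d.adK κ X)) Y := rfl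

theorem poissonForm_skew (κ : S) (X Y : LieAlg 𝕜 nK K) :
    poissonForm d κ X Y = -poissonForm d κ Y X :=
  d.dualPoisson_skew κ X Y

/-- Since `(λ ℳ λ⁻¹)_𝒦 ⊆ ℳ`, the projection from `𝒦` to `ℳ` in the definition of `adM`
has no effect. -/
theorem IsReductiveSplitting.coe_adM (hM : IsReductiveSplitting d i iS M)
    (hpair : ∀ X α, dH.pairing X α = d.pairing (i.diff X) (iS.diff α)) (u : T) (Y : M) :
    (adM d hM.isCompl (iS.hom u) Y : LieAlg 𝕜 nK K) = d.projK (d.adK (iS.hom u) Y) := by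
  have h := Submodule.projectionOnto_apply_left hM.isCompl
    ⟨_, hM.projK_adK_mem hpair u Y.2⟩
  exact congrArg Subtype.val h

variable {ι : Type*} {b : ι → M}

/-- The constraint matrix is the Poisson tensor of `K*` on the basis of `ℳ`. -/
theorem IsReductiveSplitting.constraintMatrix_apply (hM : IsReductiveSplitting d i iS M)
    (hpair : ∀ X α, dH.pairing X α = d.pairing (i.diff X) (iS.diff α)) (u : T) (p q : ι) :
    constraintMatrix d hM.isCompl b (iS.hom u) p q = poissonForm d (iS.hom u) (b p) (b q) := by
  rw [constraintMatrix, Matrix.of_apply, hM.coe_adM hpair]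
  rfl

theorem IsReductiveSplitting.constraintMatrix_transpose (hM : IsReductiveSplitting d i iS M)
    (hpair : ∀ X α, dH.pairing X α = d.pairing (i.diff X) (iS.diff α)) (u : T) :
    (constraintMatrix d hM.isCompl b (iS.hom u)).transpose
      = -constraintMatrix d hM.isCompl b (iS.hom u) := by
  ext p q
  rw [Matrix.transpose_apply, Matrix.neg_apply, hM.constraintMatrix_apply hpair,
    hM.constraintMatrix_apply hpair, poissonForm_skew]

theorem IsReductiveSplitting.isSkew_rho [Fintype ι] [DecidableEq ι]
    (hM : IsReductiveSplitting d i iS M)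
    (hpair : ∀ X α, dH.pairing X α = d.pairing (i.diff X) (iS.diff α)) (u : T)
    (hC : IsUnit (constraintMatrix d hM.isCompl b (iS.hom u)).det) :
    IsSkew (rho d hM.isCompl b (iS.hom u)) := by
  have h := transpose_nonsing_inv_eq_neg (hM.constraintMatrix_transpose (b := b) hpair u) hC
  exact isSkew_sum h _

theorem IsReductiveSplitting.poissonForm_diff_mem (hM : IsReductiveSplitting d i iS M)
    (hpair : ∀ X α, dH.pairing X α = d.pairing (i.diff X) (iS.diff α))
    (u : T) (X : LieAlg 𝕜 nH H) {Y : LieAlg 𝕜 nK K} (hY : Y ∈ M) :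
    poissonForm d (iS.hom u) (i.diff X) Y = 0 := by
  rw [poissonForm_apply, hM.projK_adK_diff hpair, hM.dualPoisson_diff_mem hpair u _ hY]

theorem IsReductiveSplitting.poissonForm_mem_diff (hM : IsReductiveSplitting d i iS M)
    (hpair : ∀ X α, dH.pairing X α = d.pairing (i.diff X) (iS.diff α))
    (u : T) (X : LieAlg 𝕜 nH H) {Y : LieAlg 𝕜 nK K} (hY : Y ∈ M) :
    poissonForm d (iS.hom u) Y (i.diff X) = 0 := by
  rw [poissonForm_skew, hM.poissonForm_diff_mem hpair u X hY, neg_zero]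

theorem IsReductiveSplitting.poissonForm_diff_diff (hM : IsReductiveSplitting d i iS M)
    (hpair : ∀ X α, dH.pairing X α = d.pairing (i.diff X) (iS.diff α))
    (u : T) (X Y : LieAlg 𝕜 nH H) :
    poissonForm d (iS.hom u) (i.diff X) (i.diff Y) = poissonForm dH u X Y := by
  rw [poissonForm_apply, poissonForm_apply, hM.projK_adK_diff hpair,
    hM.dualPoisson_diff_diff hpair]

end Constraints

/-! ### The bracket in terms of right gradients -/

section QBracket

variable {𝕜 : Type*} [RCLike 𝕜] {nG nK nS nD nH nT nE : ℕ}
  {G : Type*} [TopologicalSpace G] [ChartedSpace (EuclideanSpace 𝕜 (Fin nG)) G] [Group G]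
  [LieGroup (Model 𝕜 nG) ∞ G]
  {K : Type*} [TopologicalSpace K] [ChartedSpace (EuclideanSpace 𝕜 (Fin nK)) K] [Group K]
  {S : Type*} [TopologicalSpace S] [ChartedSpace (EuclideanSpace 𝕜 (Fin nS)) S] [Group S]
  [LieGroup (Model 𝕜 nS) ∞ S]
  {D : Type*} [TopologicalSpace D] [ChartedSpace (EuclideanSpace 𝕜 (Fin nD)) D] [Group D]
  [LieGroup (Model 𝕜 nD) ∞ D]

/-- The right gradient of `F : G × K* → 𝕜` with respect to `K*`, as an element of `𝒦`. -/
def gradS (d : DrinfeldDouble 𝕜 nK nS nD K S D) (F : G × S → 𝕜) (q : G × S) : LieAlg 𝕜 nK K :=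
  d.dualEquiv.symm (rightGrad 𝕜 nS (fun κ => F (q.1, κ)) q.2)

/-- The function `F` on `G × K*` is differentiable with respect to `K*` at the point `q`. -/
def DiffS (F : G × S → 𝕜) (q : G × S) : Prop :=
  ∃ L, HasDerivOne (𝕜 := 𝕜) (n := nS) (fun x : S => F (q.1, q.2 * x)) L

theorem pairing_gradS (d : DrinfeldDouble 𝕜 nK nS nD K S D) {F : G × S → 𝕜} {q : G × S}
    {L : LieAlg 𝕜 nS S →L[𝕜] 𝕜} (h : HasDerivOne (fun x : S => F (q.1, q.2 * x)) L)
    (α : LieAlg 𝕜 nS S) : d.pairing (gradS d F q) α = L α := by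
  rw [gradS, d.pairing_dualEquiv_symm]
  exact rightGrad_apply h α

theorem qBracket_eq [ConnectedSpace S] (j : LieSubgroup 𝕜 nK nG K G)
    (d : DrinfeldDouble 𝕜 nK nS nD K S D) (R : LieAlg 𝕜 nG G ⊗[𝕜] LieAlg 𝕜 nG G)
    (r : S → LieAlg 𝕜 nG G ⊗[𝕜] LieAlg 𝕜 nG G) {F₁ F₂ : G × S → 𝕜} {q : G × S}
    (h₁ : DiffS (𝕜 := 𝕜) (nS := nS) F₁ q) (h₂ : DiffS (𝕜 := 𝕜) (nS := nS) F₂ q) :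
    qBracket j d R r F₁ F₂ q = poissonForm d q.2 (gradS d F₁ q) (gradS d F₂ q)
      + (rightGrad 𝕜 nG (fun g => F₁ (g, q.2)) q.1
            (j.diff (d.projK (d.adK q.2 (gradS d F₂ q))))
          - rightGrad 𝕜 nG (fun g => F₂ (g, q.2)) q.1
            (j.diff (d.projK (d.adK q.2 (gradS d F₁ q)))))
      + (ev2 (rightGrad 𝕜 nG (fun g => F₁ (g, q.2)) q.1)
            (rightGrad 𝕜 nG (fun g => F₂ (g, q.2)) q.1) (R + r q.2)
          - ev2 (leftGrad 𝕜 nG (fun g => F₁ (g, q.2)) q.1)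
            (leftGrad 𝕜 nG (fun g => F₂ (g, q.2)) q.1) R) := by
  obtain ⟨L₁, h₁⟩ := h₁
  obtain ⟨L₂, h₂⟩ := h₂
  have e₁ := d.leftGrad_eq_projK (f := fun κ => F₁ (q.1, κ)) (κ := q.2) h₁
  have e₂ := d.leftGrad_eq_projK (f := fun κ => F₂ (q.1, κ)) (κ := q.2) h₂
  simp only [qBracket]
  rw [e₁, e₂]
  rfl

theorem diffS_of_contMDiffAt {F : G × S → 𝕜} {q : G × S}
    (hF : ContMDiffAt ((Model 𝕜 nG).prod (Model 𝕜 nS)) 𝓘(𝕜, 𝕜) ∞ F q) :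
    DiffS (𝕜 := 𝕜) (nS := nS) F q := by
  refine ⟨_, HasDerivOne.of_mdifferentiableAt ?_⟩
  have h1 : ContMDiffAt (Model 𝕜 nS) ((Model 𝕜 nG).prod (Model 𝕜 nS)) ∞
      (fun x : S => (q.1, q.2 * x)) 1 :=
    contMDiffAt_const.prodMk contMDiffAt_mul_left
  have h2 : ContMDiffAt ((Model 𝕜 nG).prod (Model 𝕜 nS)) 𝓘(𝕜, 𝕜) ∞ F (q.1, q.2 * 1) := by
    rw [mul_one]; exact hF
  exact (h2.comp (1 : S) h1).mdifferentiableAt (by simp)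

theorem rightGrad_congr {A : Type*} [TopologicalSpace A]
    [ChartedSpace (EuclideanSpace 𝕜 (Fin nG)) A] [Group A] {f f' : A → 𝕜} {a a' : A}
    (h : ∀ᶠ x in 𝓝 (1 : A), f (a * x) = f' (a' * x)) :
    rightGrad 𝕜 nG f a = rightGrad 𝕜 nG f' a' := by
  have := Filter.EventuallyEq.mfderiv_eq (I := Model 𝕜 nG) (I' := 𝓘(𝕜, 𝕜)) h
  rw [rightGrad, rightGrad]
  exact congrArg (fun L : LieAlg 𝕜 nG A →L[𝕜] 𝕜 => L.toLinearMap) this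

theorem leftGrad_congr {A : Type*} [TopologicalSpace A]
    [ChartedSpace (EuclideanSpace 𝕜 (Fin nG)) A] [Group A] {f f' : A → 𝕜} {a a' : A}
    (h : ∀ᶠ x in 𝓝 (1 : A), f (x * a) = f' (x * a')) :
    leftGrad 𝕜 nG f a = leftGrad 𝕜 nG f' a' := by
  have := Filter.EventuallyEq.mfderiv_eq (I := Model 𝕜 nG) (I' := 𝓘(𝕜, 𝕜)) h
  rw [leftGrad, leftGrad]
  exact congrArg (fun L : LieAlg 𝕜 nG A →L[𝕜] 𝕜 => L.toLinearMap) this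

theorem rightGrad_const {A : Type*} [TopologicalSpace A]
    [ChartedSpace (EuclideanSpace 𝕜 (Fin nG)) A] [Group A] (c : 𝕜) (a : A) :
    rightGrad 𝕜 nG (fun _ : A => c) a = 0 :=
  LinearMap.ext fun v => rightGrad_apply (f := fun _ => c) (a := a) (hasDerivOne_const c) v

theorem leftGrad_const {A : Type*} [TopologicalSpace A]
    [ChartedSpace (EuclideanSpace 𝕜 (Fin nG)) A] [Group A] (c : 𝕜) (a : A) :
    leftGrad 𝕜 nG (fun _ : A => c) a = 0 :=
  LinearMap.ext fun v => leftGrad_apply (f := fun _ => c) (a := a) (hasDerivOne_const c) v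

end QBracket

/-! ### Restriction of functions to `G × H*` -/

section Restriction

variable {𝕜 : Type*} [RCLike 𝕜] {nG nK nS nD nH nT nE : ℕ}
  {G : Type*} [TopologicalSpace G] [ChartedSpace (EuclideanSpace 𝕜 (Fin nG)) G] [Group G]
  [LieGroup (Model 𝕜 nG) ∞ G]
  {K : Type*} [TopologicalSpace K] [ChartedSpace (EuclideanSpace 𝕜 (Fin nK)) K] [Group K]
  [LieGroup (Model 𝕜 nK) ∞ K]
  {S : Type*} [TopologicalSpace S] [ChartedSpace (EuclideanSpace 𝕜 (Fin nS)) S] [Group S]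
  [LieGroup (Model 𝕜 nS) ∞ S] [ConnectedSpace S]
  {D : Type*} [TopologicalSpace D] [ChartedSpace (EuclideanSpace 𝕜 (Fin nD)) D] [Group D]
  [LieGroup (Model 𝕜 nD) ∞ D]
  {H : Type*} [TopologicalSpace H] [ChartedSpace (EuclideanSpace 𝕜 (Fin nH)) H] [Group H]
  [LieGroup (Model 𝕜 nH) ∞ H]
  {T : Type*} [TopologicalSpace T] [ChartedSpace (EuclideanSpace 𝕜 (Fin nT)) T] [Group T]
  [LieGroup (Model 𝕜 nT) ∞ T] [ConnectedSpace T]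
  {E : Type*} [TopologicalSpace E] [ChartedSpace (EuclideanSpace 𝕜 (Fin nE)) E] [Group E]
  [LieGroup (Model 𝕜 nE) ∞ E]
  {d : DrinfeldDouble 𝕜 nK nS nD K S D} {i : LieSubgroup 𝕜 nH nK H K}
  {dH : DrinfeldDouble 𝕜 nH nT nE H T E} {iS : LieSubgroup 𝕜 nT nS T S}
  {M : Submodule 𝕜 (LieAlg 𝕜 nK K)} {F : G × S → 𝕜} {Φ : G × T → 𝕜} {g : G} {u : T}

theorem rightGrad_restrict (h : ∀ᶠ p in 𝓝 (g, u), F (inclQ iS.hom p) = Φ p) :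
    rightGrad 𝕜 nG (fun x => F (x, iS.hom u)) g = rightGrad 𝕜 nG (fun x => Φ (x, u)) g := by
  have ht : Filter.Tendsto (fun x : G => (g * x, u)) (𝓝 1) (𝓝 (g, u)) := by
    have : IsTopologicalGroup G := topologicalGroup_of_lieGroup (Model 𝕜 nG) ∞
    exact Continuous.tendsto' (by fun_prop) _ _ (by simp)
  exact rightGrad_congr (ht.eventually h)

theorem leftGrad_restrict (h : ∀ᶠ p in 𝓝 (g, u), F (inclQ iS.hom p) = Φ p) :
    leftGrad 𝕜 nG (fun x => F (x, iS.hom u)) g = leftGrad 𝕜 nG (fun x => Φ (x, u)) g := by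
  have ht : Filter.Tendsto (fun x : G => (x * g, u)) (𝓝 1) (𝓝 (g, u)) := by
    have : IsTopologicalGroup G := topologicalGroup_of_lieGroup (Model 𝕜 nG) ∞
    exact Continuous.tendsto' (by fun_prop) _ _ (by simp)
  exact leftGrad_congr (ht.eventually h)

theorem HasDerivOne.restrict {L : LieAlg 𝕜 nS S →L[𝕜] 𝕜}
    (hL : HasDerivOne (fun x : S => F (g, iS.hom u * x)) L)
    (h : ∀ᶠ p in 𝓝 (g, u), F (inclQ iS.hom p) = Φ p) :
    HasDerivOne (fun y : T => Φ (g, u * y)) (L ∘L LinearMap.toContinuousLinearMap iS.diff) := by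
  refine (hL.comp_hom iS).congr ?_
  have ht : Filter.Tendsto (fun y : T => (g, u * y)) (𝓝 1) (𝓝 (g, u)) := by
    have : IsTopologicalGroup T := topologicalGroup_of_lieGroup (Model 𝕜 nT) ∞
    exact Continuous.tendsto' (by fun_prop) _ _ (by simp)
  filter_upwards [ht.eventually h] with y hy
  rw [← hy, inclQ, map_mul]

/-- If `F` vanishes on `G × H*`, its gradient along `K*` is in `ℳ`. -/
theorem IsReductiveSplitting.gradS_mem (hM : IsReductiveSplitting d i iS M)
    (hpair : ∀ X α, dH.pairing X α = d.pairing (i.diff X) (iS.diff α))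
    (hF : DiffS (𝕜 := 𝕜) (nS := nS) F (g, iS.hom u))
    (h : ∀ᶠ p in 𝓝 (g, u), F (inclQ iS.hom p) = 0) : gradS d F (g, iS.hom u) ∈ M := by
  obtain ⟨L, hL⟩ := hF
  refine hM.mem_of_pairing_eq_zero hpair fun α => ?_
  rw [pairing_gradS d hL]
  exact congrArg (fun T : LieAlg 𝕜 nT T →L[𝕜] 𝕜 => T α)
    ((hL.restrict (Φ := fun _ => 0) h).unique (hasDerivOne_const 0))

/-- The gradient of the restriction to `G × H*` is the `ℋ`-component of the gradient. -/
theorem IsReductiveSplitting.gradS_restrict (hM : IsReductiveSplitting d i iS M)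
    (hpair : ∀ X α, dH.pairing X α = d.pairing (i.diff X) (iS.diff α))
    (hF : DiffS (𝕜 := 𝕜) (nS := nS) F (g, iS.hom u))
    (h : ∀ᶠ p in 𝓝 (g, u), F (inclQ iS.hom p) = Φ p) :
    ∃ m : M, m + i.diff (gradS dH Φ (g, u)) = gradS d F (g, iS.hom u) := by
  obtain ⟨L, hL⟩ := hF
  obtain ⟨m, hm, X, hX⟩ := hM.exists_add (gradS d F (g, iS.hom u))
  refine ⟨⟨m, hm⟩, ?_⟩
  have : gradS dH Φ (g, u) = X := by
    apply dH.pairing_left_cancel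
    intro α
    have h1 := pairing_gradS d hL (iS.diff α)
    rw [← hX, map_add, LinearMap.add_apply, hM.pairing_eq_zero hm, zero_add] at h1
    rw [pairing_gradS dH (hL.restrict h), hpair, h1]
    rfl
  rw [this, hX]

end Restriction

/-! ### Dirac reduction -/

section DiracReduction

open Matrix

variable {𝕜 : Type*} [RCLike 𝕜] {nG nK nS nD nH nT nE : ℕ}
  {G : Type*} [TopologicalSpace G] [ChartedSpace (EuclideanSpace 𝕜 (Fin nG)) G] [Group G]
  [LieGroup (Model 𝕜 nG) ∞ G]
  {K : Type*} [TopologicalSpace K] [ChartedSpace (EuclideanSpace 𝕜 (Fin nK)) K] [Group K]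
  [LieGroup (Model 𝕜 nK) ∞ K]
  {S : Type*} [TopologicalSpace S] [ChartedSpace (EuclideanSpace 𝕜 (Fin nS)) S] [Group S]
  [LieGroup (Model 𝕜 nS) ∞ S] [ConnectedSpace S]
  {D : Type*} [TopologicalSpace D] [ChartedSpace (EuclideanSpace 𝕜 (Fin nD)) D] [Group D]
  [LieGroup (Model 𝕜 nD) ∞ D]
  {H : Type*} [TopologicalSpace H] [ChartedSpace (EuclideanSpace 𝕜 (Fin nH)) H] [Group H]
  [LieGroup (Model 𝕜 nH) ∞ H]
  {T : Type*} [TopologicalSpace T] [ChartedSpace (EuclideanSpace 𝕜 (Fin nT)) T] [Group T]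
  [LieGroup (Model 𝕜 nT) ∞ T] [ConnectedSpace T]
  {E : Type*} [TopologicalSpace E] [ChartedSpace (EuclideanSpace 𝕜 (Fin nE)) E] [Group E]
  [LieGroup (Model 𝕜 nE) ∞ E]
  {d : DrinfeldDouble 𝕜 nK nS nD K S D} {i : LieSubgroup 𝕜 nH nK H K}
  {dH : DrinfeldDouble 𝕜 nH nT nE H T E} {iS : LieSubgroup 𝕜 nT nS T S}
  {M : Submodule 𝕜 (LieAlg 𝕜 nK K)} {g : G} {u : T}
  {ι : Type*} [Fintype ι] [DecidableEq ι] {b : Module.Basis ι 𝕜 M}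
  {j : LieSubgroup 𝕜 nK nG K G} {R : LieAlg 𝕜 nG G ⊗[𝕜] LieAlg 𝕜 nG G}
  {r : S → LieAlg 𝕜 nG G ⊗[𝕜] LieAlg 𝕜 nG G}

theorem map_sum_smul {k L : Type*} [Field k] [AddCommGroup L] [Module k L] (f : L →ₗ[k] k)
    (μ : ι → k) (b : ι → L) : f (∑ c, μ c • b c) = μ ⬝ᵥ fun c => f (b c) := by
  simp [dotProduct]

theorem ev2_inclMM_rho (hM : IsReductiveSplitting d i iS M)
    (hpair : ∀ X α, dH.pairing X α = d.pairing (i.diff X) (iS.diff α))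
    (φ ψ : Module.Dual 𝕜 (LieAlg 𝕜 nG G)) :
    ev2 φ ψ (inclMM j (rho d hM.isCompl b (iS.hom u)))
      = (fun a => φ (j.diff (d.projK (d.adK (iS.hom u) (b a)))))
        ⬝ᵥ ((constraintMatrix d hM.isCompl b (iS.hom u))⁻¹ *ᵥ
          fun a => ψ (j.diff (d.projK (d.adK (iS.hom u) (b a))))) := by
  simp only [rho, map_sum, map_smul, inclMM, TensorProduct.map_tmul, ev2, LinearMap.comp_apply,
    LinearMap.mul'_apply, Submodule.subtype_apply, hM.coe_adM hpair, dotProduct, Matrix.mulVec,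
    Finset.mul_sum, smul_eq_mul]
  refine Finset.sum_congr rfl fun p _ => Finset.sum_congr rfl fun q _ => ?_
  ring

/-- Constraints with linearly independent differentials have gradients `∑ A_{ac} M^c` with an
invertible matrix `A`. -/
theorem IsReductiveSplitting.exists_constraint_gradS (hM : IsReductiveSplitting d i iS M)
    (hpair : ∀ X α, dH.pairing X α = d.pairing (i.diff X) (iS.diff α))
    {Z : ι → G × S → 𝕜} (hd : ∀ a, DiffS (𝕜 := 𝕜) (nS := nS) (Z a) (g, iS.hom u))
    (hZ : ∀ a, ∀ᶠ p in 𝓝 (g, u), Z a (inclQ iS.hom p) = 0)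
    (hli : LinearIndependent 𝕜 (fun a =>
        (rightGrad 𝕜 nG (fun x => Z a (x, iS.hom u)) g,
          rightGrad 𝕜 nS (fun κ => Z a (g, κ)) (iS.hom u)))) :
    ∃ A : Matrix ι ι 𝕜, IsUnit A.det ∧
      ∀ a, gradS d (Z a) (g, iS.hom u) = ∑ c, A a c • (b c : LieAlg 𝕜 nK K) := by
  have hmem := fun a => hM.gradS_mem hpair (hd a) (hZ a)
  let v : ι → M := fun a => ⟨gradS d (Z a) (g, iS.hom u), hmem a⟩
  have hv : LinearIndependent 𝕜 v := by
    refine LinearIndependent.of_comp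
      (LinearMap.inr 𝕜 (Module.Dual 𝕜 (LieAlg 𝕜 nG G)) (Module.Dual 𝕜 (LieAlg 𝕜 nS S))
        ∘ₗ d.dualEquiv.toLinearMap ∘ₗ M.subtype) ?_
    convert hli using 1
    funext a
    have h0 : rightGrad 𝕜 nG (fun x => Z a (x, iS.hom u)) g = 0 :=
      (rightGrad_restrict (Φ := fun _ => 0) (hZ a)).trans (rightGrad_const 0 g)
    rw [h0]
    exact Prod.ext rfl (d.dualEquiv.apply_symm_apply _)
  refine ⟨Matrix.of fun a => b.equivFun (v a), ?_, fun a => ?_⟩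
  · rw [← Matrix.isUnit_iff_isUnit_det, ← Matrix.linearIndependent_rows_iff_isUnit]
    exact hv.map' b.equivFun.toLinearMap b.equivFun.ker
  · have h := congrArg M.subtype (b.sum_equivFun (v a)).symm
    rw [map_sum] at h
    simpa using h

/-- The Dirac bracket of extensions is the bracket of `G × H*` given by `r*`. The correction term
cancels all contributions of the `ℳ`-components of the gradients along `K*`, and leaves the pairing
of the gradients along `G` with `ρ`. -/
theorem IsReductiveSplitting.diracBracket_eq (hM : IsReductiveSplitting d i iS M)
    (hpair : ∀ X α, dH.pairing X α = d.pairing (i.diff X) (iS.diff α))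
    (hC : IsUnit (constraintMatrix d hM.isCompl b (iS.hom u)).det)
    {Z : ι → G × S → 𝕜} (hd : ∀ a, DiffS (𝕜 := 𝕜) (nS := nS) (Z a) (g, iS.hom u))
    (hZ : ∀ a, ∀ᶠ p in 𝓝 (g, u), Z a (inclQ iS.hom p) = 0)
    (hli : LinearIndependent 𝕜 (fun a =>
        (rightGrad 𝕜 nG (fun x => Z a (x, iS.hom u)) g,
          rightGrad 𝕜 nS (fun κ => Z a (g, κ)) (iS.hom u)))) :
    IsUnit (bracketMatrix (qBracket j d R r) Z (g, iS.hom u)).det ∧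
    ∀ (F₁ F₂ : G × S → 𝕜) (Φ₁ Φ₂ : G × T → 𝕜),
      DiffS (𝕜 := 𝕜) (nS := nS) F₁ (g, iS.hom u) → DiffS (𝕜 := 𝕜) (nS := nS) F₂ (g, iS.hom u) →
      (∀ᶠ p in 𝓝 (g, u), F₁ (inclQ iS.hom p) = Φ₁ p) →
      (∀ᶠ p in 𝓝 (g, u), F₂ (inclQ iS.hom p) = Φ₂ p) →
      diracBracket (qBracket j d R r) Z F₁ F₂ (g, iS.hom u)
        = qBracket (j.comp i) dH R (rStar d hM.isCompl b j iS r) Φ₁ Φ₂ (g, u) := by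
  obtain ⟨A, hA, hgrad⟩ := hM.exists_constraint_gradS hpair (b := b) hd hZ hli
  have hr0 : ∀ a, rightGrad 𝕜 nG (fun x => Z a (x, iS.hom u)) g = 0 := fun a =>
    (rightGrad_restrict (Φ := fun _ => 0) (hZ a)).trans (rightGrad_const 0 g)
  have hl0 : ∀ a, leftGrad 𝕜 nG (fun x => Z a (x, iS.hom u)) g = 0 := fun a =>
    (leftGrad_restrict (Φ := fun _ => 0) (hZ a)).trans (leftGrad_const 0 g)
  have ev0l : ∀ (φ : Module.Dual 𝕜 (LieAlg 𝕜 nG G)) t, ev2 0 φ t = 0 := by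
    intro φ t; simp [ev2]
  have ev0r : ∀ (φ : Module.Dual 𝕜 (LieAlg 𝕜 nG G)) t, ev2 φ 0 t = 0 := by
    intro φ t; simp [ev2]
  set C := constraintMatrix d hM.isCompl b (iS.hom u) with hCdef
  have hmat : bracketMatrix (qBracket j d R r) Z (g, iS.hom u) = A * C * Aᵀ := by
    ext p q
    rw [bracketMatrix, Matrix.of_apply, qBracket_eq j d R r (hd p) (hd q)]
    simp only [hr0, hl0, ev0l, LinearMap.zero_apply, hgrad]
    simp only [map_sum, map_smul, LinearMap.sum_apply, LinearMap.smul_apply, smul_eq_mul,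
      Matrix.mul_apply, Matrix.transpose_apply, hCdef, hM.constraintMatrix_apply hpair,
      Finset.sum_mul, Finset.mul_sum, sub_zero, add_zero]
    refine Finset.sum_congr rfl fun p _ => Finset.sum_congr rfl fun q _ => ?_
    ring
  refine ⟨?_, ?_⟩
  · rw [hmat, Matrix.det_mul, Matrix.det_mul, Matrix.det_transpose]
    exact (hA.mul hC).mul hA
  intro F₁ F₂ Φ₁ Φ₂ hF₁ hF₂ h₁ h₂
  obtain ⟨m₁, hm₁⟩ := hM.gradS_restrict hpair hF₁ h₁
  obtain ⟨m₂, hm₂⟩ := hM.gradS_restrict hpair hF₂ h₂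
  have hΦ₁ : DiffS (𝕜 := 𝕜) (nS := nT) Φ₁ (g, u) := let ⟨_, hL⟩ := hF₁; ⟨_, hL.restrict h₁⟩
  have hΦ₂ : DiffS (𝕜 := 𝕜) (nS := nT) Φ₂ (g, u) := let ⟨_, hL⟩ := hF₂; ⟨_, hL.restrict h₂⟩
  set p₁ := rightGrad 𝕜 nG (fun x => Φ₁ (x, u)) g with hp₁
  set p₂ := rightGrad 𝕜 nG (fun x => Φ₂ (x, u)) g with hp₂
  -- `θ` takes right gradients along `K*` to left gradients along `K*`, viewed in `𝒢`
  set θ : LieAlg 𝕜 nK K →ₗ[𝕜] LieAlg 𝕜 nG G := j.diff ∘ₗ d.projK ∘ₗ d.adK (iS.hom u) with hθ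
  have hθa : ∀ X, j.diff (d.projK (d.adK (iS.hom u) X)) = θ X := fun _ => rfl
  set P₁ : ι → 𝕜 := fun a => p₁ (θ (b a)) with hP₁
  set P₂ : ι → 𝕜 := fun a => p₂ (θ (b a)) with hP₂
  set μ : ι → 𝕜 := b.equivFun m₁ with hμ
  set ν : ι → 𝕜 := b.equivFun m₂ with hν
  have hm₁s : (m₁ : LieAlg 𝕜 nK K) = ∑ c, μ c • (b c : LieAlg 𝕜 nK K) := by
    have h := congrArg M.subtype (b.sum_equivFun m₁).symm
    rw [map_sum] at h
    exact h
  have hm₂s : (m₂ : LieAlg 𝕜 nK K) = ∑ c, ν c • (b c : LieAlg 𝕜 nK K) := by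
    have h := congrArg M.subtype (b.sum_equivFun m₂).symm
    rw [map_sum] at h
    exact h
  have hFZ : ∀ a, qBracket j d R r F₁ (Z a) (g, iS.hom u) = (A *ᵥ (μ ᵥ* C + P₁)) a := by
    intro a
    rw [qBracket_eq j d R r hF₁ (hd a)]
    simp only [rightGrad_restrict h₁, hr0, hl0, ev0r, LinearMap.zero_apply, hgrad, ← hm₁]
    have hf := map_sum_smul (poissonForm d (iS.hom u) (m₁ + i.diff (gradS dH Φ₁ (g, u)))
      + p₁ ∘ₗ θ) (A a) (fun c => (b c : LieAlg 𝕜 nK K))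
    simp only [LinearMap.add_apply, LinearMap.comp_apply] at hf
    rw [sub_zero, sub_zero, add_zero, hθa, hf, Matrix.mulVec]
    congr 1
    funext c
    rw [map_add, LinearMap.add_apply, hM.poissonForm_diff_mem hpair u _ (b c).2, add_zero, hm₁s,
      ← LinearMap.flip_apply, map_sum_smul]
    simp only [Pi.add_apply, Matrix.vecMul, LinearMap.flip_apply, hCdef,
      hM.constraintMatrix_apply hpair, hP₁]
  have hZF : ∀ a, qBracket j d R r (Z a) F₂ (g, iS.hom u) = (A *ᵥ (C *ᵥ ν - P₂)) a := by
    intro a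
    rw [qBracket_eq j d R r (hd a) hF₂]
    simp only [rightGrad_restrict h₂, hr0, hl0, ev0l, LinearMap.zero_apply, hgrad, ← hm₂]
    have hf := map_sum_smul ((poissonForm d (iS.hom u)).flip (m₂ + i.diff (gradS dH Φ₂ (g, u)))
      - p₂ ∘ₗ θ) (A a) (fun c => (b c : LieAlg 𝕜 nK K))
    simp only [LinearMap.sub_apply, LinearMap.comp_apply] at hf
    rw [sub_zero, zero_sub, add_zero, hθa, ← sub_eq_add_neg]
    refine hf.trans ?_
    rw [Matrix.mulVec]
    congr 1
    funext c
    change poissonForm d (iS.hom u) (b c) (m₂ + i.diff (gradS dH Φ₂ (g, u))) - p₂ (θ (b c)) = _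
    rw [map_add, hM.poissonForm_mem_diff hpair u _ (b c).2, add_zero, hm₂s, map_sum_smul,
      dotProduct_comm]
    simp only [Pi.sub_apply, Matrix.mulVec, hCdef, hM.constraintMatrix_apply hpair, hP₂]
  rw [diracBracket, hmat]
  simp only [hFZ, hZF]
  rw [sum_mulVec_inv_congr A C hA, dotProduct_inv_mulVec C hC,
    qBracket_eq j d R r hF₁ hF₂, qBracket_eq (j.comp i) dH R _ hΦ₁ hΦ₂, rStar]
  have hρ : ev2 p₁ p₂ (inclMM j (rho d hM.isCompl b (iS.hom u))) = P₁ ⬝ᵥ (C⁻¹ *ᵥ P₂) :=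
    ev2_inclMM_rho (j := j) (u := u) (b := b) hM hpair p₁ p₂
  have hmm : poissonForm d (iS.hom u) m₁ m₂ = μ ⬝ᵥ (C *ᵥ ν) := by
    rw [hm₁s, ← LinearMap.flip_apply, map_sum_smul]
    congr 1
    funext c
    rw [LinearMap.flip_apply, hm₂s, map_sum_smul, dotProduct_comm]
    simp only [Matrix.mulVec, hCdef, hM.constraintMatrix_apply hpair]
  have hmP : p₂ (θ m₁) = μ ⬝ᵥ P₂ := by
    rw [hm₁s, ← LinearMap.comp_apply, map_sum_smul]
    rfl
  have hPm : p₁ (θ m₂) = P₁ ⬝ᵥ ν := by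
    rw [hm₂s, ← LinearMap.comp_apply, map_sum_smul, dotProduct_comm]
    rfl
  simp only [rightGrad_restrict h₁, rightGrad_restrict h₂, leftGrad_restrict h₁,
    leftGrad_restrict h₂]
  rw [← hm₁, ← hm₂]
  simp only [map_add, LinearMap.add_apply, hM.poissonForm_diff_mem hpair u _ m₂.2,
    hM.poissonForm_mem_diff hpair u _ m₁.2, hM.poissonForm_diff_diff hpair, LieSubgroup.comp_diff,
    ← hM.projK_adK_diff hpair]
  simp only [hθa]
  rw [hρ, hmm, hmP, hPm]
  ring

end DiracReduction

/-! ### Slices for Lie subgroups -/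

section Slice

variable {𝕜 : Type*} [RCLike 𝕜] {m n : ℕ}
  {T : Type*} [TopologicalSpace T] [ChartedSpace (EuclideanSpace 𝕜 (Fin m)) T] [Group T]
  [LieGroup (Model 𝕜 m) ∞ T]
  {S : Type*} [TopologicalSpace S] [ChartedSpace (EuclideanSpace 𝕜 (Fin n)) S] [Group S]
  [LieGroup (Model 𝕜 n) ∞ S]

/-- If a smooth map of finite-dimensional spaces has invertible derivative at a point, it restricts
to a diffeomorphism of a neighbourhood of this point, inside any given open set, onto an open
set. -/
theorem exists_openPartialHomeomorph_contDiffOn {X Y : Type*} [NormedAddCommGroup X]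
    [NormedSpace 𝕜 X] [NormedAddCommGroup Y] [NormedSpace 𝕜 Y] [CompleteSpace X]
    {f : X → Y} {s : Set X} (hs : IsOpen s) (hf : ContDiffOn 𝕜 ∞ f s) {x : X} (hx : x ∈ s)
    {L : X ≃L[𝕜] Y} (hL : HasFDerivAt f (L : X →L[𝕜] Y) x) :
    ∃ e : OpenPartialHomeomorph X Y, x ∈ e.source ∧ e.source ⊆ s ∧ (∀ y, e y = f y) ∧
      ContDiffOn 𝕜 ∞ e.symm e.target := by
  have hfx : ContDiffAt 𝕜 ∞ f x := hf.contDiffAt (hs.mem_nhds hx)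
  set e₀ := hfx.toOpenPartialHomeomorph f hL (by simp) with he₀
  have hcoe : ∀ y, e₀ y = f y := fun y => rfl
  have hopen : IsOpen (s ∩ fderiv 𝕜 f ⁻¹' Set.range ((↑) : (X ≃L[𝕜] Y) → X →L[𝕜] Y)) :=
    (hf.continuousOn_fderiv_of_isOpen hs (by simp)).isOpen_inter_preimage hs
      ContinuousLinearEquiv.isOpen
  refine ⟨e₀.restrOpen _ hopen, ?_, ?_, hcoe, ?_⟩
  · rw [OpenPartialHomeomorph.restrOpen_source]
    exact ⟨hfx.mem_toOpenPartialHomeomorph_source hL (by simp), hx, L, hL.fderiv.symm⟩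
  · rw [OpenPartialHomeomorph.restrOpen_source]
    exact fun y hy => hy.2.1
  · intro y hy
    have hy' := (e₀.restrOpen _ hopen).map_target hy
    rw [OpenPartialHomeomorph.restrOpen_source] at hy'
    obtain ⟨-, hs', L', hL'⟩ := hy'
    have hfy : ContDiffAt 𝕜 ∞ f ((e₀.restrOpen _ hopen).symm y) := hf.contDiffAt (hs.mem_nhds hs')
    refine ((e₀.restrOpen _ hopen).contDiffAt_symm (f₀' := L') hy ?_ hfy).contDiffWithinAt
    rw [hL']
    exact (hfy.differentiableAt (by simp)).hasFDerivAt

/-- The inclusion of the Lie algebra of a Lie subgroup, in coordinates. -/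
def coordIncl (iS : LieSubgroup 𝕜 m n T S) :
    EuclideanSpace 𝕜 (Fin m) →L[𝕜] EuclideanSpace 𝕜 (Fin n) :=
  (coord 𝕜 n S).toContinuousLinearMap ∘L LinearMap.toContinuousLinearMap iS.diff ∘L
    (coord 𝕜 m T).symm.toContinuousLinearMap

theorem coordIncl_injective (iS : LieSubgroup 𝕜 m n T S) :
    Function.Injective (coordIncl iS) := iS.diff_injective

variable (iS : LieSubgroup 𝕜 m n T S) (N : Submodule 𝕜 (EuclideanSpace 𝕜 (Fin n)))

/-- The product of the point of `T` with coordinates `x` and of the point of `S` with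
coordinates `v ∈ N` relative to the identity. -/
def sliceMul (p : EuclideanSpace 𝕜 (Fin m) × N) : S :=
  iS.hom ((chartOne 𝕜 m T).symm p.1) * (chartOne 𝕜 n S).symm (origin 𝕜 n S + p.2)

/-- The points at which `sliceMul` can be read in the charts. -/
def sliceDomain : Set (EuclideanSpace 𝕜 (Fin m) × N) :=
  {p | p.1 ∈ (chartOne 𝕜 m T).target ∧ origin 𝕜 n S + p.2 ∈ (chartOne 𝕜 n S).target} ∩
    sliceMul iS N ⁻¹' (chartOne 𝕜 n S).source

theorem isOpen_sliceMul_domain :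
    IsOpen {p : EuclideanSpace 𝕜 (Fin m) × N |
      p.1 ∈ (chartOne 𝕜 m T).target ∧ origin 𝕜 n S + p.2 ∈ (chartOne 𝕜 n S).target} :=
  ((isOpen_extChartAt_target (I := Model 𝕜 m) (1 : T)).preimage continuous_fst).inter
    ((isOpen_extChartAt_target (I := Model 𝕜 n) (1 : S)).preimage
      (by fun_prop : Continuous fun p : EuclideanSpace 𝕜 (Fin m) × N =>
        origin 𝕜 n S + (p.2 : EuclideanSpace 𝕜 (Fin n))))

theorem contMDiffOn_sliceMul :
    ContMDiffOn 𝓘(𝕜, EuclideanSpace 𝕜 (Fin m) × N) (Model 𝕜 n) ∞ (sliceMul iS N)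
      {p | p.1 ∈ (chartOne 𝕜 m T).target ∧ origin 𝕜 n S + p.2 ∈ (chartOne 𝕜 n S).target} := by
  have h1 : ContMDiff 𝓘(𝕜, EuclideanSpace 𝕜 (Fin m) × N) 𝓘(𝕜, EuclideanSpace 𝕜 (Fin m)) ∞
      (fun p : EuclideanSpace 𝕜 (Fin m) × N => p.1) := contDiff_fst.contMDiff
  have h2 : ContMDiff 𝓘(𝕜, EuclideanSpace 𝕜 (Fin m) × N) 𝓘(𝕜, EuclideanSpace 𝕜 (Fin n)) ∞
      (fun p : EuclideanSpace 𝕜 (Fin m) × N => origin 𝕜 n S + (p.2 : EuclideanSpace 𝕜 (Fin n))) :=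
    (contDiff_const.add (N.subtypeL.contDiff.comp contDiff_snd)).contMDiff
  have hT := contMDiffOn_extChartAt_symm (I := Model 𝕜 m) (n := ∞) (1 : T)
  have hS := contMDiffOn_extChartAt_symm (I := Model 𝕜 n) (n := ∞) (1 : S)
  exact (iS.smooth.comp_contMDiffOn (hT.comp h1.contMDiffOn fun p hp => hp.1)).mul
    (hS.comp h2.contMDiffOn fun p hp => hp.2)

theorem isOpen_sliceDomain : IsOpen (sliceDomain iS N) :=
  (contMDiffOn_sliceMul iS N).continuousOn.isOpen_inter_preimage (isOpen_sliceMul_domain N)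
    (isOpen_extChartAt_source (I := Model 𝕜 n) (1 : S))

theorem contDiffOn_chartOne_sliceMul :
    ContDiffOn 𝕜 ∞ (fun p => chartOne 𝕜 n S (sliceMul iS N p)) (sliceDomain iS N) := by
  rw [← contMDiffOn_iff_contDiffOn]
  have hS := contMDiffOn_extChartAt (I := Model 𝕜 n) (n := ∞) (x := (1 : S))
  rw [← extChartAt_source (Model 𝕜 n)] at hS
  exact hS.comp ((contMDiffOn_sliceMul iS N).mono Set.inter_subset_left) fun p hp => hp.2

theorem sliceMul_zero (x : EuclideanSpace 𝕜 (Fin m)) :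
    sliceMul iS N (x, 0) = iS.hom ((chartOne 𝕜 m T).symm x) := by
  rw [sliceMul, ZeroMemClass.coe_zero, add_zero, chartOne_symm_origin, mul_one]

theorem sliceMul_origin (v : N) :
    sliceMul iS N (origin 𝕜 m T, v) = (chartOne 𝕜 n S).symm (origin 𝕜 n S + v) := by
  rw [sliceMul, chartOne_symm_origin, map_one, one_mul]

theorem origin_mem_sliceDomain : (origin 𝕜 m T, 0) ∈ sliceDomain iS N := by
  refine ⟨⟨mem_extChartAt_target _, ?_⟩, ?_⟩
  · rw [ZeroMemClass.coe_zero, add_zero]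
    exact mem_extChartAt_target _
  · rw [Set.mem_preimage, sliceMul_zero, chartOne_symm_origin, map_one]
    exact mem_extChartAt_source _

theorem tendsto_origin_add :
    Filter.Tendsto (fun v : N => origin 𝕜 n S + (v : EuclideanSpace 𝕜 (Fin n))) (𝓝 0)
      (𝓝 (origin 𝕜 n S)) :=
  Continuous.tendsto' (by fun_prop) _ _ (by simp)

/-- At the identity, the slice map has the derivative `(v, w) ↦ v + w`, where the Lie algebra of `T`
is viewed inside that of `S`. -/
theorem hasFDerivAt_chartOne_sliceMul :
    HasFDerivAt (fun p => chartOne 𝕜 n S (sliceMul iS N p)) ((coordIncl iS).coprod N.subtypeL)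
      (origin 𝕜 m T, 0) := by
  have hd := (((contDiffOn_chartOne_sliceMul iS N).contDiffAt
    ((isOpen_sliceDomain iS N).mem_nhds (origin_mem_sliceDomain iS N))).differentiableAt
      (by simp)).hasFDerivAt
  refine hd.congr_fderiv ?_
  have hz : ∀ᶠ v : N in 𝓝 0, origin 𝕜 n S + (v : EuclideanSpace 𝕜 (Fin n))
      = ((fun p => chartOne 𝕜 n S (sliceMul iS N p)) ∘ fun v => (origin 𝕜 m T, v)) v := by
    filter_upwards [tendsto_origin_add N (target_mem_nhds (𝕜 := 𝕜) (n := n) (A := S))] with v hv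
    rw [Function.comp_apply, sliceMul_origin, PartialEquiv.right_inv _ hv]
  have h1 := (HasFDerivAt.comp (origin 𝕜 m T) (f := fun x => (x, (0 : N))) hd
    ((hasFDerivAt_id (𝕜 := 𝕜) _).prodMk (hasFDerivAt_const (0 : N) _))).congr_of_eventuallyEq
      (f₁ := fun x => chartOne 𝕜 n S (iS.hom ((chartOne 𝕜 m T).symm x)))
      (.of_forall fun x => by simp only [Function.comp_apply, sliceMul_zero])
  have h2 := (HasFDerivAt.comp (0 : N) (f := fun v => (origin 𝕜 m T, v)) hd
    ((hasFDerivAt_const (origin 𝕜 m T) _).prodMk (hasFDerivAt_id (𝕜 := 𝕜) _))).congr_of_eventuallyEq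
      (f₁ := fun v : N => origin 𝕜 n S + (v : EuclideanSpace 𝕜 (Fin n))) hz
  have e1 := h1.unique iS.hasGroupDeriv
  have e2 := h2.unique (N.subtypeL.hasFDerivAt.const_add (origin 𝕜 n S))
  exact ContinuousLinearMap.prod_ext (e1.trans (ContinuousLinearMap.coprod_comp_inl _ _).symm)
    (e2.trans (ContinuousLinearMap.coprod_comp_inr _ _).symm)

/-- A local slice for a Lie subgroup `T` of `S` near the identity: near the identity, `S` is a
product of `T` and of a complement `N` of the Lie algebra of `T`. Here `τ` and `ξ` are the two
components. -/
theorem exists_slice_one (hN : IsCompl (LinearMap.range (coordIncl iS).toLinearMap) N) :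
    ∃ (U : Set T) (W : Set S) (τ : S → T) (ξ : S → N), IsOpen U ∧ 1 ∈ U ∧ IsOpen W ∧
      ContMDiffOn (Model 𝕜 n) (Model 𝕜 m) ∞ τ W ∧ ContMDiffOn (Model 𝕜 n) 𝓘(𝕜, N) ∞ ξ W ∧
      Set.MapsTo τ W U ∧ (∀ κ ∈ W, ξ κ = 0 → iS.hom (τ κ) = κ) ∧
      ∀ u ∈ U, iS.hom u ∈ W ∧ τ (iS.hom u) = u ∧ ξ (iS.hom u) = 0 ∧
        ∀ᶠ v : N in 𝓝 0, ξ (iS.hom u * (chartOne 𝕜 n S).symm (origin 𝕜 n S + v)) = v := by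
  let L : (EuclideanSpace 𝕜 (Fin m) × N) ≃L[𝕜] EuclideanSpace 𝕜 (Fin n) :=
    (LinearEquiv.ofBijective ((coordIncl iS).coprod N.subtypeL).toLinearMap (by
      constructor
      · rw [← LinearMap.ker_eq_bot]
        refine LinearMap.ker_coprod_of_disjoint_range _ _ ?_ |>.trans ?_
        · exact (Submodule.range_subtype N).symm ▸ hN.disjoint
        · rw [LinearMap.ker_eq_bot.2 (coordIncl_injective iS),
            show LinearMap.ker N.subtypeL.toLinearMap = ⊥ from N.ker_subtype]
          exact Submodule.prod_bot
      · rw [← LinearMap.range_eq_top]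
        refine (LinearMap.range_coprod _ _).trans ?_
        exact (Submodule.range_subtype N).symm ▸ hN.sup_eq_top)).toContinuousLinearEquiv
  have hL : HasFDerivAt (fun p => chartOne 𝕜 n S (sliceMul iS N p))
      (L : (EuclideanSpace 𝕜 (Fin m) × N) →L[𝕜] EuclideanSpace 𝕜 (Fin n)) (origin 𝕜 m T, 0) :=
    hasFDerivAt_chartOne_sliceMul iS N
  obtain ⟨e, he0, hes, hef, hesymm⟩ := exists_openPartialHomeomorph_contDiffOn
    (isOpen_sliceDomain iS N) (contDiffOn_chartOne_sliceMul iS N) (origin_mem_sliceDomain iS N) hL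
  have hleft : ∀ p ∈ e.source, e.symm (chartOne 𝕜 n S (sliceMul iS N p)) = p := fun p hp => by
    rw [← hef, e.left_inv hp]
  -- the part of the slice chart whose projection to `T` stays in its domain
  have hY : IsOpen (e.target ∩ e.symm ⁻¹' {p | (p.1, (0 : N)) ∈ e.source}) :=
    e.symm.continuousOn.isOpen_inter_preimage e.open_target
      (e.open_source.preimage (by fun_prop))
  refine ⟨(chartOne 𝕜 m T).source ∩ chartOne 𝕜 m T ⁻¹' {x | (x, (0 : N)) ∈ e.source},
    (chartOne 𝕜 n S).source ∩ chartOne 𝕜 n S ⁻¹'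
      (e.target ∩ e.symm ⁻¹' {p | (p.1, (0 : N)) ∈ e.source}),
    fun κ => (chartOne 𝕜 m T).symm (e.symm (chartOne 𝕜 n S κ)).1,
    fun κ => (e.symm (chartOne 𝕜 n S κ)).2, ?_, ⟨mem_extChartAt_source _, he0⟩, ?_, ?_, ?_, ?_, ?_,
    ?_⟩
  · exact (continuousOn_extChartAt (I := Model 𝕜 m) (1 : T)).isOpen_inter_preimage
      (isOpen_extChartAt_source _) (e.open_source.preimage (by fun_prop))
  · exact (continuousOn_extChartAt (I := Model 𝕜 n) (1 : S)).isOpen_inter_preimage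
      (isOpen_extChartAt_source _) hY
  all_goals
    have hS := contMDiffOn_extChartAt (I := Model 𝕜 n) (n := ∞) (x := (1 : S))
    rw [← extChartAt_source (Model 𝕜 n)] at hS
  · have hT := contMDiffOn_extChartAt_symm (I := Model 𝕜 m) (n := ∞) (1 : T)
    refine hT.comp (((contDiff_fst.comp_contDiffOn hesymm).contMDiffOn).comp
      (hS.mono Set.inter_subset_left) fun κ hκ => hκ.2.1) fun κ hκ => ?_
    exact (hes (e.map_target hκ.2.1)).1.1
  · exact (contDiff_snd.comp_contDiffOn hesymm).contMDiffOn.comp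
      (hS.mono Set.inter_subset_left) fun κ hκ => hκ.2.1
  · intro κ hκ
    have h1 := (hes (e.map_target hκ.2.1)).1.1
    refine ⟨(chartOne 𝕜 m T).map_target h1, ?_⟩
    rw [Set.mem_preimage, (chartOne 𝕜 m T).right_inv h1]
    exact hκ.2.2
  · intro κ hκ h0
    have h0' : e.symm (chartOne 𝕜 n S κ) = ((e.symm (chartOne 𝕜 n S κ)).1, 0) := Prod.ext rfl h0
    have hdom := hes hκ.2.2
    refine (chartOne 𝕜 n S).injOn ?_ hκ.1 ?_
    · rw [← sliceMul_zero iS N]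
      exact hdom.2
    · rw [← sliceMul_zero iS N, ← hef, ← h0', e.right_inv hκ.2.1]
  · intro u hu
    have hdom := hes hu.2
    have hu1 : sliceMul iS N (chartOne 𝕜 m T u, 0) = iS.hom u := by
      rw [sliceMul_zero, (chartOne 𝕜 m T).left_inv hu.1]
    have hu2 := hleft _ hu.2
    rw [hu1] at hu2
    have hu3 : chartOne 𝕜 n S (iS.hom u) ∈ e.target := by
      rw [← hu1, ← hef]
      exact e.map_source hu.2
    refine ⟨⟨?_, hu3, ?_⟩, ?_, ?_, ?_⟩
    · rw [← hu1]
      exact hdom.2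
    · rw [Set.mem_preimage, hu2]
      exact hu.2
    · simp only [hu2]
      exact (chartOne 𝕜 m T).left_inv hu.1
    · simp only [hu2]
    · have ht : Filter.Tendsto (fun v : N => (chartOne 𝕜 m T u, v)) (𝓝 0)
          (𝓝 (chartOne 𝕜 m T u, 0)) := Continuous.tendsto' (by fun_prop) _ _ rfl
      filter_upwards [ht (e.open_source.mem_nhds hu.2)] with v hv
      have h1 := congrArg Prod.snd (hleft _ hv)
      simp only [sliceMul, (chartOne 𝕜 m T).left_inv hu.1] at h1
      exact h1

/-- A local slice for a Lie subgroup `T` of `S` near any point of an open set `U` of `T`. The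
derivative of the transversal component `ξ` along `T` is the projection along the Lie algebra
of `T`. -/
theorem exists_slice (hN : IsCompl (LinearMap.range (coordIncl iS).toLinearMap) N)
    {U : Set T} (hU : IsOpen U) {V : Set S} (hV : IsOpen V) (hUV : Set.MapsTo iS.hom U V)
    {u₀ : T} (hu₀ : u₀ ∈ U) :
    ∃ (U₀ : Set T) (W : Set S) (τ : S → T) (ξ : S → N), IsOpen U₀ ∧ u₀ ∈ U₀ ∧ U₀ ⊆ U ∧
      IsOpen W ∧ W ⊆ V ∧
      ContMDiffOn (Model 𝕜 n) (Model 𝕜 m) ∞ τ W ∧ ContMDiffOn (Model 𝕜 n) 𝓘(𝕜, N) ∞ ξ W ∧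
      iS.hom '' U₀ = {κ | κ ∈ W ∧ ξ κ = 0} ∧
      (Topology.IsEmbedding (fun x : U => iS.hom x) → iS.hom '' U ∩ W = {κ | κ ∈ W ∧ ξ κ = 0}) ∧
      ∀ u ∈ U₀, τ (iS.hom u) = u ∧
        ∃ L : LieAlg 𝕜 n S →L[𝕜] N, HasDerivOne (fun x => ξ (iS.hom u * x)) L ∧
          (∀ α, L (iS.diff α) = 0) ∧ ∀ v : N, L ((coord 𝕜 n S).symm v) = v := by
  have hgT : IsTopologicalGroup T := topologicalGroup_of_lieGroup (Model 𝕜 m) ∞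
  have hgS : IsTopologicalGroup S := topologicalGroup_of_lieGroup (Model 𝕜 n) ∞
  obtain ⟨U', W', τ, ξ, hU', h1U', hW', hτ, hξ, hmaps, hzero, hU'W⟩ := exists_slice_one iS N hN
  -- translate the slice at the identity by `u₀`
  set s : S := iS.hom u₀⁻¹ with hs
  have hsm : ∀ u, s * iS.hom u = iS.hom (u₀⁻¹ * u) := fun u => (map_mul _ _ _).symm
  have hW₀ : IsOpen ((s * ·) ⁻¹' W') := hW'.preimage (continuous_const_mul s)
  have hmul : ContMDiff (Model 𝕜 n) (Model 𝕜 n) ∞ (s * ·) := contMDiff_mul_left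
  have hτ' : ContMDiffOn (Model 𝕜 n) (Model 𝕜 m) ∞ (fun κ => u₀ * τ (s * κ))
      ((s * ·) ⁻¹' W') :=
    (contMDiff_mul_left (a := u₀)).comp_contMDiffOn (hτ.comp hmul.contMDiffOn fun κ hκ => hκ)
  have hW₁ : IsOpen (((s * ·) ⁻¹' W' ∩ (fun κ => u₀ * τ (s * κ)) ⁻¹' U) ∩ V) :=
    (hτ'.continuousOn.isOpen_inter_preimage hW₀ hU).inter hV
  have hU₀ : IsOpen ((u₀⁻¹ * ·) ⁻¹' U' ∩ U) :=
    (hU'.preimage (continuous_const_mul u₀⁻¹)).inter hU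
  -- in the embedded case, `W` has to avoid the rest of `U`
  obtain ⟨W₂, hW₂, hsub, hemb⟩ : ∃ W₂ : Set S, IsOpen W₂ ∧
      iS.hom '' ((u₀⁻¹ * ·) ⁻¹' U' ∩ U) ⊆ W₂ ∧
      (Topology.IsEmbedding (fun x : U => iS.hom x) →
        iS.hom '' U ∩ W₂ ⊆ iS.hom '' ((u₀⁻¹ * ·) ⁻¹' U' ∩ U)) := by
    by_cases he : Topology.IsEmbedding (fun x : U => iS.hom x)
    · obtain ⟨W₂, hW₂, hpre⟩ := he.isOpen_iff.1 (hU₀.preimage continuous_subtype_val)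
      have hiff : ∀ u (hu : u ∈ U), iS.hom u ∈ W₂ ↔ u ∈ (u₀⁻¹ * ·) ⁻¹' U' ∩ U := fun u hu =>
        Set.ext_iff.1 hpre ⟨u, hu⟩
      refine ⟨W₂, hW₂, ?_, fun _ => ?_⟩
      · rintro _ ⟨u, hu, rfl⟩
        exact (hiff u hu.2).2 hu
      · rintro _ ⟨⟨u, hu, rfl⟩, huW⟩
        exact ⟨u, (hiff u hu).1 huW, rfl⟩
    · exact ⟨Set.univ, isOpen_univ, Set.subset_univ _, fun h => absurd h he⟩
  have himage : iS.hom '' ((u₀⁻¹ * ·) ⁻¹' U' ∩ U)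
      = {κ | κ ∈ (((s * ·) ⁻¹' W' ∩ (fun κ => u₀ * τ (s * κ)) ⁻¹' U) ∩ V) ∩ W₂ ∧
        ξ (s * κ) = 0} := by
    ext κ
    constructor
    · rintro ⟨u, hu, rfl⟩
      obtain ⟨h1, h2, h3, -⟩ := hU'W _ hu.1
      refine ⟨⟨⟨⟨?_, ?_⟩, hUV hu.2⟩, hsub ⟨u, hu, rfl⟩⟩, ?_⟩
      · rw [Set.mem_preimage, hsm]; exact h1
      · rw [Set.mem_preimage, hsm, h2, mul_inv_cancel_left]; exact hu.2
      · rw [hsm, h3]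
    · rintro ⟨⟨⟨⟨h1, h2⟩, -⟩, -⟩, h0⟩
      refine ⟨u₀ * τ (s * κ), ⟨?_, h2⟩, ?_⟩
      · rw [Set.mem_preimage, inv_mul_cancel_left]
        exact hmaps h1
      · rw [map_mul, hzero _ h1 h0, hs, map_inv, mul_inv_cancel_left]
  refine ⟨_, _, fun κ => u₀ * τ (s * κ), fun κ => ξ (s * κ), hU₀, ?_, Set.inter_subset_right,
    hW₁.inter hW₂, fun κ hκ => hκ.1.2, hτ'.mono fun κ hκ => hκ.1.1.1,
    hξ.comp hmul.contMDiffOn fun κ hκ => hκ.1.1.1, himage, fun he => ?_, fun u hu => ?_⟩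
  · refine ⟨?_, hu₀⟩
    rw [Set.mem_preimage, inv_mul_cancel]
    exact h1U'
  · refine Set.Subset.antisymm ?_ fun κ hκ => ⟨?_, hκ.1⟩
    · rintro κ ⟨hκU, hκW⟩
      exact himage ▸ hemb he ⟨hκU, hκW.2⟩
    · rw [← himage] at hκ
      exact Set.image_mono Set.inter_subset_right hκ
  · obtain ⟨h1, h2, -, h4⟩ := hU'W _ hu.1
    refine ⟨?_, ?_⟩
    · change u₀ * τ (s * iS.hom u) = u
      rw [hsm]
      exact (congrArg (u₀ * ·) h2).trans (mul_inv_cancel_left _ _)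
    have hd : MDifferentiableAt (Model 𝕜 n) 𝓘(𝕜, N) (fun x => ξ (s * (iS.hom u * x))) 1 := by
      have hc : ContMDiff (Model 𝕜 n) (Model 𝕜 n) ∞ (fun x => s * (iS.hom u * x)) :=
        hmul.comp contMDiff_mul_left
      have hx : ContMDiffAt (Model 𝕜 n) 𝓘(𝕜, N) ∞ ξ (s * (iS.hom u * 1)) := by
        rw [mul_one, hsm]
        exact hξ.contMDiffAt (hW'.mem_nhds h1)
      exact (hx.comp (1 : S) hc.contMDiffAt).mdifferentiableAt (by simp)
    obtain ⟨L, hL⟩ : ∃ L, HasDerivOne (𝕜 := 𝕜) (n := n) (fun x => ξ (s * (iS.hom u * x))) L :=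
      ⟨_, HasDerivOne.of_mdifferentiableAt hd⟩
    refine ⟨L, hL, fun α => ?_, fun v => ?_⟩
    · have hc : HasDerivOne (𝕜 := 𝕜) (n := m)
          (fun y : T => ξ (s * (iS.hom u * iS.hom y))) 0 := by
        refine (hasDerivOne_const (0 : N)).congr ?_
        have ht : Filter.Tendsto (fun y : T => u₀⁻¹ * (u * y)) (𝓝 1) (𝓝 (u₀⁻¹ * u)) :=
          Continuous.tendsto' (by fun_prop) _ _ (by simp)
        filter_upwards [ht (hU'.mem_nhds hu.1)] with y hy
        rw [← map_mul, hsm]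
        exact (hU'W _ hy).2.2.1
      exact congrArg (fun A : LieAlg 𝕜 m T →L[𝕜] N => A α) ((hL.comp_hom iS).unique hc)
    · have hL' : HasFDerivAt (𝕜 := 𝕜)
          (fun x => ξ (s * (iS.hom u * (chartOne 𝕜 n S).symm x)))
          (L ∘L (coord 𝕜 n S).symm.toContinuousLinearMap)
          (origin 𝕜 n S + ((0 : N) : EuclideanSpace 𝕜 (Fin n))) := by
        rw [ZeroMemClass.coe_zero, add_zero]
        exact hL
      have h5 := (hL'.comp (0 : N)
        (N.subtypeL.hasFDerivAt.const_add (origin 𝕜 n S))).congr_of_eventuallyEq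
        (f₁ := fun v => v) (by
          filter_upwards [h4] with v hv
          simp only [Function.comp_apply, Submodule.subtypeL_apply]
          rw [← mul_assoc, hsm, hv])
      exact congrArg (fun A : N →L[𝕜] N => A v) (h5.unique (hasFDerivAt_id _))

end Slice

/-! ### Local constraints and extensions -/

section LocalConstraints

variable {𝕜 : Type*} [RCLike 𝕜] {nG nK nS nD nH nT nE : ℕ}
  {G : Type*} [TopologicalSpace G] [ChartedSpace (EuclideanSpace 𝕜 (Fin nG)) G] [Group G]
  [LieGroup (Model 𝕜 nG) ∞ G]
  {K : Type*} [TopologicalSpace K] [ChartedSpace (EuclideanSpace 𝕜 (Fin nK)) K] [Group K]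
  [LieGroup (Model 𝕜 nK) ∞ K]
  {S : Type*} [TopologicalSpace S] [ChartedSpace (EuclideanSpace 𝕜 (Fin nS)) S] [Group S]
  [LieGroup (Model 𝕜 nS) ∞ S] [ConnectedSpace S]
  {D : Type*} [TopologicalSpace D] [ChartedSpace (EuclideanSpace 𝕜 (Fin nD)) D] [Group D]
  [LieGroup (Model 𝕜 nD) ∞ D]
  {H : Type*} [TopologicalSpace H] [ChartedSpace (EuclideanSpace 𝕜 (Fin nH)) H] [Group H]
  [LieGroup (Model 𝕜 nH) ∞ H]
  {T : Type*} [TopologicalSpace T] [ChartedSpace (EuclideanSpace 𝕜 (Fin nT)) T] [Group T]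
  [LieGroup (Model 𝕜 nT) ∞ T] [ConnectedSpace T]
  {E : Type*} [TopologicalSpace E] [ChartedSpace (EuclideanSpace 𝕜 (Fin nE)) E] [Group E]
  [LieGroup (Model 𝕜 nE) ∞ E]
  {d : DrinfeldDouble 𝕜 nK nS nD K S D} {i : LieSubgroup 𝕜 nH nK H K}
  {dH : DrinfeldDouble 𝕜 nH nT nE H T E} {iS : LieSubgroup 𝕜 nT nS T S}
  {M : Submodule 𝕜 (LieAlg 𝕜 nK K)} {g : G} {u : T}
  {ι : Type*} {b : Module.Basis ι 𝕜 M}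
  {j : LieSubgroup 𝕜 nK nG K G} {R : LieAlg 𝕜 nG G ⊗[𝕜] LieAlg 𝕜 nG G}
  {r : S → LieAlg 𝕜 nG G ⊗[𝕜] LieAlg 𝕜 nG G}

/-- Constraints that depend on `K*` only and have the right gradients `M^a` have the bracket
matrix `C`. -/
theorem IsReductiveSplitting.bracketMatrix_eq [Fintype ι] [DecidableEq ι]
    (hM : IsReductiveSplitting d i iS M)
    (hpair : ∀ X α, dH.pairing X α = d.pairing (i.diff X) (iS.diff α)) {ξ : ι → S → 𝕜}
    (hd : ∀ a, ∃ L, HasDerivOne (𝕜 := 𝕜) (n := nS) (fun x => ξ a (iS.hom u * x)) L)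
    (hξ : ∀ a, rightGrad 𝕜 nS (ξ a) (iS.hom u) = d.pairing (b a)) :
    bracketMatrix (qBracket j d R r) (fun a (q : G × S) => ξ a q.2) (g, iS.hom u)
      = constraintMatrix d hM.isCompl b (iS.hom u) := by
  have hgrad : ∀ a, gradS d (fun q : G × S => ξ a q.2) (g, iS.hom u) = b a := fun a =>
    (congrArg d.dualEquiv.symm (hξ a)).trans (d.dualEquiv.symm_apply_apply _)
  have hd' : ∀ a, DiffS (𝕜 := 𝕜) (nS := nS) (fun q : G × S => ξ a q.2) (g, iS.hom u) := hd
  ext p q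
  rw [bracketMatrix, Matrix.of_apply, qBracket_eq j d R r (hd' p) (hd' q), hgrad, hgrad,
    hM.constraintMatrix_apply hpair]
  simp only [rightGrad_const, leftGrad_const]
  simp [ev2]

/-- `Q(H*)` is locally cut out by constraints that depend on `K*` only: the components of the
transversal coordinate of a slice with respect to the basis of `ℳ`, which is dual to the
transversal space. -/
theorem IsReductiveSplitting.exists_constraints (hM : IsReductiveSplitting d i iS M)
    {U : Set T} (hU : IsOpen U) {V : Set S} (hV : IsOpen V) (hUV : Set.MapsTo iS.hom U V)
    {u₀ : T} (hu₀ : u₀ ∈ U) (b : Module.Basis ι 𝕜 M) :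
    ∃ (U₀ : Set T) (W : Set S) (ξ : ι → S → 𝕜),
      IsOpen U₀ ∧ u₀ ∈ U₀ ∧ U₀ ⊆ U ∧ IsOpen W ∧ W ⊆ V ∧
      (∀ a, ContMDiffOn (Model 𝕜 nS) 𝓘(𝕜, 𝕜) ∞ (ξ a) W) ∧
      iS.hom '' U₀ = {κ | κ ∈ W ∧ ∀ a, ξ a κ = 0} ∧
      (Topology.IsEmbedding (fun x : U => iS.hom x) →
        iS.hom '' U ∩ W = {κ | κ ∈ W ∧ ∀ a, ξ a κ = 0}) ∧
      ∀ a, ∀ u ∈ U₀, (∃ L, HasDerivOne (𝕜 := 𝕜) (n := nS) (fun x => ξ a (iS.hom u * x)) L) ∧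
        rightGrad 𝕜 nS (ξ a) (iS.hom u) = d.pairing (b a) := by
  obtain ⟨N, hN⟩ := Submodule.exists_isCompl (LinearMap.range (coordIncl iS).toLinearMap)
  obtain ⟨U₀, W, τ, ξ, hU₀, hu, hUU, hW, hWV, -, hξ, himage, hemb, hgrad⟩ :=
    exists_slice iS N hN hU hV hUV hu₀
  let P : ι → N →L[𝕜] 𝕜 := fun a => LinearMap.toContinuousLinearMap
    (d.pairing (b a) ∘ₗ (coord 𝕜 nS S).symm.toLinearMap ∘ₗ N.subtype)
  have hP : ∀ a v, P a v = d.pairing (b a) ((coord 𝕜 nS S).symm v) := fun a v => rfl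
  have hP0 : ∀ v, (∀ a, P a v = 0) ↔ v = 0 := by
    refine fun v => ⟨fun h => ?_, fun h a => by rw [h, map_zero]⟩
    have hv : (coord 𝕜 nS S).symm v ∈ LinearMap.range iS.diff := by
      refine (hM.dual_eq _).2 fun X hX => ?_
      have := b.ext (f₁ := d.pairing.flip ((coord 𝕜 nS S).symm v) ∘ₗ M.subtype) (f₂ := 0) h
      exact congrArg (fun f : M →ₗ[𝕜] 𝕜 => f ⟨X, hX⟩) this
    obtain ⟨β, hβ⟩ := hv
    have hv' : (v : EuclideanSpace 𝕜 (Fin nS)) ∈ LinearMap.range (coordIncl iS).toLinearMap :=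
      ⟨coord 𝕜 nT T β, hβ⟩
    exact Subtype.ext (Submodule.disjoint_def.1 hN.disjoint _ hv' v.2)
  refine ⟨U₀, W, fun a κ => P a (ξ κ), hU₀, hu, hUU, hW, hWV, fun a => ?_, ?_, ?_, ?_⟩
  · exact (P a).contDiff.contMDiff.comp_contMDiffOn hξ
  · simp only [hP0]
    exact himage
  · simp only [hP0]
    exact hemb
  · intro a u hu
    obtain ⟨-, L, hL, hLT, hLN⟩ := hgrad u hu
    have hL' := hL.clm_comp (P a)
    refine ⟨⟨_, hL'⟩, LinearMap.ext fun α => ?_⟩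
    rw [rightGrad_apply hL']
    have hα : coord 𝕜 nS S α ∈ LinearMap.range (coordIncl iS).toLinearMap ⊔ N := by
      rw [hN.sup_eq_top]; trivial
    obtain ⟨_, ⟨β, rfl⟩, v, hv, hsum⟩ := Submodule.mem_sup.1 hα
    have hα' : α = iS.diff ((coord 𝕜 nT T).symm β) + (coord 𝕜 nS S).symm (⟨v, hv⟩ : N) := hsum.symm
    rw [hα', map_add, map_add, ContinuousLinearMap.comp_apply, ContinuousLinearMap.comp_apply,
      hLT, hLN, map_zero, zero_add, hP, hM.pairing_eq_zero (b a).2, zero_add]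

/-- A smooth function on `G × T` extends locally to `G × S`: it is constant along a slice. -/
theorem exists_extension (iS : LieSubgroup 𝕜 nT nS T S) {Φ : G × T → 𝕜}
    (hΦ : ContMDiffAt ((Model 𝕜 nG).prod (Model 𝕜 nT)) 𝓘(𝕜, 𝕜) ∞ Φ (g, u)) :
    ∃ F : G × S → 𝕜,
      ContMDiffAt ((Model 𝕜 nG).prod (Model 𝕜 nS)) 𝓘(𝕜, 𝕜) ∞ F (g, iS.hom u) ∧
      ∀ᶠ p in 𝓝 (g, u), F (inclQ iS.hom p) = Φ p := by
  obtain ⟨N, hN⟩ := Submodule.exists_isCompl (LinearMap.range (coordIncl iS).toLinearMap)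
  obtain ⟨U₀, W, τ, ξ, hU₀, hu, -, hW, -, hτ, -, himage, -, hgrad⟩ :=
    exists_slice iS N hN isOpen_univ isOpen_univ (Set.mapsTo_univ _ _) (Set.mem_univ u)
  have huW : iS.hom u ∈ W := (himage.subset ⟨u, hu, rfl⟩).1
  refine ⟨fun q => Φ (q.1, τ q.2), ?_, ?_⟩
  · have hΦ' : ContMDiffAt ((Model 𝕜 nG).prod (Model 𝕜 nT)) 𝓘(𝕜, 𝕜) ∞ Φ (g, τ (iS.hom u)) := by
      rwa [(hgrad u hu).1]
    exact ContMDiffAt.comp (g, iS.hom u) (f := fun q : G × S => (q.1, τ q.2)) hΦ'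
      (contMDiffAt_fst.prodMk
        (ContMDiffAt.comp (g, iS.hom u) (hτ.contMDiffAt (hW.mem_nhds huW)) contMDiffAt_snd))
  · filter_upwards [(continuous_snd.tendsto (g, u)) (hU₀.mem_nhds hu)] with p hp
    simp only [inclQ, (hgrad p.2 hp).1]

end LocalConstraints

/-! ### Smoothness of the reduced map -/

section Smoothness

variable {𝕜 : Type*} [RCLike 𝕜] {nG nK nS nD nH nT nE : ℕ}
  {G : Type*} [TopologicalSpace G] [ChartedSpace (EuclideanSpace 𝕜 (Fin nG)) G] [Group G]
  [LieGroup (Model 𝕜 nG) ∞ G]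
  {K : Type*} [TopologicalSpace K] [ChartedSpace (EuclideanSpace 𝕜 (Fin nK)) K] [Group K]
  [LieGroup (Model 𝕜 nK) ∞ K]
  {S : Type*} [TopologicalSpace S] [ChartedSpace (EuclideanSpace 𝕜 (Fin nS)) S] [Group S]
  [LieGroup (Model 𝕜 nS) ∞ S] [ConnectedSpace S]
  {D : Type*} [TopologicalSpace D] [ChartedSpace (EuclideanSpace 𝕜 (Fin nD)) D] [Group D]
  [LieGroup (Model 𝕜 nD) ∞ D]
  {H : Type*} [TopologicalSpace H] [ChartedSpace (EuclideanSpace 𝕜 (Fin nH)) H] [Group H]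
  [LieGroup (Model 𝕜 nH) ∞ H]
  {T : Type*} [TopologicalSpace T] [ChartedSpace (EuclideanSpace 𝕜 (Fin nT)) T] [Group T]
  [LieGroup (Model 𝕜 nT) ∞ T] [ConnectedSpace T]
  {E : Type*} [TopologicalSpace E] [ChartedSpace (EuclideanSpace 𝕜 (Fin nE)) E] [Group E]
  [LieGroup (Model 𝕜 nE) ∞ E]
  {d : DrinfeldDouble 𝕜 nK nS nD K S D} {i : LieSubgroup 𝕜 nH nK H K}
  {dH : DrinfeldDouble 𝕜 nH nT nE H T E} {iS : LieSubgroup 𝕜 nT nS T S}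
  {M : Submodule 𝕜 (LieAlg 𝕜 nK K)}
  {ι : Type*} [Fintype ι] [DecidableEq ι] {b : Module.Basis ι 𝕜 M}
  {j : LieSubgroup 𝕜 nK nG K G}
  {r : S → LieAlg 𝕜 nG G ⊗[𝕜] LieAlg 𝕜 nG G}

theorem contDiff_det : ContDiff 𝕜 ∞ (fun A : ι → ι → 𝕜 => (Matrix.of A).det) := by
  simp only [Matrix.det_apply']
  exact ContDiff.sum fun σ _ => contDiff_const.mul
    (contDiff_prod fun a _ => contDiff_apply_apply 𝕜 𝕜 (σ a) a)

theorem contDiffAt_matrix_inv {A : ι → ι → 𝕜} (hA : IsUnit (Matrix.of A).det) (p q : ι) :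
    ContDiffAt 𝕜 ∞ (fun A : ι → ι → 𝕜 => (Matrix.of A)⁻¹ p q) A := by
  have hadj : ContDiff 𝕜 ∞ (fun A : ι → ι → 𝕜 => (Matrix.of A).adjugate p q) := by
    simp only [Matrix.adjugate_apply]
    refine contDiff_det.comp
      (f := fun (A : ι → ι → 𝕜) a c => (Matrix.of A).updateRow q (Pi.single p 1) a c)
      (contDiff_pi.2 fun a => contDiff_pi.2 fun c => ?_)
    by_cases h : a = q
    · subst h
      simp only [Matrix.updateRow_self]
      exact contDiff_const
    · simp only [Matrix.updateRow_ne h]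
      exact contDiff_apply_apply 𝕜 𝕜 a c
  have hdet : ContDiffAt 𝕜 ∞ (fun A : ι → ι → 𝕜 => (Matrix.of A).det) A := contDiff_det.contDiffAt
  simp only [Matrix.inv_def, Ring.inverse_eq_inv', Matrix.smul_apply, smul_eq_mul]
  exact (hdet.inv hA.ne_zero).mul hadj.contDiffAt

theorem contMDiff_adK (d : DrinfeldDouble 𝕜 nK nS nD K S D) (X : LieAlg 𝕜 nK K) :
    ContMDiff (Model 𝕜 nS) (Model 𝕜 nD) ∞ (fun κ => coord 𝕜 nD D (d.adK κ X)) :=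
  (contMDiff_Ad (d.inK.diff X)).comp d.inS.smooth

theorem contMDiff_linear_adK (d : DrinfeldDouble 𝕜 nK nS nD K S D)
    (f : LieAlg 𝕜 nD D →ₗ[𝕜] 𝕜) (X : LieAlg 𝕜 nK K) :
    ContMDiff (Model 𝕜 nS) 𝓘(𝕜, 𝕜) ∞ (fun κ => f (d.adK κ X)) :=
  (LinearMap.toContinuousLinearMap (f ∘ₗ (coord 𝕜 nD D).symm.toLinearMap)).contDiff.contMDiff.comp
    (contMDiff_adK d X)

/-- The Poisson tensor of `K*` is smooth. -/
theorem contMDiff_poissonForm (d : DrinfeldDouble 𝕜 nK nS nD K S D) (X Y : LieAlg 𝕜 nK K) :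
    ContMDiff (Model 𝕜 nS) 𝓘(𝕜, 𝕜) ∞ (fun κ => poissonForm d κ X Y) := by
  let B : LinearMap.BilinForm 𝕜 (EuclideanSpace 𝕜 (Fin nD)) :=
    d.form.compl₁₂ (d.inK.diff ∘ₗ d.projK ∘ₗ (coord 𝕜 nD D).symm.toLinearMap)
      (coord 𝕜 nD D).symm.toLinearMap
  let B' : EuclideanSpace 𝕜 (Fin nD) →L[𝕜] EuclideanSpace 𝕜 (Fin nD) →L[𝕜] 𝕜 :=
    LinearMap.toContinuousLinearMap (LinearMap.toContinuousLinearMap.toLinearMap ∘ₗ B)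
  exact (B'.contDiff.contMDiff.comp (contMDiff_adK d X)).clm_apply (contMDiff_adK d Y)

/-- `ρ` and `r* = r + ρ` are smooth and skew where the constraint matrix is invertible. -/
theorem IsReductiveSplitting.isAdmissible_rStar (hM : IsReductiveSplitting d i iS M)
    (hpair : ∀ X α, dH.pairing X α = d.pairing (i.diff X) (iS.diff α))
    {U : Set T} {V : Set S} (hUV : Set.MapsTo iS.hom U V)
    (hr : IsAdmissible (𝕜 := 𝕜) (nG := nG) (nS := nS) V r)
    (hC : ∀ u ∈ U, IsUnit (constraintMatrix d hM.isCompl b (iS.hom u)).det) :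
    IsAdmissible (𝕜 := 𝕜) (nG := nG) (nS := nT) U (rStar d hM.isCompl b j iS r) where
  skew u hu := by
    have h1 := hr.skew _ (hUV hu)
    have h2 := hM.isSkew_rho hpair u (hC u hu)
    rw [IsSkew] at h1 h2 ⊢
    rw [rStar, map_add, h1, inclMM, ← TensorProduct.map_comm, h2]
    simp only [map_neg, neg_add]
  smooth α β := by
    simp only [rStar, map_add, ev2_inclMM_rho hM hpair, dotProduct, Matrix.mulVec]
    have hf : ∀ (φ : Module.Dual 𝕜 (LieAlg 𝕜 nG G)) a, ContMDiff (Model 𝕜 nT) 𝓘(𝕜, 𝕜) ∞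
        (fun u => φ (j.diff (d.projK (d.adK (iS.hom u) (b a))))) := fun φ a =>
      (contMDiff_linear_adK d (φ ∘ₗ j.diff ∘ₗ d.projK) (b a)).comp iS.smooth
    have hCs : ContMDiff (Model 𝕜 nT) 𝓘(𝕜, ι → ι → 𝕜) ∞
        (fun u p q => constraintMatrix d hM.isCompl b (iS.hom u) p q) := by
      refine contMDiff_pi_space.2 fun p => contMDiff_pi_space.2 fun q => ?_
      simp only [hM.constraintMatrix_apply hpair]
      exact (contMDiff_poissonForm d _ _).comp iS.smooth
    have hinv : ∀ p q, ContMDiffOn (Model 𝕜 nT) 𝓘(𝕜, 𝕜) ∞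
        (fun u => (constraintMatrix d hM.isCompl b (iS.hom u))⁻¹ p q) U := fun p q u hu =>
      ((contDiffAt_matrix_inv (hC u hu) p q).contMDiffAt.comp u hCs.contMDiffAt).contMDiffWithinAt
    refine ((hr.smooth α β).comp iS.smooth.contMDiffOn hUV).add (contMDiffOn_finsetSum fun p _ =>
      (hf α p).contMDiffOn.mul (contMDiffOn_finsetSum fun q _ =>
        (hinv p q).mul (hf β q).contMDiffOn))

end Smoothness

end PLDirac

end

theorem theorem3p6 {𝕜 : Type*} [RCLike 𝕜] {nG nK nS nD nH nT nE : ℕ}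
    -- the groups `G`, `K`, `S = K*` and `D = D(K, K*)`
    {G : Type*} [TopologicalSpace G] [ChartedSpace (EuclideanSpace 𝕜 (Fin nG)) G] [Group G]
    [LieGroup (PLDirac.Model 𝕜 nG) ∞ G] [ConnectedSpace G]
    {K : Type*} [TopologicalSpace K] [ChartedSpace (EuclideanSpace 𝕜 (Fin nK)) K] [Group K]
    [LieGroup (PLDirac.Model 𝕜 nK) ∞ K] [ConnectedSpace K]
    {S : Type*} [TopologicalSpace S] [ChartedSpace (EuclideanSpace 𝕜 (Fin nS)) S] [Group S]
    [LieGroup (PLDirac.Model 𝕜 nS) ∞ S] [ConnectedSpace S]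
    {D : Type*} [TopologicalSpace D] [ChartedSpace (EuclideanSpace 𝕜 (Fin nD)) D] [Group D]
    [LieGroup (PLDirac.Model 𝕜 nD) ∞ D]
    -- the groups `H`, `T = H*` and `E = D(H, H*)`
    {H : Type*} [TopologicalSpace H] [ChartedSpace (EuclideanSpace 𝕜 (Fin nH)) H] [Group H]
    [LieGroup (PLDirac.Model 𝕜 nH) ∞ H] [ConnectedSpace H]
    {T : Type*} [TopologicalSpace T] [ChartedSpace (EuclideanSpace 𝕜 (Fin nT)) T] [Group T]
    [LieGroup (PLDirac.Model 𝕜 nT) ∞ T] [ConnectedSpace T]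
    {E : Type*} [TopologicalSpace E] [ChartedSpace (EuclideanSpace 𝕜 (Fin nE)) E] [Group E]
    [LieGroup (PLDirac.Model 𝕜 nE) ∞ E]
    -- `H ⊆ K ⊆ G` is a chain of Poisson-Lie subgroups, with their duals and doubles
    (R : PLDirac.LieAlg 𝕜 nG G ⊗[𝕜] PLDirac.LieAlg 𝕜 nG G) (_hR : PLDirac.IsCoboundaryRMatrix R)
    (j : PLDirac.LieSubgroup 𝕜 nK nG K G) (d : PLDirac.DrinfeldDouble 𝕜 nK nS nD K S D)
    (_hK : PLDirac.IsPoissonLieSubgroup j d R)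
    (i : PLDirac.LieSubgroup 𝕜 nH nK H K) (dH : PLDirac.DrinfeldDouble 𝕜 nH nT nE H T E)
    (_hH : PLDirac.IsPoissonLieSubgroup (j.comp i) dH R)
    -- `H* ⊆ K*`, and the pairing of `ℋ*` with `ℋ` is the one of `𝒦*` with `𝒦`
    (iS : PLDirac.LieSubgroup 𝕜 nT nS T S)
    (_hpair : ∀ X α, dH.pairing X α = d.pairing (i.diff X) (iS.diff α))
    -- the structural conditions
    (M : Submodule 𝕜 (PLDirac.LieAlg 𝕜 nK K)) (hM : PLDirac.IsReductiveSplitting d i iS M)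
    {ι : Type*} [Fintype ι] [DecidableEq ι] (b : Module.Basis ι 𝕜 M)
    -- the dynamical `r`-matrix on the open set `V ⊆ K*`
    (V : Set S) (_hV : IsOpen V) (r : S → PLDirac.LieAlg 𝕜 nG G ⊗[𝕜] PLDirac.LieAlg 𝕜 nG G)
    (_hr : PLDirac.IsTriangularRMatrix j d R V r)
    -- the submanifold `U ⊆ H* ∩ V`, on which the constraint matrix is non-degenerate
    (U : Set T) (_hU : IsOpen U) (_hne : U.Nonempty) (_hUV : Set.MapsTo iS.hom U V)
    (_hC : ∀ u ∈ U, IsUnit (PLDirac.constraintMatrix d hM.isCompl b (iS.hom u)).det) :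
    -- `Q(U)` is locally cut out by constraints with `∇'ξ_a = M^a` and bracket matrix `C`, which is
    -- invertible by hypothesis: they are second class
    (∀ u₀ ∈ U, ∃ (U₀ : Set T) (W : Set S) (ξ : ι → S → 𝕜),
      IsOpen U₀ ∧ u₀ ∈ U₀ ∧ U₀ ⊆ U ∧ IsOpen W ∧ W ⊆ V ∧
      (∀ a, ContMDiffOn (PLDirac.Model 𝕜 nS) 𝓘(𝕜, 𝕜) ∞ (ξ a) W) ∧
      iS.hom '' U₀ = {κ | κ ∈ W ∧ ∀ a, ξ a κ = 0} ∧
      (Topology.IsEmbedding (fun x : U => iS.hom x) →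
        iS.hom '' U ∩ W = {κ | κ ∈ W ∧ ∀ a, ξ a κ = 0}) ∧
      (∀ a, ∀ u ∈ U₀, PLDirac.rightGrad 𝕜 nS (ξ a) (iS.hom u) = d.pairing (b a)) ∧
      ∀ (g : G), ∀ u ∈ U₀,
        PLDirac.bracketMatrix (PLDirac.qBracket j d R r) (fun a (q : G × S) => ξ a q.2)
          (g, iS.hom u) = PLDirac.constraintMatrix d hM.isCompl b (iS.hom u)) ∧
    -- every function on `Q(U)` extends locally to `Q(V)`
    (∀ (g : G), ∀ u ∈ U, ∀ Φ : G × T → 𝕜,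
      ContMDiffAt ((PLDirac.Model 𝕜 nG).prod (PLDirac.Model 𝕜 nT)) 𝓘(𝕜, 𝕜) ∞ Φ (g, u) →
      ∃ F : G × S → 𝕜,
        ContMDiffAt ((PLDirac.Model 𝕜 nG).prod (PLDirac.Model 𝕜 nS)) 𝓘(𝕜, 𝕜) ∞ F
          (g, iS.hom u) ∧
        ∀ᶠ p in 𝓝 (g, u), F (PLDirac.inclQ iS.hom p) = Φ p) ∧
    -- any regular constraints for `Q(U)` are second class, and the Dirac bracket that they define
    -- is the bracket of `Q(U)` given by `r*`
    (∀ (g : G), ∀ u ∈ U, ∀ Z : ι → G × S → 𝕜,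
      (∀ a, ContMDiffAt ((PLDirac.Model 𝕜 nG).prod (PLDirac.Model 𝕜 nS)) 𝓘(𝕜, 𝕜) ∞ (Z a)
        (g, iS.hom u)) →
      (∀ a, ∀ᶠ p in 𝓝 (g, u), Z a (PLDirac.inclQ iS.hom p) = 0) →
      LinearIndependent 𝕜 (fun a =>
        (PLDirac.rightGrad 𝕜 nG (fun x => Z a (x, iS.hom u)) g,
          PLDirac.rightGrad 𝕜 nS (fun κ => Z a (g, κ)) (iS.hom u))) →
      IsUnit (PLDirac.bracketMatrix (PLDirac.qBracket j d R r) Z (g, iS.hom u)).det ∧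
      ∀ (F₁ F₂ : G × S → 𝕜) (Φ₁ Φ₂ : G × T → 𝕜),
        ContMDiffAt ((PLDirac.Model 𝕜 nG).prod (PLDirac.Model 𝕜 nS)) 𝓘(𝕜, 𝕜) ∞ F₁
          (g, iS.hom u) →
        ContMDiffAt ((PLDirac.Model 𝕜 nG).prod (PLDirac.Model 𝕜 nS)) 𝓘(𝕜, 𝕜) ∞ F₂
          (g, iS.hom u) →
        (∀ᶠ p in 𝓝 (g, u), F₁ (PLDirac.inclQ iS.hom p) = Φ₁ p) →
        (∀ᶠ p in 𝓝 (g, u), F₂ (PLDirac.inclQ iS.hom p) = Φ₂ p) →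
        PLDirac.diracBracket (PLDirac.qBracket j d R r) Z F₁ F₂ (g, iS.hom u)
          = PLDirac.qBracket (j.comp i) dH R (PLDirac.rStar d hM.isCompl b j iS r) Φ₁ Φ₂
            (g, u)) ∧
    -- `ρ` takes values in `ℳ ∧ ℳ`, and `r*` is an admissible map to `𝒢 ∧ 𝒢`
    (∀ u ∈ U, PLDirac.IsSkew (PLDirac.rho d hM.isCompl b (iS.hom u))) ∧
    PLDirac.IsAdmissible (𝕜 := 𝕜) (nG := nG) (nS := nT) U
      (PLDirac.rStar d hM.isCompl b j iS r) := by
  refine ⟨fun u₀ hu₀ => ?_, fun g u _ Φ hΦ => PLDirac.exists_extension iS hΦ,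
    fun g u hu Z hZ hZ0 hli => ?_, fun u hu => hM.isSkew_rho _hpair u (_hC u hu),
    hM.isAdmissible_rStar _hpair _hUV _hr.toIsAdmissible _hC⟩
  · obtain ⟨U₀, W, ξ, hU₀, hu, hUU, hW, hWV, hξ, himage, hemb, hgrad⟩ :=
      hM.exists_constraints _hU _hV _hUV hu₀ b
    exact ⟨U₀, W, ξ, hU₀, hu, hUU, hW, hWV, hξ, himage, hemb, fun a u hu => (hgrad a u hu).2,
      fun g u hu => hM.bracketMatrix_eq _hpair (fun a => (hgrad a u hu).1)
        fun a => (hgrad a u hu).2⟩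
  · obtain ⟨hdet, h⟩ := hM.diracBracket_eq (j := j) (R := R) (r := r) _hpair (_hC u hu)
      (fun a => PLDirac.diffS_of_contMDiffAt (hZ a)) hZ0 hli
    exact ⟨hdet, fun F₁ F₂ Φ₁ Φ₂ hF₁ hF₂ =>
      h F₁ F₂ Φ₁ Φ₂ (PLDirac.diffS_of_contMDiffAt hF₁) (PLDirac.diffS_of_contMDiffAt hF₂)⟩
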